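/- All schemes are of finite type over a fixed field $k$, and embeddings are embeddings over $k$. For closed embeddings $Y\subset X\subset M$ with ideal sheaves $\mathcal J_{Y,X}\subset\mathcal O_X$ and $\mathcal J_{Y,M}\subset\mathcal O_M$, define the sheaf of graded $\mathcal O_X$-algebras $$\mathrm{qSym}_{X\subset M}(\mathcal J_{Y,X}) := \mathrm{Sym}_{\mathcal O_X}(\mathcal J_{Y,X})\otimes_{\mathrm{Sym}_{\mathcal O_M}(\mathcal J_{Y,M})}\mathrm{Rees}_{\mathcal O_M}(\mathcal J_{Y,M}),$$ where $\mathrm{Rees}_{\mathcal O_M}(\mathcal J)=\bigoplus_{n\ge 0}\mathcal J^n$. Closed embeddings $X\subset M\subset N$ induce an epimorphism $\mathrm{qSym}_{X\subset N}(\mathcal J_{Y,X})\to\mathrm{qSym}_{X\subset M}(\mathcal J_{Y,X})$. The (absolute) quasi-symmetric algebra of $\mathcal J_{Y,X}$ is the inverse limit of this system, in the category of sheaves of graded $\mathcal O_X$-algebras and degree-preserving homomorphisms, over all closed embeddings $X\subset M$: $$\mathrm{qSym}_{\mathcal O_X}(\mathcal J_{Y,X}) := \varprojlim_{M\supset X}\mathrm{qSym}_{X\subset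 M}(\mathcal J_{Y,X}).$$ **Theorem.** Let $Y\subset X\subset M$ be closed embeddings of schemes, with $M$ nonsingular (all local rings of $M$ are regular). Then the canonical homomorphism $$\mathrm{qSym}_{\mathcal O_X}(\mathcal J_{Y,X})\longrightarrow \mathrm{qSym}_{X\subset M}(\mathcal J_{Y,X})$$ is an isomorphism of sheaves of graded $\mathcal O_X$-algebras. Consequently $\mathrm{qSym}_{X\subset M}(\mathcal J_{Y,X})$ does not depend on the nonsingular ambient scheme $M$: for any two closed embeddings $X\subset M$ and $X\subset M'$ with $M$ and $M'$ nonsingular there is an isomorphism $\mathrm{qSym}_{X\subset M}(\mathcal J_{Y,X})\cong\mathrm{qSym}_{X\subset M'}(\mathcal J_{Y,X})$ of sheaves of graded $\mathcal O_X$-algebras that is compatible with the canonical homomorphisms from $\mathrm{qSym}_{\mathcal O_X}(\mathcal J_{Y,X})$. -/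

import Mathlib

universe u v w

namespace QuasiSym

noncomputable section

open TensorProduct Polynomial AlgebraicGeometry CategoryTheory TopologicalSpace

set_option linter.style.haveILetI false

section RingTensor

variable {P Q N : Type u} [CommRing P] [CommRing Q] [CommRing N] (f : P →+* Q) (g : P →+* N)

/-- The tensor product `Q ⊗[P] N` of the two `P`-algebras given by `f : P → Q` and `g : P → N`. -/
def RingTensor : Type u :=
  letI := f.toAlgebra
  letI := g.toAlgebra
  Q ⊗[P] N

namespace RingTensor

instance : CommRing (RingTensor f g) :=
  letI := f.toAlgebra
  letI := g.toAlgebra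
  (inferInstance : CommRing (Q ⊗[P] N))

/-- The homomorphism `x ↦ x ⊗ 1`. -/
def inl : Q →+* RingTensor f g :=
  letI := f.toAlgebra
  letI := g.toAlgebra
  (Algebra.TensorProduct.includeLeftRingHom : Q →+* Q ⊗[P] N)

/-- The homomorphism `y ↦ 1 ⊗ y`. -/
def inr : N →+* RingTensor f g :=
  letI := f.toAlgebra
  letI := g.toAlgebra
  (Algebra.TensorProduct.includeRight : N →ₐ[P] Q ⊗[P] N).toRingHom

theorem inl_apply_eq (z : P) : inl f g (f z) = inr f g (g z) := by
  letI := f.toAlgebra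
  letI := g.toAlgebra
  exact ((Algebra.TensorProduct.includeRight : N →ₐ[P] Q ⊗[P] N).commutes z).symm

variable {f g} {D : Type v} [CommRing D]

def lift (p : Q →+* D) (q : N →+* D) (h : ∀ z, p (f z) = q (g z)) : RingTensor f g →+* D :=
  letI := f.toAlgebra
  letI := g.toAlgebra
  letI := (p.comp f).toAlgebra
  (Algebra.TensorProduct.lift (R := P) (S := P) (A := Q) (B := N) (C := D)
    { p with commutes' := fun _ => rfl } { q with commutes' := fun z => (h z).symm }
    (fun _ _ => Commute.all _ _)).toRingHom

theorem lift_inl (p : Q →+* D) (q : N →+* D) (h : ∀ z, p (f z) = q (g z)) (x : Q) :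
    lift p q h (inl f g x) = p x := by
  letI := f.toAlgebra
  letI := g.toAlgebra
  letI := (p.comp f).toAlgebra
  refine (Algebra.TensorProduct.lift_tmul (R := P) (S := P) (A := Q) (B := N) (C := D)
    _ _ _ x 1).trans ?_
  rw [map_one, mul_one]; rfl

theorem lift_inr (p : Q →+* D) (q : N →+* D) (h : ∀ z, p (f z) = q (g z)) (x : N) :
    lift p q h (inr f g x) = q x := by
  letI := f.toAlgebra
  letI := g.toAlgebra
  letI := (p.comp f).toAlgebra
  refine (Algebra.TensorProduct.lift_tmul (R := P) (S := P) (A := Q) (B := N) (C := D)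
    _ _ _ 1 x).trans ?_
  rw [map_one, one_mul]; rfl

theorem induction {motive : RingTensor f g → Prop} (h₀ : motive 0)
    (hm : ∀ x y, motive (inl f g x * inr f g y))
    (ha : ∀ x y, motive x → motive y → motive (x + y)) (z : RingTensor f g) : motive z := by
  letI := f.toAlgebra
  letI := g.toAlgebra
  refine TensorProduct.induction_on (motive := motive) z h₀ (fun x y => ?_) ha
  have : (x ⊗ₜ[P] y : RingTensor f g) = inl f g x * inr f g y := by
    refine Eq.trans ?_ (Algebra.TensorProduct.tmul_mul_tmul x 1 1 y).symm
    rw [mul_one, one_mul]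
  exact this ▸ hm x y

theorem hom_ext {p q : RingTensor f g →+* D} (h₁ : ∀ x, p (inl f g x) = q (inl f g x))
    (h₂ : ∀ x, p (inr f g x) = q (inr f g x)) : p = q :=
  RingHom.ext fun z => induction (motive := fun z => p z = q z)
    (by rw [map_zero, map_zero]) (fun x y => by rw [map_mul, map_mul, h₁, h₂])
    (fun x y hx hy => by rw [map_add, map_add, hx, hy]) z

end RingTensor

end RingTensor

section Algebra

variable {R S T A B E : Type u} [CommRing R] [CommRing S] [CommRing T] [CommRing A] [CommRing B]
  [CommRing E]

/-- The homomorphism `Sym_R(I) → D` given by a homomorphism `ρ : R → D` and a `ρ`-semilinear map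
`f : I → D`. -/
def symLift {I : Ideal R} {D : Type v} [CommRing D] (ρ : R →+* D) (f : I →+ D)
    (h : ∀ (r : R) (x : I), f (r • x) = ρ r * f x) : SymmetricAlgebra R I →+* D :=
  letI := ρ.toAlgebra
  (SymmetricAlgebra.lift (R := R) (M := I) (A := D)
    { f with map_smul' := fun r x => (h r x).trans (Algebra.smul_def r (f x)).symm }).toRingHom

theorem symLift_algebraMap {I : Ideal R} {D : Type v} [CommRing D] (ρ : R →+* D) (f : I →+ D)
    (h : ∀ (r : R) (x : I), f (r • x) = ρ r * f x) (r : R) :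
    symLift ρ f h (algebraMap R _ r) = ρ r := by
  letI := ρ.toAlgebra
  exact AlgHom.commutes (SymmetricAlgebra.lift (R := R) (M := I) (A := D) _) r

theorem symLift_ι {I : Ideal R} {D : Type v} [CommRing D] (ρ : R →+* D) (f : I →+ D)
    (h : ∀ (r : R) (x : I), f (r • x) = ρ r * f x) (x : I) :
    symLift ρ f h (SymmetricAlgebra.ι R I x) = f x := by
  letI := ρ.toAlgebra
  exact SymmetricAlgebra.lift_ι_apply _ x

theorem sym_hom_ext {I : Ideal R} {D : Type v} [CommRing D] {f g : SymmetricAlgebra R I →+* D}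
    (h₀ : ∀ r, f (algebraMap R _ r) = g (algebraMap R _ r))
    (h₁ : ∀ x, f (SymmetricAlgebra.ι R I x) = g (SymmetricAlgebra.ι R I x)) : f = g :=
  RingHom.ext fun z => SymmetricAlgebra.induction R I (motive := fun z => f z = g z) h₀ h₁
    (fun a b ha hb => by rw [map_mul, map_mul, ha, hb])
    (fun a b ha hb => by rw [map_add, map_add, ha, hb]) z

/-- Functoriality of the symmetric algebra: `Sym_R(I) → Sym_S(J)` for `ρ : R → S` with `ρ(I) ⊆ J`. -/
def symMap (ρ : R →+* S) (I : Ideal R) (J : Ideal S) (h : I ≤ J.comap ρ) :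
    SymmetricAlgebra R I →+* SymmetricAlgebra S J :=
  symLift ((algebraMap S (SymmetricAlgebra S J)).comp ρ)
    { toFun := fun x => SymmetricAlgebra.ι S J ⟨ρ x, h x.2⟩
      map_zero' := (congrArg _ (Subtype.ext (map_zero ρ))).trans (map_zero _)
      map_add' := fun x y => by
        rw [← map_add]; exact congrArg _ (Subtype.ext (map_add ρ _ _)) }
    (fun r x => by
      change SymmetricAlgebra.ι S J _ = algebraMap S _ (ρ r) * SymmetricAlgebra.ι S J _
      rw [← Algebra.smul_def, ← map_smul]
      exact congrArg _ (Subtype.ext (map_mul ρ _ _)))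

theorem symMap_algebraMap (ρ : R →+* S) (I : Ideal R) (J : Ideal S) (h : I ≤ J.comap ρ) (r : R) :
    symMap ρ I J h (algebraMap R _ r) = algebraMap S _ (ρ r) :=
  symLift_algebraMap _ _ _ r

theorem symMap_ι (ρ : R →+* S) (I : Ideal R) (J : Ideal S) (h : I ≤ J.comap ρ) (x : I) :
    symMap ρ I J h (SymmetricAlgebra.ι R I x) = SymmetricAlgebra.ι S J ⟨ρ x, h x.2⟩ :=
  symLift_ι _ _ _ x

/-- Functoriality of the Rees algebra `⨁ Iⁿ tⁿ ⊆ R[t]`: the map `Rees_R(I) → Rees_S(J)` for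
`ρ : R → S` with `ρ(I) ⊆ J`. -/
def reesMap (ρ : R →+* S) (I : Ideal R) (J : Ideal S) (h : I ≤ J.comap ρ) :
    reesAlgebra I →+* reesAlgebra J :=
  ((Polynomial.mapRingHom ρ).comp (reesAlgebra I).val.toRingHom).codRestrict
    (reesAlgebra J).toSubring (fun f => by
      change Polynomial.map ρ (f : R[X]) ∈ reesAlgebra J
      intro n
      rw [Polynomial.coeff_map]
      have h1 : I.map ρ ≤ J := Ideal.map_le_iff_le_comap.2 h
      have h2 := Ideal.mem_map_of_mem ρ (f.2 n)
      rw [Ideal.map_pow] at h2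
      exact Ideal.pow_right_mono h1 n h2)

theorem coe_reesMap (ρ : R →+* S) (I : Ideal R) (J : Ideal S) (h : I ≤ J.comap ρ)
    (f : reesAlgebra I) : (reesMap ρ I J h f : S[X]) = (f : R[X]).map ρ := rfl

/-- The canonical homomorphism `Sym_R(I) → Rees_R(I)`, which sends `x ∈ I` to `x t`. -/
def symToRees (I : Ideal R) : SymmetricAlgebra R I →ₐ[R] reesAlgebra I :=
  SymmetricAlgebra.lift
    { toFun := fun x => ⟨monomial 1 (x : R), reesAlgebra.monomial_mem.2 (by simp)⟩
      map_add' := fun x y => by ext1; simp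
      map_smul' := fun r x => by ext1; simp [smul_monomial] }

theorem symToRees_ι (I : Ideal R) (x : I) :
    (symToRees I (SymmetricAlgebra.ι R I x) : R[X]) = monomial 1 (x : R) := by
  rw [symToRees, SymmetricAlgebra.lift_ι_apply]; rfl

theorem reesMap_symToRees (ρ : R →+* S) (I : Ideal R) (J : Ideal S) (h : I ≤ J.comap ρ)
    (z : SymmetricAlgebra R I) :
    reesMap ρ I J h (symToRees I z) = symToRees J (symMap ρ I J h z) := by
  have : (reesMap ρ I J h).comp (symToRees I).toRingHom
      = (symToRees J).toRingHom.comp (symMap ρ I J h) := by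
    refine sym_hom_ext (fun r => ?_) (fun x => ?_)
    · simp only [RingHom.comp_apply, AlgHom.toRingHom_eq_coe, RingHom.coe_coe, AlgHom.commutes, symMap_algebraMap]
      ext1
      rw [coe_reesMap]
      simp
    · simp only [RingHom.comp_apply, AlgHom.toRingHom_eq_coe, RingHom.coe_coe, symMap_ι]
      ext1
      rw [coe_reesMap, symToRees_ι, symToRees_ι, map_monomial]
  exact congrArg (fun f => f z) this

/-- The quasi-symmetric algebra of the ideal `a` of `A` with respect to `φ : R → A`:
`Sym_A(a) ⊗_{Sym_R(I)} Rees_R(I)`, where `I` is the inverse image of `a` in `R`. -/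
def QSym (φ : R →+* A) (a : Ideal A) : Type u :=
  RingTensor (symMap φ (a.comap φ) a le_rfl) (symToRees (a.comap φ)).toRingHom

instance (φ : R →+* A) (a : Ideal A) : CommRing (QSym φ a) :=
  (inferInstance : CommRing (RingTensor (symMap φ (a.comap φ) a le_rfl)
    (symToRees (a.comap φ)).toRingHom))

/-- The part of degree `n` of `Sym_S(J)`: the span of the products of `n` elements of `J`. -/
def symDeg (J : Ideal S) (n : ℕ) : Submodule S (SymmetricAlgebra S J) :=
  LinearMap.range (SymmetricAlgebra.ι S J) ^ n

theorem symMap_mem_symDeg (ρ : R →+* S) (I : Ideal R) (J : Ideal S) (h : I ≤ J.comap ρ) (n : ℕ)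
    {x : SymmetricAlgebra R I} (hx : x ∈ symDeg I n) : symMap ρ I J h x ∈ symDeg J n := by
  refine Submodule.pow_induction_on_left' (M := LinearMap.range (SymmetricAlgebra.ι R I))
    (C := fun n x _ => symMap ρ I J h x ∈ symDeg J n) (fun r => ?_) (fun x y i _ _ hx hy => ?_)
    (fun m hm i x _ hx => ?_) hx
  · rw [symMap_algebraMap, symDeg, pow_zero]
    exact Submodule.algebraMap_mem _
  · rw [map_add]; exact add_mem hx hy
  · obtain ⟨m, rfl⟩ := hm
    rw [map_mul, symMap_ι, symDeg, pow_succ']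
    exact Submodule.mul_mem_mul (LinearMap.mem_range_self _ _) hx

/-- The homogeneous element `c tⁿ` of `Rees_R(I)`, for `c ∈ Iⁿ`. -/
def reesMonomial (I : Ideal R) (n : ℕ) (c : R) (hc : c ∈ I ^ n) : reesAlgebra I :=
  ⟨monomial n c, reesAlgebra.monomial_mem.2 hc⟩

theorem map_mem_pow (ρ : R →+* S) (I : Ideal R) (J : Ideal S) (h : I ≤ J.comap ρ) {n : ℕ} {c : R}
    (hc : c ∈ I ^ n) : ρ c ∈ J ^ n := by
  have h2 := Ideal.mem_map_of_mem ρ hc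
  rw [Ideal.map_pow] at h2
  exact Ideal.pow_right_mono (Ideal.map_le_iff_le_comap.2 h) n h2

theorem reesMap_reesMonomial (ρ : R →+* S) (I : Ideal R) (J : Ideal S) (h : I ≤ J.comap ρ) (n : ℕ)
    (c : R) (hc : c ∈ I ^ n) :
    reesMap ρ I J h (reesMonomial I n c hc) =
      reesMonomial J n (ρ c) (map_mem_pow ρ I J h hc) :=
  Subtype.ext (by rw [coe_reesMap]; exact map_monomial ρ)

theorem reesMonomial_mul (I : Ideal R) (m n : ℕ) (c d : R) (hc : c ∈ I ^ m) (hd : d ∈ I ^ n) :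
    reesMonomial I m c hc * reesMonomial I n d hd =
      reesMonomial I (m + n) (c * d) (pow_add I m n ▸ Ideal.mul_mem_mul hc hd) :=
  Subtype.ext (monomial_mul_monomial m n c d)

/-- Auxiliary: a homomorphism whose values lie in the image of an injective one factors through it. -/
def factorHom {P Q N : Type*} [CommRing P] [CommRing Q] [CommRing N] (f : P →+* N) (g : Q →+* N)
    (hg : Function.Injective g) (h : ∀ x, ∃ y, g y = f x) : P →+* Q where
  toFun x := (h x).choose
  map_one' := hg (by rw [(h 1).choose_spec, map_one, map_one])
  map_zero' := hg (by rw [(h 0).choose_spec, map_zero, map_zero])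
  map_mul' x y := hg (by
    rw [(h (x * y)).choose_spec, map_mul, map_mul, (h x).choose_spec, (h y).choose_spec])
  map_add' x y := hg (by
    rw [(h (x + y)).choose_spec, map_add, map_add, (h x).choose_spec, (h y).choose_spec])

theorem factorHom_spec {P Q N : Type*} [CommRing P] [CommRing Q] [CommRing N] (f : P →+* N)
    (g : Q →+* N) (hg : Function.Injective g) (h : ∀ x, ∃ y, g y = f x) (x : P) :
    g (factorHom f g hg h x) = f x := (h x).choose_spec

/-- Auxiliary: the homomorphism `R[t] → R[t][X]` with `t ↦ t X`, which separates degrees. -/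
def polySplit : R[X] →+* R[X][X] := eval₂RingHom (Polynomial.C.comp Polynomial.C) (monomial 1 X)

theorem polySplit_monomial (n : ℕ) (c : R) :
    polySplit (monomial n c) = monomial n (monomial n c) := by
  rw [polySplit, coe_eval₂RingHom, eval₂_monomial, monomial_pow, one_mul, RingHom.comp_apply,
    C_mul_monomial, C_mul_X_pow_eq_monomial]

theorem exists_reesSplit (I : Ideal R) (f : reesAlgebra I) :
    ∃ g : (reesAlgebra I)[X], mapRingHom (algebraMap (reesAlgebra I) R[X]) g =
      (polySplit.comp (algebraMap (reesAlgebra I) R[X])) f := by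
  refine ⟨∑ n ∈ (f : R[X]).support,
    monomial n (reesMonomial I n ((f : R[X]).coeff n) ((mem_reesAlgebra_iff I _).1 f.2 n)), ?_⟩
  have h1 : polySplit (f : R[X]) =
      ∑ n ∈ (f : R[X]).support, monomial n (monomial n ((f : R[X]).coeff n)) := by
    conv_lhs => rw [(f : R[X]).as_sum_support]
    rw [map_sum]
    exact Finset.sum_congr rfl fun n _ => polySplit_monomial n _
  refine Eq.trans ?_ h1.symm
  rw [coe_mapRingHom, Polynomial.map_sum]
  refine Finset.sum_congr rfl fun n _ => ?_
  rw [map_monomial]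
  rfl

/-- Auxiliary: the homomorphism `Rees_R(I) → Rees_R(I)[X]` with `c tⁿ ↦ c tⁿ Xⁿ`. -/
def reesSplit (I : Ideal R) : reesAlgebra I →+* (reesAlgebra I)[X] :=
  factorHom (Q := (reesAlgebra I)[X]) (polySplit.comp (algebraMap (reesAlgebra I) R[X]))
    (mapRingHom (algebraMap (reesAlgebra I) R[X])) (map_injective _ Subtype.val_injective)
    (exists_reesSplit I)

theorem reesSplit_reesMonomial (I : Ideal R) (n : ℕ) (c : R) (hc : c ∈ I ^ n) :
    reesSplit I (reesMonomial I n c hc) = monomial n (reesMonomial I n c hc) := by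
  refine map_injective (algebraMap (reesAlgebra I) R[X]) Subtype.val_injective ?_
  refine (factorHom_spec (Q := (reesAlgebra I)[X]) _ _ _ (exists_reesSplit I) _).trans ?_
  rw [map_monomial]
  exact polySplit_monomial n c

namespace QSym

/-- The structure homomorphism `Sym_A(a) → qSym`. -/
def ofSym (φ : R →+* A) (a : Ideal A) : SymmetricAlgebra A a →+* QSym φ a := RingTensor.inl _ _

/-- The structure homomorphism `Rees_R(I) → qSym`. -/
def ofRees (φ : R →+* A) (a : Ideal A) : reesAlgebra (a.comap φ) →+* QSym φ a :=
  RingTensor.inr _ _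

/-- The structure of `A`-algebra of the quasi-symmetric algebra. -/
def algMap (φ : R →+* A) (a : Ideal A) : A →+* QSym φ a :=
  (ofSym φ a).comp (algebraMap A (SymmetricAlgebra A a))

variable {φ : R →+* A} {a : Ideal A} {ψ : S →+* B} {b : Ideal B} {χ : T →+* E} {c : Ideal E}

theorem comap_le (ρ : R →+* S) (σ : A →+* B) (h : ψ.comp ρ = σ.comp φ) (hab : a ≤ b.comap σ) :
    a.comap φ ≤ (b.comap ψ).comap ρ := fun x hx => by
  have h1 : σ (φ x) ∈ b := hab hx
  rw [← RingHom.comp_apply, ← h] at h1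
  exact h1

theorem symMap_symMap_comap (ρ : R →+* S) (σ : A →+* B) (h : ψ.comp ρ = σ.comp φ)
    (hab : a ≤ b.comap σ) (z : SymmetricAlgebra R (a.comap φ)) :
    symMap σ a b hab (symMap φ (a.comap φ) a le_rfl z) =
      symMap ψ (b.comap ψ) b le_rfl (symMap ρ _ _ (comap_le ρ σ h hab) z) := by
  refine congrArg (fun g : SymmetricAlgebra R (a.comap φ) →+* SymmetricAlgebra B b => g z)
    (sym_hom_ext (f := (symMap σ a b hab).comp (symMap φ (a.comap φ) a le_rfl))
      (g := (symMap ψ (b.comap ψ) b le_rfl).comp (symMap ρ _ _ (comap_le ρ σ h hab)))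
      (fun r => ?_) (fun x => ?_))
  · rw [RingHom.comp_apply, RingHom.comp_apply, symMap_algebraMap, symMap_algebraMap,
      symMap_algebraMap, symMap_algebraMap]
    exact congrArg _ (congrArg (fun g : R →+* B => g r) h).symm
  · rw [RingHom.comp_apply, RingHom.comp_apply, symMap_ι, symMap_ι, symMap_ι, symMap_ι]
    exact congrArg _ (Subtype.ext (congrArg (fun g : R →+* B => g x) h).symm)

theorem ofSym_symMap (y : SymmetricAlgebra R (a.comap φ)) :
    ofSym φ a (symMap φ (a.comap φ) a le_rfl y) = ofRees φ a (symToRees (a.comap φ) y) :=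
  RingTensor.inl_apply_eq _ _ y

/-- Functoriality of the quasi-symmetric algebra, for a commutative square from `φ : R → A` to
`ψ : S → B` such that `a` maps into `b`. -/
def map (ρ : R →+* S) (σ : A →+* B) (h : ψ.comp ρ = σ.comp φ) (hab : a ≤ b.comap σ) :
    QSym φ a →+* QSym ψ b :=
  RingTensor.lift ((ofSym ψ b).comp (symMap σ a b hab))
    ((ofRees ψ b).comp (reesMap ρ _ _ (comap_le ρ σ h hab)))
    (fun z => (congrArg (ofSym ψ b) (symMap_symMap_comap ρ σ h hab z)).trans
      ((ofSym_symMap _).trans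
        (congrArg (ofRees ψ b) (reesMap_symToRees ρ _ _ (comap_le ρ σ h hab) z).symm)))

variable (ρ : R →+* S) (σ : A →+* B) (h : ψ.comp ρ = σ.comp φ) (hab : a ≤ b.comap σ)

theorem map_ofSym (x) : map ρ σ h hab (ofSym φ a x) = ofSym ψ b (symMap σ a b hab x) :=
  RingTensor.lift_inl _ _ _ x

theorem map_ofRees (x) :
    map ρ σ h hab (ofRees φ a x) = ofRees ψ b (reesMap ρ _ _ (comap_le ρ σ h hab) x) :=
  RingTensor.lift_inr _ _ _ x

theorem map_algMap (x) : map ρ σ h hab (algMap φ a x) = algMap ψ b (σ x) :=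
  (map_ofSym ρ σ h hab _).trans (congrArg _ (symMap_algebraMap _ _ _ _ x))

theorem symMap_symMap (I : Ideal R) (J : Ideal S) (K : Ideal T) (ρ : R →+* S) (ρ' : S →+* T)
    (h : I ≤ J.comap ρ) (h' : J ≤ K.comap ρ') (h'' : I ≤ K.comap (ρ'.comp ρ))
    (z : SymmetricAlgebra R I) :
    symMap ρ' J K h' (symMap ρ I J h z) = symMap (ρ'.comp ρ) I K h'' z := by
  refine congrArg (fun g : SymmetricAlgebra R I →+* SymmetricAlgebra T K => g z)
    (sym_hom_ext (f := (symMap ρ' J K h').comp (symMap ρ I J h)) (fun r => ?_) (fun x => ?_))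
  · rw [RingHom.comp_apply, symMap_algebraMap, symMap_algebraMap, symMap_algebraMap]; rfl
  · rw [RingHom.comp_apply, symMap_ι, symMap_ι, symMap_ι]; rfl

theorem map_map (ρ' : S →+* T) (σ' : B →+* E) (h' : χ.comp ρ' = σ'.comp ψ)
    (hbc : b ≤ c.comap σ') (h'' : χ.comp (ρ'.comp ρ) = (σ'.comp σ).comp φ)
    (hac : a ≤ c.comap (σ'.comp σ)) (z : QSym φ a) :
    map ρ' σ' h' hbc (map ρ σ h hab z) = map (ρ'.comp ρ) (σ'.comp σ) h'' hac z := by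
  refine congrArg (fun g : QSym φ a →+* QSym χ c => g z)
    (RingTensor.hom_ext (p := (map ρ' σ' h' hbc).comp (map ρ σ h hab))
      (fun x => ?_) (fun x => ?_))
  · refine (congrArg (map ρ' σ' h' hbc) (map_ofSym ρ σ h hab x)).trans ?_
    refine (map_ofSym ρ' σ' h' hbc _).trans ?_
    refine Eq.trans ?_ (map_ofSym (ρ'.comp ρ) (σ'.comp σ) h'' hac x).symm
    exact congrArg _ (symMap_symMap a b c σ σ' hab hbc hac x)
  · refine (congrArg (map ρ' σ' h' hbc) (map_ofRees ρ σ h hab x)).trans ?_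
    refine (map_ofRees ρ' σ' h' hbc _).trans ?_
    refine Eq.trans ?_ (map_ofRees (ρ'.comp ρ) (σ'.comp σ) h'' hac x).symm
    exact congrArg _ (Subtype.ext (Polynomial.map_map _ _ _))

theorem map_map_of_eq {ρ' : S →+* T} {σ' : B →+* E} {ρ'' : R →+* T} {σ'' : A →+* E}
    (h' : χ.comp ρ' = σ'.comp ψ) (hbc : b ≤ c.comap σ') (h'' : χ.comp ρ'' = σ''.comp φ)
    (hac : a ≤ c.comap σ'') (e₁ : ρ'.comp ρ = ρ'') (e₂ : σ'.comp σ = σ'') (z : QSym φ a) :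
    map ρ' σ' h' hbc (map ρ σ h hab z) = map ρ'' σ'' h'' hac z := by
  subst e₁ e₂
  exact map_map ρ σ h hab ρ' σ' h' hbc h'' hac z

variable (φ a) in
/-- The part of degree `n` of the quasi-symmetric algebra, for the grading of the tensor product: it
is spanned by the `x ⊗ y` with `x`, `y` homogeneous of degrees of sum `n`. -/
def deg (n : ℕ) : AddSubgroup (QSym φ a) :=
  AddSubgroup.closure {z | ∃ i j, i + j = n ∧ ∃ x ∈ symDeg a i, ∃ r, ∃ hr : r ∈ a.comap φ ^ j,
    z = ofSym φ a x * ofRees φ a (reesMonomial _ j r hr)}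

theorem map_mem_deg {n : ℕ} {z : QSym φ a} (hz : z ∈ deg φ a n) :
    map ρ σ h hab z ∈ deg ψ b n := by
  suffices deg φ a n ≤ (deg ψ b n).comap (map ρ σ h hab).toAddMonoidHom from this hz
  refine (AddSubgroup.closure_le _).2 ?_
  rintro _ ⟨i, j, rfl, x, hx, r, hr, rfl⟩
  refine AddSubgroup.subset_closure ⟨i, j, rfl, _, symMap_mem_symDeg σ a b hab i hx, ρ r,
    map_mem_pow ρ _ _ (comap_le ρ σ h hab) hr, ?_⟩
  change map ρ σ h hab (_ * _) = _
  rw [map_mul, map_ofSym, map_ofRees, reesMap_reesMonomial]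

theorem algMap_mem_deg (x : A) : algMap φ a x ∈ deg φ a 0 := by
  refine AddSubgroup.subset_closure ⟨0, 0, rfl, algebraMap A _ x, ?_, 1, ?_, ?_⟩
  · rw [symDeg, pow_zero]; exact Submodule.algebraMap_mem _
  · rw [pow_zero, Ideal.one_eq_top]; trivial
  · have : reesMonomial (a.comap φ) 0 1 (by rw [pow_zero, Ideal.one_eq_top]; trivial) = 1 :=
      Subtype.ext rfl
    rw [this, map_one, mul_one]; rfl

theorem mul_mem_closure {G : Type*} [CommRing G] {s t w : Set G}
    (h : ∀ x ∈ s, ∀ y ∈ t, x * y ∈ w) {x y : G} (hx : x ∈ AddSubgroup.closure s)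
    (hy : y ∈ AddSubgroup.closure t) : x * y ∈ AddSubgroup.closure w := by
  suffices AddSubgroup.closure t ≤ (AddSubgroup.closure w).comap (AddMonoidHom.mulLeft x) from
    this hy
  refine (AddSubgroup.closure_le _).2 fun y' hy' => ?_
  suffices AddSubgroup.closure s ≤ (AddSubgroup.closure w).comap (AddMonoidHom.mulRight y') from
    this hx
  exact (AddSubgroup.closure_le _).2 fun x' hx' => AddSubgroup.subset_closure (h x' hx' y' hy')

theorem mul_mem_deg {m n : ℕ} {y z : QSym φ a} (hy : y ∈ deg φ a m) (hz : z ∈ deg φ a n) :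
    y * z ∈ deg φ a (m + n) := by
  refine mul_mem_closure ?_ hy hz
  rintro _ ⟨i, j, rfl, x, hx, r, hr, rfl⟩ _ ⟨i', j', rfl, x', hx', r', hr', rfl⟩
  refine ⟨i + i', j + j', by omega, x * x', ?_, r * r',
    pow_add (a.comap φ) j j' ▸ Ideal.mul_mem_mul hr hr', ?_⟩
  · rw [symDeg, pow_add]; exact Submodule.mul_mem_mul hx hx'
  · rw [map_mul (ofSym φ a), ← reesMonomial_mul _ j j' r r' hr hr', map_mul (ofRees φ a)]
    exact mul_mul_mul_comm _ _ _ _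

variable (φ a) in
/-- Auxiliary: the homomorphism on `Sym_A(a)` that multiplies the part of degree `n` by `Xⁿ`. -/
def splitSym : SymmetricAlgebra A a →+* (QSym φ a)[X] :=
  symLift (Polynomial.C.comp (algMap φ a))
    { toFun := fun x => monomial 1 (ofSym φ a (SymmetricAlgebra.ι A a x))
      map_zero' := by rw [map_zero, map_zero, map_zero]
      map_add' := fun x y => by rw [map_add, map_add, map_add] }
    (fun r x => by
      change monomial 1 (ofSym φ a (SymmetricAlgebra.ι A a (r • x))) =
        Polynomial.C (algMap φ a r) * monomial 1 (ofSym φ a (SymmetricAlgebra.ι A a x))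
      rw [C_mul_monomial, map_smul, Algebra.smul_def, map_mul]; rfl)

theorem splitSym_algebraMap (r : A) :
    splitSym φ a (algebraMap A _ r) = monomial 0 (ofSym φ a (algebraMap A _ r)) :=
  symLift_algebraMap _ _ _ r

theorem splitSym_ι (x : a) : splitSym φ a (SymmetricAlgebra.ι A a x) =
    monomial 1 (ofSym φ a (SymmetricAlgebra.ι A a x)) :=
  symLift_ι _ _ _ x

variable (φ a) in
/-- Auxiliary: the homomorphism on `Rees_R(I)` that multiplies the part of degree `n` by `Xⁿ`. -/
def splitRees : reesAlgebra (a.comap φ) →+* (QSym φ a)[X] :=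
  (mapRingHom (ofRees φ a)).comp (reesSplit (a.comap φ))

theorem splitRees_reesMonomial (n : ℕ) (c : R) (hc : c ∈ a.comap φ ^ n) :
    splitRees φ a (reesMonomial _ n c hc) = monomial n (ofRees φ a (reesMonomial _ n c hc)) := by
  rw [splitRees, RingHom.comp_apply, reesSplit_reesMonomial]
  exact map_monomial _

theorem splitSym_symMap (y : SymmetricAlgebra R (a.comap φ)) :
    splitSym φ a (symMap φ (a.comap φ) a le_rfl y) =
      splitRees φ a (symToRees (a.comap φ) y) := by
  refine congrArg (fun g : SymmetricAlgebra R (a.comap φ) →+* (QSym φ a)[X] => g y)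
    (sym_hom_ext (f := (splitSym φ a).comp (symMap φ (a.comap φ) a le_rfl))
      (g := (splitRees φ a).comp (symToRees (a.comap φ)).toRingHom) (fun r => ?_) (fun x => ?_))
  · have h2 : symToRees (a.comap φ) (algebraMap R _ r) =
      reesMonomial (a.comap φ) 0 r (by rw [pow_zero, Ideal.one_eq_top]; trivial) :=
      (AlgHom.commutes _ r).trans (Subtype.ext rfl)
    have h3 := ofSym_symMap (φ := φ) (a := a) (algebraMap R _ r)
    rw [symMap_algebraMap, h2] at h3
    change splitSym φ a (symMap φ _ a le_rfl _) = splitRees φ a (symToRees _ _)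
    rw [h2, splitRees_reesMonomial, symMap_algebraMap, splitSym_algebraMap, h3]
  · have h2 : symToRees (a.comap φ) (SymmetricAlgebra.ι R _ x) =
      reesMonomial (a.comap φ) 1 x (by rw [pow_one]; exact x.2) :=
      Subtype.ext (symToRees_ι _ x)
    have h3 := ofSym_symMap (φ := φ) (a := a) (SymmetricAlgebra.ι R _ x)
    rw [symMap_ι, h2] at h3
    change splitSym φ a (symMap φ _ a le_rfl _) = splitRees φ a (symToRees _ _)
    rw [h2, splitRees_reesMonomial, symMap_ι, splitSym_ι, h3]

variable (φ a) in
/-- Auxiliary: the homomorphism on the quasi-symmetric algebra that multiplies the part of degree `n`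
by `Xⁿ`; it shows that the parts of different degrees are independent. -/
def split : QSym φ a →+* (QSym φ a)[X] :=
  RingTensor.lift (splitSym φ a) (splitRees φ a) splitSym_symMap

theorem splitSym_of_mem {n : ℕ} {x : SymmetricAlgebra A a} (hx : x ∈ symDeg a n) :
    splitSym φ a x = monomial n (ofSym φ a x) := by
  refine Submodule.pow_induction_on_left' (M := LinearMap.range (SymmetricAlgebra.ι A a))
    (C := fun n x _ => splitSym φ a x = monomial n (ofSym φ a x)) (fun r => ?_)
    (fun x y i _ _ hx hy => ?_) (fun m hm i x _ hx => ?_) hx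
  · rw [splitSym_algebraMap]
  · rw [map_add, map_add, map_add, hx, hy]
  · obtain ⟨m, rfl⟩ := hm
    rw [map_mul (splitSym φ a), splitSym_ι, hx, map_mul (ofSym φ a), Nat.succ_eq_add_one,
      add_comm, ← monomial_mul_monomial]

theorem split_of_mem_deg {n : ℕ} {z : QSym φ a} (hz : z ∈ deg φ a n) :
    split φ a z = monomial n z := by
  refine AddSubgroup.closure_induction (p := fun z _ => split φ a z = monomial n z)
    ?_ (by rw [map_zero, map_zero]) (fun x y _ _ hx hy => by rw [map_add, map_add, hx, hy])
    (fun x _ hx => by rw [map_neg, map_neg, hx]) hz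
  rintro _ ⟨i, j, rfl, x, hx, r, hr, rfl⟩
  rw [map_mul (split φ a), ← monomial_mul_monomial]
  congr 1
  · exact (RingTensor.lift_inl _ _ _ x).trans (splitSym_of_mem hx)
  · exact (RingTensor.lift_inr _ _ _ _).trans (splitRees_reesMonomial _ _ _)

theorem deg_indep (t : Finset ℕ) (s : ℕ → QSym φ a) (hs : ∀ n, s n ∈ deg φ a n)
    (h₀ : ∑ n ∈ t, s n = 0) : ∀ n ∈ t, s n = 0 := by
  intro n hn
  have h1 := congrArg (fun z => (split φ a z).coeff n) h₀
  simp only [map_sum, split_of_mem_deg (hs _), finsetSum_coeff, coeff_monomial,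
    Finset.sum_ite_eq', hn, if_true, map_zero, coeff_zero] at h1
  exact h1

end QSym

end Algebra
/-- A sheaf of commutative graded `𝒪_X`-algebras: a sheaf of commutative rings with a homomorphism
from `𝒪_X` and subsheaves `deg d` of additive groups, such that the sheaf is the direct sum of these
subsheaves (every section is locally a finite sum of homogeneous ones, the sum is direct), with
`deg d * deg e ⊆ deg (d + e)` and with `𝒪_X` landing in degree `0`. -/
structure GradedAlgSheaf (X : Scheme.{u}) where
  sections : X.Opens → Type w
  [ring : ∀ U, CommRing (sections U)]
  algMap : ∀ U, Γ(X, U) →+* sections U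
  deg : ∀ U, ℕ → AddSubgroup (sections U)
  res : ∀ {U V : X.Opens}, V ≤ U → (sections U →+* sections V)
  res_refl : ∀ {U : X.Opens} (s : sections U), res le_rfl s = s
  res_res : ∀ {U V W : X.Opens} (h : V ≤ U) (h' : W ≤ V) (s : sections U),
    res h' (res h s) = res (h'.trans h) s
  res_algMap : ∀ {U V : X.Opens} (h : V ≤ U) (c : Γ(X, U)),
    res h (algMap U c) = algMap V (X.presheaf.map (homOfLE h).op c)
  res_mem_deg : ∀ {U V : X.Opens} (h : V ≤ U) {d : ℕ} {s : sections U},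
    s ∈ deg U d → res h s ∈ deg V d
  algMap_mem_deg : ∀ {U : X.Opens} (c : Γ(X, U)), algMap U c ∈ deg U 0
  mul_mem_deg : ∀ {U : X.Opens} {d e : ℕ} {s t : sections U},
    s ∈ deg U d → t ∈ deg U e → s * t ∈ deg U (d + e)
  sum_eq_zero : ∀ {U : X.Opens} (t : Finset ℕ) (s : ℕ → sections U), (∀ d, s d ∈ deg U d) →
    ∑ d ∈ t, s d = 0 → ∀ d ∈ t, s d = 0
  locally_mem_sum : ∀ {U : X.Opens} (s : sections U) (x : U),
    ∃ (V : X.Opens) (h : V ≤ U), (x : X) ∈ V ∧ res h s ∈ ⨆ d, deg V d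
  mem_deg_of_locally : ∀ {U : X.Opens} {d : ℕ} (s : sections U),
    (∀ x : U, ∃ (V : X.Opens) (h : V ≤ U), (x : X) ∈ V ∧ res h s ∈ deg V d) → s ∈ deg U d
  eq_of_locally : ∀ {U : X.Opens} (s t : sections U),
    (∀ x : U, ∃ (V : X.Opens) (h : V ≤ U), (x : X) ∈ V ∧ res h s = res h t) → s = t
  glue : ∀ {ι : Type u} (V : ι → X.Opens) (s : ∀ i, sections (V i)),
    (∀ i j, res (inf_le_left : V i ⊓ V j ≤ V i) (s i) = res (inf_le_right : V i ⊓ V j ≤ V j) (s j)) →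
    ∃ t : sections (⨆ i, V i), ∀ i, res (le_iSup V i) t = s i

attribute [instance] GradedAlgSheaf.ring

namespace GradedAlgSheaf

variable {X : Scheme.{u}}

/-- A homomorphism of sheaves of graded `𝒪_X`-algebras; it preserves the degree. -/
structure Hom (S : GradedAlgSheaf.{u, v} X) (T : GradedAlgSheaf.{u, w} X) where
  app : ∀ U, S.sections U →+* T.sections U
  app_algMap : ∀ U c, app U (S.algMap U c) = T.algMap U c
  app_mem_deg : ∀ U d s, s ∈ S.deg U d → app U s ∈ T.deg U d
  app_res : ∀ {U V : X.Opens} (h : V ≤ U) (s : S.sections U),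
    app V (S.res h s) = T.res h (app U s)

/-- A homomorphism is an isomorphism if it has a two-sided inverse homomorphism. -/
def Hom.IsIso {S : GradedAlgSheaf.{u, v} X} {T : GradedAlgSheaf.{u, w} X} (f : S.Hom T) : Prop :=
  ∃ g : T.Hom S, (∀ U s, g.app U (f.app U s) = s) ∧ ∀ U t, f.app U (g.app U t) = t

variable {F : X → Type w} [∀ x, CommRing (F x)]

/-- Restriction of functions `x ↦ s x ∈ F x` to a smaller open set. -/
def restrict {U V : X.Opens} (h : V ≤ U) : (∀ x : U, F x) →+* (∀ x : V, F x) where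
  toFun s x := s ⟨x, h x.2⟩
  map_one' := rfl
  map_zero' := rfl
  map_add' _ _ := rfl
  map_mul' _ _ := rfl

/-- The function that a section of `𝒪_X` defines through its germs. -/
def germwise (α : ∀ x, X.presheaf.stalk x →+* F x) (U : X.Opens) : Γ(X, U) →+* (∀ x : U, F x) :=
  RingHom.pi fun x => (α x).comp (X.presheaf.germ U x x.2).hom

/-- `P U d` is a subsheaf of the sheaf `U ↦ ∏_{x ∈ U} F x` for each `d`, and these are compatible with
multiplication, with the homomorphisms `α x : 𝒪_{X,x} → F x`, and independent. -/
structure IsHomogeneousSystem (α : ∀ x, X.presheaf.stalk x →+* F x)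
    (P : ∀ U : X.Opens, ℕ → AddSubgroup (∀ x : U, F x)) : Prop where
  restrict_mem : ∀ {U V : X.Opens} (h : V ≤ U) {d : ℕ} {s : ∀ x : U, F x},
    s ∈ P U d → restrict h s ∈ P V d
  mem_of_locally : ∀ {U : X.Opens} {d : ℕ} (s : ∀ x : U, F x),
    (∀ x : U, ∃ (V : X.Opens) (h : V ≤ U), (x : X) ∈ V ∧ restrict h s ∈ P V d) → s ∈ P U d
  germwise_mem : ∀ {U : X.Opens} (c : Γ(X, U)), germwise α U c ∈ P U 0
  mul_mem : ∀ {U : X.Opens} {d e : ℕ} {s t : ∀ x : U, F x},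
    s ∈ P U d → t ∈ P U e → s * t ∈ P U (d + e)
  sum_eq_zero : ∀ {U : X.Opens} (t : Finset ℕ) (s : ℕ → ∀ x : U, F x), (∀ d, s d ∈ P U d) →
    ∑ d ∈ t, s d = 0 → ∀ d ∈ t, s d = 0

variable {α : ∀ x, X.presheaf.stalk x →+* F x} {P : ∀ U : X.Opens, ℕ → AddSubgroup (∀ x : U, F x)}

theorem IsHomogeneousSystem.restrict_mem_iSup (hP : IsHomogeneousSystem α P) {U V : X.Opens}
    (h : V ≤ U) {s : ∀ x : U, F x} (hs : s ∈ ⨆ d, P U d) : restrict h s ∈ ⨆ d, P V d := by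
  suffices ⨆ d, P U d ≤ (⨆ d, P V d).comap (restrict h).toAddMonoidHom from this hs
  exact iSup_le fun d s hs => (le_iSup (P V) d) (hP.restrict_mem h hs)

theorem IsHomogeneousSystem.mul_mem_iSup (hP : IsHomogeneousSystem α P) {U : X.Opens}
    {s t : ∀ x : U, F x} (hs : s ∈ ⨆ d, P U d) (ht : t ∈ ⨆ d, P U d) :
    s * t ∈ ⨆ d, P U d := by
  rw [AddSubgroup.iSup_eq_closure] at *
  refine QSym.mul_mem_closure ?_ hs ht
  intro x hx y hy
  obtain ⟨d, hd⟩ := Set.mem_iUnion.1 hx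
  obtain ⟨e, he⟩ := Set.mem_iUnion.1 hy
  exact Set.mem_iUnion.2 ⟨d + e, hP.mul_mem hd he⟩

/-- The functions that are locally a finite sum of members of the `P V d`. -/
def locallySum (hP : IsHomogeneousSystem α P) (U : X.Opens) : Subring (∀ x : U, F x) where
  carrier := {s | ∀ x : U, ∃ (V : X.Opens) (h : V ≤ U), (x : X) ∈ V ∧
    restrict h s ∈ ⨆ d, P V d}
  mul_mem' {s t} hs ht x := by
    obtain ⟨V, h, hx, hV⟩ := hs x
    obtain ⟨W, h', hx', hW⟩ := ht x
    exact ⟨V ⊓ W, inf_le_left.trans h, ⟨hx, hx'⟩, hP.mul_mem_iSup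
      (hP.restrict_mem_iSup inf_le_left hV) (hP.restrict_mem_iSup inf_le_right hW)⟩
  add_mem' {s t} hs ht x := by
    obtain ⟨V, h, hx, hV⟩ := hs x
    obtain ⟨W, h', hx', hW⟩ := ht x
    exact ⟨V ⊓ W, inf_le_left.trans h, ⟨hx, hx'⟩, add_mem
      (hP.restrict_mem_iSup inf_le_left hV) (hP.restrict_mem_iSup inf_le_right hW)⟩
  one_mem' x := ⟨U, le_rfl, x.2, (le_iSup (P U) 0) (map_one (germwise α U) ▸ hP.germwise_mem 1)⟩
  zero_mem' x := ⟨U, le_rfl, x.2, zero_mem _⟩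
  neg_mem' {s} hs x := by
    obtain ⟨V, h, hx, hV⟩ := hs x
    exact ⟨V, h, hx, neg_mem hV⟩

theorem mem_locallySum (hP : IsHomogeneousSystem α P) {U : X.Opens} {d : ℕ} {s : ∀ x : U, F x}
    (hs : s ∈ P U d) : s ∈ locallySum hP U :=
  fun x => ⟨U, le_rfl, x.2, (le_iSup (P U) d) hs⟩

/-- The sheaf direct sum `⨁_d P d`, a sheaf of graded `𝒪_X`-algebras. -/
def ofHomogeneous (hP : IsHomogeneousSystem α P) : GradedAlgSheaf.{u, max u w} X where
  sections U := locallySum hP U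
  algMap U := (germwise α U).codRestrict (locallySum hP U) fun c =>
    mem_locallySum hP (hP.germwise_mem c)
  deg U d := (P U d).comap (locallySum hP U).subtype.toAddMonoidHom
  res {U V} h := ((restrict h).comp (locallySum hP U).subtype).codRestrict (locallySum hP V)
    fun (s : locallySum hP U) x => by
      obtain ⟨W, h', hx, hW⟩ := s.2 ⟨x, h x.2⟩
      exact ⟨V ⊓ W, inf_le_left, ⟨x.2, hx⟩, hP.restrict_mem_iSup inf_le_right hW⟩
  res_refl _ := rfl
  res_res _ _ _ := rfl
  res_algMap {U V} h c := by
    refine Subtype.ext (funext fun x => ?_)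
    exact congrArg (α x) (X.presheaf.germ_res_apply (homOfLE h) x x.2 c).symm
  res_mem_deg h _ _ hs := hP.restrict_mem h hs
  algMap_mem_deg c := hP.germwise_mem c
  mul_mem_deg hs ht := hP.mul_mem hs ht
  sum_eq_zero {U} t s hs h₀ d hd := by
    refine Subtype.ext (hP.sum_eq_zero t (fun d => (s d : ∀ x : U, F x)) hs ?_ d hd)
    have := congrArg (locallySum hP U).subtype h₀
    rwa [map_sum, map_zero] at this
  locally_mem_sum {U} s x := by
    obtain ⟨V, h, hx, hV⟩ := s.2 x
    refine ⟨V, h, hx, ?_⟩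
    suffices H : ∀ t (ht : t ∈ locallySum hP V), t ∈ ⨆ d, P V d → (⟨t, ht⟩ : locallySum hP V) ∈
      ⨆ d, (P V d).comap (locallySum hP V).subtype.toAddMonoidHom from H _ _ hV
    intro t ht ht'
    have h1 : ⨆ d, P V d ≤ (⨆ d, (P V d).comap (locallySum hP V).subtype.toAddMonoidHom).map
        (locallySum hP V).subtype.toAddMonoidHom :=
      iSup_le fun d s hs => ⟨⟨s, mem_locallySum hP hs⟩,
        (le_iSup (fun d => (P V d).comap (locallySum hP V).subtype.toAddMonoidHom) d) hs, rfl⟩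
    obtain ⟨t', ht1, ht2⟩ := h1 ht'
    have : t' = ⟨t, ht⟩ := Subtype.ext ht2
    exact this ▸ ht1
  mem_deg_of_locally s hs := hP.mem_of_locally _ hs
  eq_of_locally s t h := by
    refine Subtype.ext (funext fun x => ?_)
    obtain ⟨V, hV, hx, e⟩ := h x
    exact congrFun (congrArg Subtype.val e) ⟨x, hx⟩
  glue {ι} V s h := by
    have hc : ∀ x : (⨆ i, V i : X.Opens), ∃ i, (x : X) ∈ V i := fun x => Opens.mem_iSup.1 x.2
    have he : ∀ i (x : V i) (j) (hj : (x : X) ∈ V j),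
        (s j : ∀ x : V j, F x) ⟨x, hj⟩ = (s i : ∀ x : V i, F x) x := fun i x j hj =>
      congrFun (congrArg Subtype.val (h j i)) ⟨x, hj, x.2⟩
    let t : ∀ x : (⨆ i, V i : X.Opens), F x := fun x =>
      (s (hc x).choose : ∀ y : V (hc x).choose, F y) ⟨x, (hc x).choose_spec⟩
    suffices ht : t ∈ locallySum hP (⨆ i, V i) from
      ⟨⟨t, ht⟩, fun i => Subtype.ext (funext fun x => he i x _ _)⟩
    intro x
    obtain ⟨i, hi⟩ := hc x
    obtain ⟨W, hW, hx, hs⟩ := (s i).2 ⟨x, hi⟩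
    refine ⟨W, hW.trans (le_iSup V i), hx, ?_⟩
    convert hs using 1
    exact funext fun y => he i ⟨y, hW y.2⟩ _ _

end GradedAlgSheaf


section Geometry

variable {Y X M N : Scheme.{u}}

/-- The sections over `U` of the ideal sheaf of `Y` in `X`: the functions that vanish on `Y`. -/
def idealOn (j : Y ⟶ X) (U : X.Opens) : Ideal Γ(X, U) := RingHom.ker (j.app U).hom

/-- The stalk at `x` of the ideal sheaf of `Y` in `X`. -/
def idealAt (j : Y ⟶ X) (x : X) : Ideal (X.presheaf.stalk x) :=
  ⨆ (U : X.Opens) (hx : x ∈ U), (idealOn j U).map (X.presheaf.germ U x hx).hom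

theorem idealOn_le_res (j : Y ⟶ X) {U V : X.Opens} (h : V ≤ U) :
    idealOn j U ≤ (idealOn j V).comap (X.presheaf.map (homOfLE h).op).hom := fun c hc => by
  have h1 : j.app U c = 0 := hc
  change j.app V (X.presheaf.map (homOfLE h).op c) = 0
  have h2 := ConcreteCategory.congr_hom (j.naturality (homOfLE h).op) c
  rw [CommRingCat.comp_apply, CommRingCat.comp_apply, h1, map_zero] at h2
  exact h2

theorem idealOn_le_idealAt (j : Y ⟶ X) {U : X.Opens} {x : X} (hx : x ∈ U) :
    idealOn j U ≤ (idealAt j x).comap (X.presheaf.germ U x hx).hom :=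
  Ideal.map_le_iff_le_comap.1
    (le_iSup₂ (f := fun (U : X.Opens) (hx : x ∈ U) =>
      (idealOn j U).map (X.presheaf.germ U x hx).hom) U hx)

variable (j : Y ⟶ X) (i : X ⟶ M)

/-- The value on the open set `W` of `M` of the presheaf
`Sym_{𝒪_X}(𝒥_{Y,X}) ⊗_{Sym_{𝒪_M}(𝒥_{Y,M})} Rees_{𝒪_M}(𝒥_{Y,M})`, formed with the rings of sections
over `W` and over `X ∩ W`; the ideal of `Y` in `𝒪_M(W)` is the inverse image of that in
`𝒪_X(X ∩ W)`. -/
def QSymOn (W : M.Opens) : Type u := QSym (i.app W).hom (idealOn j (i ⁻¹ᵁ W))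

instance (W : M.Opens) : CommRing (QSymOn j i W) :=
  (inferInstance : CommRing (QSym (i.app W).hom (idealOn j (i ⁻¹ᵁ W))))

/-- The part of degree `d` of `QSymOn`. -/
def QSymOn.deg (W : M.Opens) (d : ℕ) : AddSubgroup (QSymOn j i W) :=
  QSym.deg (i.app W).hom (idealOn j (i ⁻¹ᵁ W)) d

/-- The stalk at the point `x` of `X` of the presheaf `QSymOn` (symmetric algebras, Rees algebras and
tensor products commute with direct limits): the quasi-symmetric algebra of the stalk of `𝒥_{Y,X}`
with respect to `𝒪_{M,x} → 𝒪_{X,x}`. -/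
def QSymAt (x : X) : Type u := QSym (i.stalkMap x).hom (idealAt j x)

instance (x : X) : CommRing (QSymAt j i x) :=
  (inferInstance : CommRing (QSym (i.stalkMap x).hom (idealAt j x)))

/-- The part of degree `d` of `QSymAt`. -/
def QSymAt.deg (x : X) (d : ℕ) : AddSubgroup (QSymAt j i x) :=
  QSym.deg (i.stalkMap x).hom (idealAt j x) d

/-- The restriction maps of the presheaf `QSymOn`. -/
def qsymRes {W W' : M.Opens} (h : W' ≤ W) : QSymOn j i W →+* QSymOn j i W' :=
  QSym.map (M.presheaf.map (homOfLE h).op).hom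
    (X.presheaf.map (homOfLE (i.preimage_mono h)).op).hom
    (congrArg CommRingCat.Hom.hom (i.naturality (homOfLE h).op))
    (idealOn_le_res j (i.preimage_mono h))

/-- The germ at `x` of a section over `W`. -/
def qsymGerm (W : M.Opens) (x : X) (hx : i x ∈ W) : QSymOn j i W →+* QSymAt j i x :=
  QSym.map (M.presheaf.germ W (i x) hx).hom (X.presheaf.germ (i ⁻¹ᵁ W) x hx).hom
    (congrArg CommRingCat.Hom.hom (i.germ_stalkMap W x hx)) (idealOn_le_idealAt j _)

theorem qsymGerm_res {W W' : M.Opens} (h : W' ≤ W) (x : X) (hx : i x ∈ W') (t : QSymOn j i W) :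
    qsymGerm j i W' x hx (qsymRes j i h t) = qsymGerm j i W x (h hx) t := by
  have e1 : (M.presheaf.germ W' (i x) hx).hom.comp (M.presheaf.map (homOfLE h).op).hom =
      (M.presheaf.germ W (i x) (h hx)).hom :=
    congrArg CommRingCat.Hom.hom (M.presheaf.germ_res (homOfLE h) (i x) hx)
  have e2 : (X.presheaf.germ (i ⁻¹ᵁ W') x hx).hom.comp
      (X.presheaf.map (homOfLE (i.preimage_mono h)).op).hom =
      (X.presheaf.germ (i ⁻¹ᵁ W) x (h hx)).hom :=
    congrArg CommRingCat.Hom.hom (X.presheaf.germ_res (homOfLE (i.preimage_mono h)) x hx)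
  exact QSym.map_map_of_eq _ _ _ _ _ _ _ _ e1 e2 t

theorem qsymRes_mem_deg {W W' : M.Opens} (h : W' ≤ W) {d : ℕ} {t : QSymOn j i W}
    (ht : t ∈ QSymOn.deg j i W d) : qsymRes j i h t ∈ QSymOn.deg j i W' d :=
  QSym.map_mem_deg _ _ _ _ ht

theorem QSymOn.mul_mem_deg {W : M.Opens} {d e : ℕ} {t t' : QSymOn j i W}
    (ht : t ∈ QSymOn.deg j i W d) (ht' : t' ∈ QSymOn.deg j i W e) :
    t * t' ∈ QSymOn.deg j i W (d + e) :=
  QSym.mul_mem_deg ht ht'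

theorem QSymAt.sum_eq_zero {x : X} (t : Finset ℕ) (s : ℕ → QSymAt j i x)
    (hs : ∀ d, s d ∈ QSymAt.deg j i x d) (h₀ : ∑ d ∈ t, s d = 0) : ∀ d ∈ t, s d = 0 :=
  QSym.deg_indep t s hs h₀

theorem qsymGerm_mem_deg (W : M.Opens) (x : X) (hx : i x ∈ W) {d : ℕ} {t : QSymOn j i W}
    (ht : t ∈ QSymOn.deg j i W d) : qsymGerm j i W x hx t ∈ QSymAt.deg j i x d :=
  QSym.map_mem_deg _ _ _ _ ht

/-- The sheaf associated with the part of degree `d` of the presheaf `QSymOn`, as a sheaf on `X`: the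
functions with values in the stalks which are locally the germs of an element of degree `d`. -/
def homogeneousSections (U : X.Opens) (d : ℕ) : AddSubgroup (∀ x : U, QSymAt j i x) where
  carrier := {s | ∀ x : U, ∃ W : M.Opens, i x ∈ W ∧
    ∃ t ∈ QSymOn.deg j i W d,
      ∀ (y : U) (hy : i y ∈ W), s y = qsymGerm j i W y hy t}
  add_mem' {s s'} hs hs' x := by
    obtain ⟨W, hx, t, ht, h⟩ := hs x
    obtain ⟨W', hx', t', ht', h'⟩ := hs' x
    refine ⟨W ⊓ W', ⟨hx, hx'⟩, qsymRes j i inf_le_left t + qsymRes j i inf_le_right t',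
      add_mem (qsymRes_mem_deg j i _ ht) (qsymRes_mem_deg j i _ ht'), fun y hy => ?_⟩
    rw [map_add, qsymGerm_res, qsymGerm_res, ← h y hy.1, ← h' y hy.2]
    rfl
  zero_mem' x := ⟨⊤, trivial, 0, zero_mem _, fun y hy => (map_zero _).symm⟩
  neg_mem' {s} hs x := by
    obtain ⟨W, hx, t, ht, h⟩ := hs x
    exact ⟨W, hx, -t, neg_mem ht, fun y hy => by rw [map_neg, ← h y hy]; rfl⟩

/-- The structure of `𝒪_{X,x}`-algebra of the stalk. -/
def stalkAlgMap (x : X) : X.presheaf.stalk x →+* QSymAt j i x :=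
  QSym.algMap (i.stalkMap x).hom (idealAt j x)

theorem homogeneousSections_mem_deg {U : X.Opens} {d : ℕ} {s : ∀ x : U, QSymAt j i x}
    (hs : s ∈ homogeneousSections j i U d) (x : U) :
    s x ∈ QSymAt.deg j i x d := by
  obtain ⟨W, hx, t, ht, h⟩ := hs x
  rw [h x hx]
  exact qsymGerm_mem_deg j i W x hx ht

theorem exists_preimage_le [IsClosedImmersion i] {U : X.Opens} {x : X} (hx : x ∈ U) :
    ∃ W : M.Opens, i x ∈ W ∧ i ⁻¹ᵁ W ≤ U := by
  obtain ⟨W, hW, e⟩ := i.isClosedEmbedding.isInducing.isOpen_iff.1 U.isOpen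
  have hm : ∀ y, i y ∈ W ↔ y ∈ U := fun y => by
    rw [← SetLike.mem_coe, ← e]; rfl
  exact ⟨⟨W, hW⟩, (hm x).2 hx, fun y hy => (hm y).1 hy⟩

theorem isHomogeneousSystem [IsClosedImmersion i] :
    GradedAlgSheaf.IsHomogeneousSystem (F := QSymAt j i) (stalkAlgMap j i)
      (homogeneousSections j i) where
  restrict_mem {U V} h {d s} hs x := by
    obtain ⟨W, hx, t, ht, e⟩ := hs ⟨x, h x.2⟩
    exact ⟨W, hx, t, ht, fun y hy => e ⟨y, h y.2⟩ hy⟩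
  mem_of_locally {U d} s hs x := by
    obtain ⟨V, hV, hx, h⟩ := hs x
    obtain ⟨W, hxW, t, ht, e⟩ := h ⟨x, hx⟩
    obtain ⟨W', hxW', hW'⟩ := exists_preimage_le i hx
    refine ⟨W ⊓ W', ⟨hxW, hxW'⟩, qsymRes j i inf_le_left t, qsymRes_mem_deg j i _ ht,
      fun y hy => ?_⟩
    rw [qsymGerm_res]
    exact e ⟨y, hW' hy.2⟩ hy.1
  germwise_mem {U} c x := by
    obtain ⟨W, hxW, hW⟩ := exists_preimage_le i x.2
    refine ⟨W, hxW, QSym.algMap _ _ (X.presheaf.map (homOfLE hW).op c),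
      QSym.algMap_mem_deg _, fun y hy => ?_⟩
    refine Eq.trans ?_ (QSym.map_algMap _ _ _ _ _).symm
    exact congrArg (stalkAlgMap j i y)
      (X.presheaf.germ_res_apply (homOfLE hW) y.1 hy c).symm
  mul_mem {U d e s s'} hs hs' x := by
    obtain ⟨W, hx, t, ht, h⟩ := hs x
    obtain ⟨W', hx', t', ht', h'⟩ := hs' x
    refine ⟨W ⊓ W', ⟨hx, hx'⟩, qsymRes j i inf_le_left t * qsymRes j i inf_le_right t',
      QSymOn.mul_mem_deg j i (qsymRes_mem_deg j i _ ht) (qsymRes_mem_deg j i _ ht'),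
      fun y hy => ?_⟩
    rw [map_mul, qsymGerm_res, qsymGerm_res, ← h y hy.1, ← h' y hy.2]
    rfl
  sum_eq_zero {U} t s hs h₀ d hd := funext fun x =>
    QSymAt.sum_eq_zero j i t (fun d => s d x) (fun d => homogeneousSections_mem_deg j i (hs d) x)
      (by rw [← Finset.sum_apply, h₀]; rfl) d hd

/-- The quasi-symmetric algebra `qSym_{X ⊂ M}(𝒥_{Y,X})`, a sheaf of graded `𝒪_X`-algebras, for closed
embeddings `j : Y → X` and `i : X → M`. -/
def qSym [IsClosedImmersion i] : GradedAlgSheaf.{u, u} X :=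
  GradedAlgSheaf.ofHomogeneous (isHomogeneousSystem j i)

variable {i} {i' : X ⟶ N} {f : M ⟶ N}

/-- The map `𝒪_{N,x} → 𝒪_{M,x}` of stalks at a point `x` of `X`, for `f : M → N` under `X`. -/
def ambientStalkMap (w : i ≫ f = i') (x : X) :
    N.presheaf.stalk (i' x) →+* M.presheaf.stalk (i x) :=
  ((N.presheaf.stalkCongr (.of_eq (by rw [← w]; rfl))).hom ≫ f.stalkMap (i x)).hom

theorem stalkMap_comp_ambientStalkMap (w : i ≫ f = i') (x : X) :
    (i.stalkMap x).hom.comp (ambientStalkMap w x) =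
      (RingHom.id _).comp (i'.stalkMap x).hom := by
  subst w
  have e : N.presheaf.stalkCongr (.of_eq (rfl : f (i x) = f (i x))) = Iso.refl _ := by
    ext1; simp
  have e2 : f.stalkMap (i x) ≫ i.stalkMap x = (i ≫ f).stalkMap x :=
    (Scheme.Hom.stalkMap_comp i f x).symm
  refine Eq.trans ?_ (congrArg CommRingCat.Hom.hom e2)
  change (((N.presheaf.stalkCongr (.of_eq (rfl : f (i x) = f (i x)))).hom ≫
    f.stalkMap (i x)) ≫ i.stalkMap x).hom = _
  rw [e, Iso.refl_hom, Category.id_comp]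
  rfl

/-- The map on stalks induced by a morphism `f : M → N` under `X`. -/
def qsymTransition (w : i ≫ f = i') (x : X) : QSymAt j i' x →+* QSymAt j i x :=
  QSym.map (ambientStalkMap w x) (RingHom.id _) (stalkMap_comp_ambientStalkMap w x) le_rfl

theorem ambientStalkMap_comp_germ (i : X ⟶ M) (f : M ⟶ N) (W : N.Opens) (y : X)
    (hy : f (i y) ∈ W) :
    (ambientStalkMap (rfl : i ≫ f = i ≫ f) y).comp (N.presheaf.germ W ((i ≫ f) y) hy).hom =
      (M.presheaf.germ (f ⁻¹ᵁ W) (i y) hy).hom.comp (f.app W).hom := by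
  have e : N.presheaf.stalkCongr (.of_eq (rfl : f (i y) = f (i y))) = Iso.refl _ := by
    ext1; simp
  refine Eq.trans ?_ (congrArg CommRingCat.Hom.hom (f.germ_stalkMap W (i y) hy))
  change (N.presheaf.germ W (f (i y)) hy ≫ (N.presheaf.stalkCongr
    (.of_eq (rfl : f (i y) = f (i y)))).hom ≫ f.stalkMap (i y)).hom = _
  rw [e, Iso.refl_hom, Category.id_comp]

/-- The map on sections of the presheaves induced by a morphism `f : M → N` under `X`. -/
def qsymPull (i : X ⟶ M) (f : M ⟶ N) (W : N.Opens) :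
    QSymOn j (i ≫ f) W →+* QSymOn j i (f ⁻¹ᵁ W) :=
  QSym.map (f.app W).hom (RingHom.id Γ(X, (i ≫ f) ⁻¹ᵁ W))
    (congrArg CommRingCat.Hom.hom (Scheme.Hom.comp_app i f W).symm) le_rfl

theorem qsymTransition_germ (i : X ⟶ M) (f : M ⟶ N) (W : N.Opens) (y : X) (hy : f (i y) ∈ W)
    (t : QSymOn j (i ≫ f) W) :
    qsymTransition j (rfl : i ≫ f = i ≫ f) y (qsymGerm j (i ≫ f) W y hy t) =
      qsymGerm j i (f ⁻¹ᵁ W) y hy (qsymPull j i f W t) := by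
  have e₂ : (RingHom.id (X.presheaf.stalk y)).comp
      (X.presheaf.germ ((i ≫ f) ⁻¹ᵁ W) y hy).hom =
      (X.presheaf.germ (i ⁻¹ᵁ f ⁻¹ᵁ W) y hy).hom.comp (RingHom.id _) := rfl
  have h₀ : (i.stalkMap y).hom.comp ((M.presheaf.germ (f ⁻¹ᵁ W) (i y) hy).hom.comp
      (f.app W).hom) = ((X.presheaf.germ (i ⁻¹ᵁ f ⁻¹ᵁ W) y hy).hom.comp (RingHom.id _)).comp
      ((i ≫ f).app W).hom := by
    rw [← ambientStalkMap_comp_germ, ← RingHom.comp_assoc, stalkMap_comp_ambientStalkMap]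
    exact congrArg CommRingCat.Hom.hom ((i ≫ f).germ_stalkMap W y hy)
  refine (QSym.map_map_of_eq _ _ _ _ _ _ h₀ (idealOn_le_idealAt j _)
    (ambientStalkMap_comp_germ i f W y hy) e₂ t).trans ?_
  exact (QSym.map_map_of_eq _ _ _ _ _ _ h₀ (idealOn_le_idealAt j _) rfl rfl t).symm

theorem qsymTransition_mem (w : i ≫ f = i') {U : X.Opens} {d : ℕ} {s : ∀ x : U, QSymAt j i' x}
    (hs : s ∈ homogeneousSections j i' U d) :
    (fun x : U => qsymTransition j w x (s x)) ∈ homogeneousSections j i U d := by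
  subst w
  intro x
  obtain ⟨W, hx, t, ht, h⟩ := hs x
  refine ⟨f ⁻¹ᵁ W, hx, qsymPull j i f W t, QSym.map_mem_deg _ _ _ _ ht, fun y hy => ?_⟩
  exact (congrArg _ (h y hy)).trans (qsymTransition_germ j i f W y hy t)

theorem qsymTransition_stalkAlgMap (w : i ≫ f = i') (x : X) (c : X.presheaf.stalk x) :
    qsymTransition j w x (stalkAlgMap j i' x c) = stalkAlgMap j i x c :=
  QSym.map_algMap _ _ _ _ _

/-- The map on stalkwise functions induced by a morphism `f : M → N` under `X`. -/
def transitionFun (w : i ≫ f = i') (U : X.Opens) :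
    (∀ x : U, QSymAt j i' x) →+* (∀ x : U, QSymAt j i x) :=
  RingHom.pi fun x : U => (qsymTransition j w x).comp
    (Pi.evalRingHom (fun x : U => QSymAt j i' x) x)

theorem transitionFun_germwise (w : i ≫ f = i') (U : X.Opens) (c : Γ(X, U)) :
    transitionFun j w U (GradedAlgSheaf.germwise (stalkAlgMap j i') U c) =
      GradedAlgSheaf.germwise (stalkAlgMap j i) U c :=
  funext fun x => qsymTransition_stalkAlgMap j w x.1 (X.presheaf.germ U x.1 x.2 c)

theorem transitionFun_mem (w : i ≫ f = i') [IsClosedImmersion i] [IsClosedImmersion i']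
    (U : X.Opens) (s : GradedAlgSheaf.locallySum (isHomogeneousSystem j i') U) :
    transitionFun j w U s.1 ∈ GradedAlgSheaf.locallySum (isHomogeneousSystem j i) U := fun x => by
  obtain ⟨V, h, hx, hV⟩ := s.2 x
  refine ⟨V, h, hx, ?_⟩
  suffices ⨆ d, homogeneousSections j i' V d ≤ (⨆ d, homogeneousSections j i V d).comap
    (transitionFun j w V).toAddMonoidHom from this hV
  exact iSup_le fun d s hs => (le_iSup (homogeneousSections j i V) d) (qsymTransition_mem j w hs)

/-- The homomorphism `qSym_{X ⊂ N}(𝒥_{Y,X}) → qSym_{X ⊂ M}(𝒥_{Y,X})` induced by a morphism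
`f : M → N` under `X`. -/
def qSymTransition (w : i ≫ f = i') [IsClosedImmersion i] [IsClosedImmersion i'] :
    (qSym j i').Hom (qSym j i) where
  app U := ((transitionFun j w U).comp
      (GradedAlgSheaf.locallySum (isHomogeneousSystem j i') U).subtype).codRestrict
    (GradedAlgSheaf.locallySum (isHomogeneousSystem j i) U) (transitionFun_mem j w U)
  app_algMap U c := Subtype.ext (transitionFun_germwise j w U c)
  app_mem_deg _ _ _ hs := qsymTransition_mem j w hs
  app_res _ _ := rfl

variable {k : Type u} [Field k]

/-- A closed embedding over `k` of the `k`-scheme `X` into a scheme `M` of finite type over `k`. -/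
structure AmbientEmbedding (p : X ⟶ Spec (.of k)) where
  M : Scheme.{u}
  str : M ⟶ Spec (.of k)
  locallyOfFiniteType : LocallyOfFiniteType str
  quasiCompact : QuasiCompact str
  emb : X ⟶ M
  isClosedImmersion : IsClosedImmersion emb
  emb_str : emb ≫ str = p

attribute [instance] AmbientEmbedding.isClosedImmersion

variable {p : X ⟶ Spec (.of k)}

/-- A morphism in the index category of the inverse system: a closed embedding `X ⊂ M ⊂ N` over `k`
that extends the given embedding of `X` in `M` to that in `N`. -/
structure AmbientEmbedding.Hom (E E' : AmbientEmbedding p) where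
  hom : E.M ⟶ E'.M
  isClosedImmersion : IsClosedImmersion hom
  hom_str : hom ≫ E'.str = E.str
  emb_hom : E.emb ≫ hom = E'.emb

variable (p)

/-- Families of elements of the stalks at `x` of all the `qSym_{X ⊂ M}(𝒥_{Y,X})`. -/
abbrev QSymFamily (x : X) : Type (u + 1) := ∀ E : AmbientEmbedding p, QSymAt j E.emb x

/-- The structure of `𝒪_{X,x}`-algebra of the ring of families. -/
def familyAlgMap (x : X) : X.presheaf.stalk x →+* QSymFamily j p x :=
  RingHom.pi fun E => stalkAlgMap j E.emb x

/-- The inverse limit over all `M` of the parts of degree `d` of the `qSym_{X ⊂ M}(𝒥_{Y,X})`: families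
of sections of degree `d` that are compatible with the homomorphisms induced by `X ⊂ M ⊂ N`. -/
def compatibleFamilies (U : X.Opens) (d : ℕ) : AddSubgroup (∀ x : U, QSymFamily j p x) where
  carrier := {s | (∀ E, (fun x => s x E) ∈ homogeneousSections j E.emb U d) ∧
    ∀ (E E' : AmbientEmbedding p) (f : E.Hom E') (x : U),
      qsymTransition j f.emb_hom x (s x E') = s x E}
  add_mem' hs ht := ⟨fun E => add_mem (hs.1 E) (ht.1 E), fun E E' f x =>
    (map_add _ _ _).trans (congrArg₂ (· + ·) (hs.2 E E' f x) (ht.2 E E' f x))⟩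
  zero_mem' := ⟨fun E => zero_mem (homogeneousSections j E.emb U d), fun _ _ _ _ => map_zero _⟩
  neg_mem' hs := ⟨fun E => neg_mem (hs.1 E), fun E E' f x =>
    (map_neg _ _).trans (congrArg _ (hs.2 E E' f x))⟩

/-- The component at `E` of a family. -/
def evalFamily (E : AmbientEmbedding p) (U : X.Opens) :
    (∀ x : U, QSymFamily j p x) →+* ∀ x : U, QSymAt j E.emb x :=
  RingHom.pi fun x => (Pi.evalRingHom (fun E : AmbientEmbedding p => QSymAt j E.emb x) E).comp
    (Pi.evalRingHom (fun x : U => QSymFamily j p x) x)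

theorem compatibleFamilies_sum_eq_zero {U : X.Opens} (t : Finset ℕ)
    (s : ℕ → ∀ x : U, QSymFamily j p x) (hs : ∀ d, s d ∈ compatibleFamilies j p U d)
    (h₀ : ∑ d ∈ t, s d = 0) (d : ℕ) (hd : d ∈ t) : s d = 0 := by
  have h : ∀ E : AmbientEmbedding p, evalFamily j p E U (s d) = 0 := fun E =>
    (isHomogeneousSystem j E.emb).sum_eq_zero t (fun d => evalFamily j p E U (s d))
      (fun d => (hs d).1 E)
      (((map_sum (evalFamily j p E U) s t).symm.trans
        (congrArg (evalFamily j p E U) h₀)).trans (map_zero (evalFamily j p E U))) d hd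
  exact funext fun x => funext fun E => congrFun (h E) x

theorem isHomogeneousSystem_family :
    GradedAlgSheaf.IsHomogeneousSystem (F := QSymFamily j p) (familyAlgMap j p)
      (compatibleFamilies j p) where
  restrict_mem h _ _ hs := ⟨fun E => (isHomogeneousSystem j E.emb).restrict_mem h (hs.1 E),
    fun E E' f x => hs.2 E E' f ⟨x, h x.2⟩⟩
  mem_of_locally _ hs := by
    refine ⟨fun E => (isHomogeneousSystem j E.emb).mem_of_locally _ fun x => ?_,
      fun E E' f x => ?_⟩
    · obtain ⟨V, hV, hx, h⟩ := hs x
      exact ⟨V, hV, hx, h.1 E⟩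
    · obtain ⟨V, hV, hx, h⟩ := hs x
      exact h.2 E E' f ⟨x, hx⟩
  germwise_mem c := ⟨fun E => (isHomogeneousSystem j E.emb).germwise_mem c,
    fun E E' f x => qsymTransition_stalkAlgMap j f.emb_hom _ _⟩
  mul_mem hs ht := ⟨fun E => (isHomogeneousSystem j E.emb).mul_mem (hs.1 E) (ht.1 E),
    fun E E' f x => (map_mul _ _ _).trans (congrArg₂ (· * ·) (hs.2 E E' f x) (ht.2 E E' f x))⟩
  sum_eq_zero t s hs h₀ d hd := compatibleFamilies_sum_eq_zero j p t s hs h₀ d hd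

/-- The quasi-symmetric algebra `qSym_{𝒪_X}(𝒥_{Y,X})`: the inverse limit, in the category of sheaves of
graded `𝒪_X`-algebras, of the algebras `qSym_{X ⊂ M}(𝒥_{Y,X})` over all closed embeddings of `X`,
that is the direct sum of the inverse limits of the graded parts. Its universal property is
`existsUnique_lift`. -/
def absQSym : GradedAlgSheaf.{u, u + 1} X :=
  GradedAlgSheaf.ofHomogeneous.{u, u + 1} (isHomogeneousSystem_family j p)

theorem evalFamily_mem (E : AmbientEmbedding p) (U : X.Opens)
    (s : GradedAlgSheaf.locallySum (isHomogeneousSystem_family j p) U) :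
    evalFamily j p E U s.1 ∈ GradedAlgSheaf.locallySum (isHomogeneousSystem j E.emb) U :=
  fun x => by
    obtain ⟨V, h, hx, hV⟩ := s.2 x
    refine ⟨V, h, hx, ?_⟩
    suffices ⨆ d, compatibleFamilies j p V d ≤ (⨆ d, homogeneousSections j E.emb V d).comap
      (evalFamily j p E V).toAddMonoidHom from this hV
    exact iSup_le fun d s hs => (le_iSup (homogeneousSections j E.emb V) d) (hs.1 E)

/-- The canonical homomorphism from the inverse limit to `qSym_{X ⊂ M}(𝒥_{Y,X})`. -/
def absQSymProj (E : AmbientEmbedding p) : (absQSym j p).Hom (qSym j E.emb) where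
  app U := ((evalFamily j p E U).comp
      (GradedAlgSheaf.locallySum (isHomogeneousSystem_family j p) U).subtype).codRestrict
    (GradedAlgSheaf.locallySum (isHomogeneousSystem j E.emb) U) (evalFamily_mem j p E U)
  app_algMap _ _ := rfl
  app_mem_deg _ _ _ hs := hs.1 E
  app_res _ _ := rfl

/-- The projections of the inverse limit commute with the homomorphisms of the inverse system. -/
theorem transition_absQSymProj {E E' : AmbientEmbedding p} (f : E.Hom E') (U : X.Opens)
    (s : (absQSym j p).sections U) :
    (qSymTransition j f.emb_hom).app U ((absQSymProj j p E').app U s) =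
      (absQSymProj j p E).app U s := by
  refine Subtype.ext (funext fun x => ?_)
  obtain ⟨V, h, hx, hV⟩ := s.2 x
  suffices H : ∀ r ∈ ⨆ d, compatibleFamilies j p V d, ∀ y : V,
      qsymTransition j f.emb_hom y (r y E') = r y E from H _ hV ⟨x, hx⟩
  intro r hr y
  exact AddSubgroup.iSup_induction (compatibleFamilies j p V)
    (C := fun r => qsymTransition j f.emb_hom y (r y E') = r y E) hr
    (fun d r hr => hr.2 E E' f y) (map_zero _)
    (fun r r' e e' => (map_add _ _ _).trans (congrArg₂ (· + ·) e e'))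

/-- The universal property of the inverse limit. -/
theorem existsUnique_lift (T : GradedAlgSheaf.{u, v} X)
    (φ : ∀ E : AmbientEmbedding p, T.Hom (qSym j E.emb))
    (hφ : ∀ (E E' : AmbientEmbedding p) (f : E.Hom E') (U : X.Opens) (s : T.sections U),
      (qSymTransition j f.emb_hom).app U ((φ E').app U s) = (φ E).app U s) :
    ∃! g : T.Hom (absQSym j p), ∀ (E : AmbientEmbedding p) (U : X.Opens) (s : T.sections U),
      (absQSymProj j p E).app U (g.app U s) = (φ E).app U s := by
  let q (U : X.Opens) : T.sections U →+* ∀ x : U, QSymFamily j p x :=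
    { toFun := fun s x E => ((φ E).app U s).1 x
      map_one' := funext fun x => funext fun E =>
        congrFun (congrArg Subtype.val (map_one ((φ E).app U))) x
      map_zero' := funext fun x => funext fun E =>
        congrFun (congrArg Subtype.val (map_zero ((φ E).app U))) x
      map_mul' := fun s t => funext fun x => funext fun E =>
        congrFun (congrArg Subtype.val (map_mul ((φ E).app U) s t)) x
      map_add' := fun s t => funext fun x => funext fun E =>
        congrFun (congrArg Subtype.val (map_add ((φ E).app U) s t)) x }
  have hq : ∀ U d s, s ∈ T.deg U d → q U s ∈ compatibleFamilies j p U d := fun U d s hs =>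
    ⟨fun E => (φ E).app_mem_deg U d s hs, fun E E' f x =>
      congrFun (congrArg Subtype.val (hφ E E' f U s)) x⟩
  have hr : ∀ (U V : X.Opens) (h : V ≤ U) (s : T.sections U),
      GradedAlgSheaf.restrict h (q U s) = q V (T.res h s) := fun U V h s =>
    funext fun x => funext fun E => (congrFun (congrArg Subtype.val ((φ E).app_res h s)) x).symm
  have hm : ∀ U s, q U s ∈ GradedAlgSheaf.locallySum (isHomogeneousSystem_family j p) U :=
    fun U s x => by
      obtain ⟨V, h, hx, hV⟩ := T.locally_mem_sum s x
      refine ⟨V, h, hx, ?_⟩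
      rw [hr]
      suffices ⨆ d, T.deg V d ≤ (⨆ d, compatibleFamilies j p V d).comap (q V).toAddMonoidHom from
        this hV
      exact iSup_le fun d s hs => (le_iSup (compatibleFamilies j p V) d) (hq V d s hs)
  refine ⟨{ app := fun U => (q U).codRestrict
              (GradedAlgSheaf.locallySum (isHomogeneousSystem_family j p) U) (hm U)
            app_algMap := fun U c => Subtype.ext (funext fun x => funext fun E =>
              congrFun (congrArg Subtype.val ((φ E).app_algMap U c)) x)
            app_mem_deg := fun U d s hs => hq U d s hs
            app_res := fun h s => Subtype.ext (hr _ _ h s).symm }, fun E U s => rfl, ?_⟩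
  intro g hg
  cases g with
  | mk app _ _ _ =>
    congr 1
    refine funext fun U => RingHom.ext fun s => Subtype.ext (funext fun x => funext fun E => ?_)
    exact congrFun (congrArg Subtype.val (hg E U s)) x

/-- The ambient scheme is nonsingular: all its local rings are regular. -/
def AmbientEmbedding.IsNonsingular {p : X ⟶ Spec (.of k)} (E : AmbientEmbedding p) : Prop :=
  ∀ x : E.M, IsRegularLocalRing (E.M.presheaf.stalk x)

end Geometry

end

end QuasiSym

/-! Since `Sym → Rees` is surjective, every `qSym_{X ⊂ M}` is a quotient of `Sym_{𝒪_X}(𝒥_{Y,X})`.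
Hence between two ambient schemes there is at most one homomorphism under this symmetric algebra. It
exists as soon as the relations of the Rees algebra of `M` (the kernel of `Sym → Rees`) die in
`qSym_{X ⊂ M'}`. The heart of the proof is that they do whenever `M` is nonsingular, for arbitrary
`M'` (`QSym.ofSym_symMap_eq_zero`).

Let `S`, `R` be the local rings of `M`, `M'` at a point of `X`, and `A` that of `X`. A lift `S → R`
of `S → A` would carry relations to relations by functoriality. There need not be one, but there is
one modulo each power of the maximal ideal: parameters of a regular local ring are quasi-regular and
its residue field is formally smooth over the prime field, so `S / m^N` is a truncated polynomial
ring and maps to `R / m^N` compatibly with `A` (`exists_quotient_lift`). Along such a map a relation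
`z` lifts to `Sym_R` without change of its image `w` in the quasi-symmetric algebra, and the Rees
element of the lift has coefficients in `m^N` and degree bounded independently of `N`. By Artin–Rees
and Krull's intersection theorem, `w = 0`.

The resulting maps from `qSym_{X ⊂ M}` to all `qSym_{X ⊂ M'}` are compatible, all being maps under
`Sym`, so they define a map into the inverse limit. It is inverse to the projection provided that
the components at `M` and `M'` of a section of the limit correspond under the comparison. For this,
`M` and `M'` are embedded in one scheme `N`, obtained by gluing them along `X`
(`exists_common_ambient`); both components are then images of the one at `N`, hence of one element
of the symmetric algebra at each stalk. The charts of `N` are the spectra of the rings of pairs of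
sections which agree on `X`; they are of finite type over `k` by the Artin–Tate lemma. -/

namespace QuasiSym

/-! ### Formal smoothness of extensions of a perfect field. -/

section FormallySmoothField

open MvPolynomial Algebra

/-- Formal smoothness makes the conormal map `I/I² → Ω ⊗ K` of the presentation of `K` by all its
elements injective. The coordinates of the image of `f` in the basis of differentials of the
variables are the values of its partial derivatives. -/
theorem mem_ker_sq_of_pderiv_mem_ker {F K : Type*} [Field F] [Field K] [Algebra F K]
    [Algebra.FormallySmooth F K] (f : MvPolynomial K F) (h₀ : aeval id f = (0 : K))
    (h₁ : ∀ i, aeval id (pderiv i f) = (0 : K)) :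
    f ∈ RingHom.ker (aeval id : MvPolynomial K F →ₐ[F] K) ^ 2 := by
  let P := Generators.self F K
  have hP : Function.Injective P.toExtension.cotangentComplex :=
    P.toExtension.subsingleton_h1Cotangent.1 FormallySmooth.subsingleton_h1Cotangent
  have hf : f ∈ P.toExtension.ker := h₀
  refine (Extension.Cotangent.mk_eq_zero_iff (P := P.toExtension) ⟨f, hf⟩).1 (hP ?_)
  rw [map_zero, Extension.cotangentComplex_mk]
  refine P.cotangentSpaceBasis.ext_elem fun i => ?_
  rw [map_zero, Finsupp.zero_apply]
  exact (P.cotangentSpaceBasis_repr_one_tmul f i).trans (h₁ i)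

/-- Every extension of a perfect field is formally smooth. -/
theorem formallySmooth_of_perfectField (F K : Type*) [Field F] [PerfectField F] [Field K]
    [Algebra F K] : Algebra.FormallySmooth F K := by
  let P := Generators.self F K
  refine ⟨inferInstance, P.toExtension.subsingleton_h1Cotangent.2 ?_⟩
  refine (injective_iff_map_eq_zero _).2 fun x hx => ?_
  obtain ⟨⟨f, hf⟩, rfl⟩ := Extension.Cotangent.mk_surjective x
  refine (Extension.Cotangent.mk_eq_zero_iff _).2 ?_
  have h₀ : aeval id f = (0 : K) := hf
  have h₁ (i : K) : aeval id (pderiv i f) = (0 : K) := by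
    rw [Extension.cotangentComplex_mk] at hx
    refine (P.cotangentSpaceBasis_repr_one_tmul f i).symm.trans ?_
    rw [hx, map_zero, Finsupp.zero_apply]
  -- Only finitely many elements of `K` occur in `f`. They generate a subextension `L` which is
  -- essentially of finite type, hence formally smooth because `F` is perfect; `f` lies in the
  -- square of the kernel already over `L`.
  let L := IntermediateField.adjoin F (f.vars : Set K)
  have : Algebra.EssFiniteType F L := IntermediateField.essFiniteType_iff.2 ⟨f.vars, rfl⟩
  obtain ⟨g, hg⟩ := exists_rename_eq_of_vars_subset_range f ((↑) : L → K) Subtype.val_injective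
    (fun x hx => ⟨⟨x, IntermediateField.subset_adjoin F _ hx⟩, rfl⟩)
  have hc (q : MvPolynomial L F) :
      aeval id (rename ((↑) : L → K) q) = ((aeval id q : L) : K) := by
    rw [aeval_rename]
    exact (aeval_algebraMap_apply K (id : L → L) q)
  have hgm := mem_ker_sq_of_pderiv_mem_ker g (Subtype.val_injective (by rw [← hc, hg, h₀]; rfl))
    (fun i => Subtype.val_injective (by
      rw [← hc, ← pderiv_rename Subtype.val_injective, hg, h₁]; rfl))
  have hle : RingHom.ker (aeval id : MvPolynomial L F →ₐ[F] L) ≤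
      (RingHom.ker (aeval id : MvPolynomial K F →ₐ[F] K)).comap
        (rename ((↑) : L → K) : _ →ₐ[F] MvPolynomial K F).toRingHom := fun q hq => by
    have hq' : aeval id q = (0 : L) := hq
    change aeval id (rename ((↑) : L → K) q) = (0 : K)
    rw [hc, hq']; rfl
  have := Ideal.le_comap_pow _ 2 (Ideal.pow_right_mono hle 2 hgm)
  have h3 : rename ((↑) : L → K) g ∈ RingHom.ker (aeval id : MvPolynomial K F →ₐ[F] K) ^ 2 := this
  rw [hg] at h3
  exact h3

end FormallySmoothField

/-! ### Quasi-regularity of the parameters of a regular local ring. -/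

section QuasiRegular

open MvPolynomial IsLocalRing

theorem isHomogeneous_eval₂_mul {σ R B : Type*} [CommSemiring R] [CommSemiring B] {n : ℕ}
    {F : MvPolynomial σ R} (hF : F.IsHomogeneous n) (f : R →+* B) (b : B) (g : σ → B) :
    eval₂ f (fun i => b * g i) F = b ^ n * eval₂ f g F := by
  rw [eval₂_eq, eval₂_eq, Finset.mul_sum]
  refine Finset.sum_congr rfl fun α hα => ?_
  have h : ∑ i ∈ α.support, α i = n :=
    (Finsupp.degree_apply α).symm.trans ((hF.degree_eq_sum_deg_support hα).symm)
  rw [Finset.prod_congr rfl fun i _ => mul_pow b (g i) (α i), Finset.prod_mul_distrib,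
    Finset.prod_pow_eq_pow_sum, h]
  ring

/-- A form that vanishes at the generators of a maximal ideal which cannot be generated up to radical
by fewer elements has its coefficients in the maximal ideal. -/
theorem map_residue_eq_zero_of_eval_eq_zero {S : Type*} [CommRing S] [IsLocalRing S]
    [IsNoetherianRing S] {d n : ℕ} (hd : (maximalIdeal S).height = d) (x : Fin d → S)
    (hx : Ideal.span (Set.range x) = maximalIdeal S) {F : MvPolynomial (Fin d) S}
    (hF : F.IsHomogeneous n) (h₀ : eval x F = 0) : map (residue S) F = 0 := by
  classical
  by_contra hne
  rcases isEmpty_or_nonempty (Fin d) with hE | ⟨⟨j⟩⟩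
  · obtain ⟨c, rfl⟩ := C_surjective (R := S) (Fin d) F
    rw [eval_C] at h₀
    exact hne (by rw [h₀, map_zero, map_zero])
  -- `P` is the extension of the maximal ideal to the polynomial ring. If some coefficient of `F`
  -- were a unit, `P` would be minimal over an ideal with `d - 1` generators, against Krull's height
  -- theorem.
  let P : Ideal (MvPolynomial (Fin d) S) := RingHom.ker (map (residue S))
  have hP : P.IsPrime := RingHom.ker_isPrime _
  have hover : P.LiesOver (maximalIdeal S) := ⟨by
    ext s
    rw [Ideal.mem_comap, RingHom.mem_ker, MvPolynomial.algebraMap_eq, map_C, ← C_0,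
      (C_injective _ _).eq_iff, residue_eq_zero_iff]⟩
  have hPm (Q : Ideal (MvPolynomial (Fin d) S)) (hQ : ∀ i, C (x i) ∈ Q) : P ≤ Q := by
    have h1 : maximalIdeal S ≤ Q.comap C := by
      rw [← hx, Ideal.span_le]
      rintro _ ⟨i, rfl⟩
      exact hQ i
    intro f hf
    rw [f.as_sum]
    refine Ideal.sum_mem _ fun α _ => ?_
    rw [← mul_one (coeff α f), ← C_mul_monomial]
    refine Ideal.mul_mem_right _ _ (h1 ?_)
    rw [← residue_eq_zero_iff, ← coeff_map, RingHom.mem_ker.1 hf, coeff_zero]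
  -- The generators of `J` are the minors of the matrix with rows `X` and `x` that involve the
  -- column `j`; the one for `i = j` vanishes, which leaves `d - 1`.
  let y (i : Fin d) : MvPolynomial (Fin d) S := X j * C (x i) - X i * C (x j)
  let J : Ideal (MvPolynomial (Fin d) S) := Ideal.span ((Finset.univ.erase j).image y)
  have hyJ (i : Fin d) : y i ∈ J := by
    by_cases h : i = j
    · rw [h, show y j = 0 from sub_self _]; exact zero_mem _
    · exact Ideal.subset_span (Finset.mem_coe.2 (Finset.mem_image_of_mem _
        (Finset.mem_erase.2 ⟨h, Finset.mem_univ _⟩)))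
  have hxP (i : Fin d) : C (x i) ∈ P := by
    rw [RingHom.mem_ker, map_C, (residue_eq_zero_iff _).2, C_0]
    rw [← hx]; exact Ideal.subset_span ⟨i, rfl⟩
  have hJP : J ≤ P := by
    rw [Ideal.span_le]
    intro z hz
    obtain ⟨i, -, rfl⟩ := Finset.mem_image.1 (Finset.mem_coe.1 hz)
    exact sub_mem (Ideal.mul_mem_left _ _ (hxP i)) (Ideal.mul_mem_left _ _ (hxP j))
  -- Modulo `J` one has `X_j x_i = x_j X_i`. By homogeneity `X_j^n F(x) = F(X_j x) = F(x_j X) =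
  -- x_j^n F(X)`, and `F(x) = 0`.
  have hFJ : C (x j) ^ n * F ∈ J := by
    rw [← Ideal.Quotient.eq_zero_iff_mem]
    let q := Ideal.Quotient.mk J
    have e1 : eval₂ (q.comp C) (fun i => q (X j) * q (C (x i))) F = 0 := by
      rw [isHomogeneous_eval₂_mul hF]
      have : eval₂ (q.comp C) (fun i => q (C (x i))) F = q (C (eval x F)) := by
        rw [eval, coe_eval₂Hom, eval₂_comp_left C, eval₂_comp_left q]; rfl
      rw [this, h₀, C_0, map_zero, mul_zero]
    have e2 : (fun i => q (X j) * q (C (x i))) = fun i => q (C (x j)) * q (X i) := by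
      funext i
      rw [← map_mul, ← map_mul, mul_comm (C (x j))]
      exact (Ideal.Quotient.mk_eq_mk_iff_sub_mem _ _).2 (hyJ i)
    rw [e2, isHomogeneous_eval₂_mul hF] at e1
    have e3 : eval₂ (q.comp C) (fun i => q (X i)) F = q F := by
      rw [← Function.comp_def, ← eval₂_comp_left q, eval₂_eta]
    rw [e3] at e1
    change q _ = 0
    rw [map_mul, map_pow, e1]
  -- A prime `Q` with `J ⊆ Q ⊆ P` contains neither `F` nor any variable. So it contains `x_j` by the
  -- previous step, and then every `x_i` because `X_j x_i ∈ Q`.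
  have hmin : P ∈ J.minimalPrimes := by
    refine ⟨⟨hP, hJP⟩, fun Q ⟨hQ, hJQ⟩ hQP => ?_⟩
    have hX : ∀ i, (X i : MvPolynomial (Fin d) S) ∉ Q := fun i h => by
      have := RingHom.mem_ker.1 (hQP h)
      rw [map_X] at this
      exact X_ne_zero i this
    have hj : C (x j) ∈ Q := hQ.mem_of_pow_mem n
      ((hQ.mem_or_mem (hJQ hFJ)).resolve_right fun h => hne (RingHom.mem_ker.1 (hQP h)))
    refine hPm Q fun i => (hQ.mem_or_mem ?_).resolve_left (hX j)
    have := add_mem (hJQ (hyJ i)) (Q.mul_mem_left (X i) hj)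
    rwa [sub_add_cancel] at this
  have h1 : P.height ≤ ((Finset.univ.erase j).image y).card :=
    Ideal.height_le_card_of_mem_minimalPrimes_span_finset hmin
  have h2 : ((Finset.univ.erase j).image y).card < d := by
    refine Finset.card_image_le.trans_lt ?_
    rw [Finset.card_erase_of_mem (Finset.mem_univ _), Finset.card_univ, Fintype.card_fin]
    have := j.pos
    omega
  -- Going down for the polynomial extension: the height of `P` is at least that of the maximal
  -- ideal below it.
  have h3 : (d : ℕ∞) ≤ P.height := by
    rw [Ideal.height_eq_height_add_of_liesOver_of_hasGoingDown (maximalIdeal S) P, hd]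
    exact le_self_add
  exact absurd (h3.trans h1) (not_le.2 (by exact_mod_cast h2))

/-- The parameters of a regular local ring are quasi-regular. -/
theorem map_residue_eq_zero_of_eval_mem {S : Type*} [CommRing S] [IsLocalRing S]
    [IsNoetherianRing S] {d n : ℕ} (hd : (maximalIdeal S).height = d) (x : Fin d → S)
    (hx : Ideal.span (Set.range x) = maximalIdeal S) {F : MvPolynomial (Fin d) S}
    (hF : F.IsHomogeneous n) (h₀ : eval x F ∈ maximalIdeal S ^ (n + 1)) :
    map (residue S) F = 0 := by
  -- An element of `m · m^n` is the value at `x` of a form of degree `n` with coefficients in `m`;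
  -- subtracting this form reduces to the case of value zero.
  obtain ⟨G, hG, hG₀, hGx⟩ : ∃ G : MvPolynomial (Fin d) S, G.IsHomogeneous n ∧
      map (residue S) G = 0 ∧ eval x G = eval x F := by
    rw [pow_succ'] at h₀
    refine Submodule.mul_induction_on (C := fun z => ∃ G : MvPolynomial (Fin d) S,
      G.IsHomogeneous n ∧ map (residue S) G = 0 ∧ eval x G = z) h₀ (fun s hs t ht => ?_) ?_
    · rw [← hx] at ht
      obtain ⟨p, hp, rfl⟩ := (Ideal.mem_span_pow_iff_exists_isHomogeneous x t).1 ht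
      exact ⟨C s * p, hp.C_mul s, by rw [map_mul, map_C, (residue_eq_zero_iff s).2 hs, C_0,
        zero_mul], by rw [map_mul, eval_C]⟩
    · rintro _ _ ⟨G, hG, hG₀, rfl⟩ ⟨H, hH, hH₀, rfl⟩
      exact ⟨G + H, hG.add hH, by rw [map_add, hG₀, hH₀, add_zero], map_add _ _ _⟩
  have := map_residue_eq_zero_of_eval_eq_zero hd x hx (hF.sub hG) (by rw [map_sub, hGx, sub_self])
  rwa [map_sub, hG₀, sub_zero] at this

theorem exists_parameters (S : Type*) [CommRing S] [IsRegularLocalRing S] :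
    ∃ (d : ℕ) (x : Fin d → S), (maximalIdeal S).height = d ∧
      Ideal.span (Set.range x) = maximalIdeal S := by
  have fg := (maximalIdeal S).fg_of_isNoetherianRing
  have h := IsRegularLocalRing.spanFinrank_maximalIdeal (R := S)
  rw [← maximalIdeal_height_eq_ringKrullDim, ← Submodule.FG.generators_ncard fg] at h
  have hf := Submodule.FG.finite_generators fg
  have e := hf.toFinset.equivFinOfCardEq (Set.ncard_eq_toFinset_card _ hf).symm
  refine ⟨_, fun i => (e.symm i : S), (by exact_mod_cast h.symm), ?_⟩
  have : Set.range (fun i => (e.symm i : S)) = (maximalIdeal S).generators := by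
    ext s
    refine ⟨?_, fun hs => ⟨e ⟨s, hf.mem_toFinset.2 hs⟩, by simp⟩⟩
    rintro ⟨i, rfl⟩
    exact hf.mem_toFinset.1 (e.symm i).2
  rw [this]
  exact (maximalIdeal S).span_generators

end QuasiRegular

/-! ### Lifting homomorphisms from a regular local ring through nilpotent thickenings. -/

section Lift

open MvPolynomial IsLocalRing

/-- The prime field serves. Uniqueness of its homomorphisms makes every square of rings commute over
it, so no compatibility of the given maps from `k` has to be tracked. -/
theorem exists_perfectField_subsingleton (k : Type u) [Field k] :
    ∃ (F : Type) (_ : Field F) (_ : PerfectField F) (_ : F →+* k),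
      ∀ (T : Type u) [CommRing T], Subsingleton (F →+* T) := by
  obtain ⟨p, hp⟩ := CharP.exists k
  rcases CharP.char_is_prime_or_zero k p with h | rfl
  · have : Fact p.Prime := ⟨h⟩
    exact ⟨ZMod p, inferInstance, inferInstance, ZMod.castHom dvd_rfl k, fun T _ => inferInstance⟩
  · have : CharZero k := CharP.charP_to_charZero k
    exact ⟨ℚ, inferInstance, inferInstance, Rat.castHom k, fun T _ => inferInstance⟩

theorem prod_pow_mem_pow {σ R B : Type*} [CommRing R] [CommRing B] {n : ℕ} {p : MvPolynomial σ R}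
    (hp : p.IsHomogeneous n) {α : σ →₀ ℕ} (hα : α ∈ p.support) (g : σ → B) {J : Ideal B}
    (hg : ∀ i, g i ∈ J) : ∏ i ∈ α.support, g i ^ α i ∈ J ^ n := by
  have h : ∑ i ∈ α.support, α i = n :=
    (Finsupp.degree_apply α).symm.trans ((hp.degree_eq_sum_deg_support hα).symm)
  rw [← h, ← Finset.prod_pow_eq_pow_sum]
  exact Ideal.prod_mem_prod fun i _ => Ideal.pow_mem_pow (hg i) _

theorem eval₂_mem_pow {σ R B : Type*} [CommRing R] [CommRing B] {n : ℕ} {p : MvPolynomial σ R}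
    (hp : p.IsHomogeneous n) (f : R →+* B) (g : σ → B) {J : Ideal B} (hg : ∀ i, g i ∈ J) :
    eval₂ f g p ∈ J ^ n := by
  rw [eval₂_eq]
  exact Ideal.sum_mem _ fun α hα => Ideal.mul_mem_left _ _ (prod_pow_mem_pow hp hα g hg)

section Coefficients

variable {S Q : Type*} [CommRing S] [IsLocalRing S] [CommRing Q] (π : S →+* Q)
  (c : ResidueField S →+* Q) {d : ℕ} (x : Fin d → S)

/-- Reduction of forms modulo the maximal ideal, relative to a coefficient field. -/
theorem sub_eval₂_map_residue_mem {n : ℕ} {P : MvPolynomial (Fin d) S} (hP : P.IsHomogeneous n)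
    (hc : ∀ s, π s - c (residue S s) ∈ (maximalIdeal S).map π)
    (hx : ∀ i, x i ∈ maximalIdeal S) :
    π (eval x P) - eval₂ c (fun i => π (x i)) (map (residue S) P) ∈
      (maximalIdeal S).map π ^ (n + 1) := by
  have h1 : π (eval x P) = eval₂ π (fun i => π (x i)) P := by
    rw [eval, coe_eval₂Hom, eval₂_comp_left π]; rfl
  rw [h1, eval₂_map, eval₂_eq, eval₂_eq, ← Finset.sum_sub_distrib, pow_succ']
  refine Ideal.sum_mem _ fun α hα => ?_
  rw [← sub_mul]
  exact Ideal.mul_mem_mul (hc _)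
    (prod_pow_mem_pow hP hα _ fun i => Ideal.mem_map_of_mem π (hx i))

/-- Successive approximation: an error in `m^n` is a form of degree `n` in the parameters, and
replacing its coefficients by their residues, embedded by `c`, leaves an error in `m^(n+1)`. The
process ends because `m^N` vanishes in the quotient. -/
theorem surjective_eval₂_coefficients {N : ℕ} (hπ : Function.Surjective π)
    (hN : (maximalIdeal S).map π ^ N = ⊥)
    (hc : ∀ s, π s - c (residue S s) ∈ (maximalIdeal S).map π)
    (hx : Ideal.span (Set.range x) = maximalIdeal S) :
    Function.Surjective (eval₂Hom c fun i => π (x i)) := by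
  have key : ∀ n, ∀ q : Q, ∃ p, q - eval₂Hom c (fun i => π (x i)) p ∈
      (maximalIdeal S).map π ^ n := by
    intro n
    induction n with
    | zero => exact fun q => ⟨0, by rw [pow_zero, Ideal.one_eq_top]; trivial⟩
    | succ n ih =>
      intro q
      obtain ⟨p, hp⟩ := ih q
      rw [← Ideal.map_pow] at hp
      obtain ⟨s, hs, hs'⟩ := (Ideal.mem_map_iff_of_surjective π hπ).1 hp
      rw [← hx] at hs
      obtain ⟨P, hP, rfl⟩ := (Ideal.mem_span_pow_iff_exists_isHomogeneous x s).1 hs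
      refine ⟨p + map (residue S) P, ?_⟩
      rw [map_add, ← sub_sub, ← hs']
      exact sub_eval₂_map_residue_mem π c x hP hc fun i => hx ▸ Ideal.subset_span ⟨i, rfl⟩
  intro q
  obtain ⟨p, hp⟩ := key N q
  rw [hN, Ideal.mem_bot, sub_eq_zero] at hp
  exact ⟨p, hp.symm⟩

/-- By induction the components below degree `n` vanish, and those above have values in `m^(n+1)`.
So the value of the component of degree `n` is there too, and quasi-regularity applies to a lift of
it to `S`. -/
theorem homogeneousComponent_eq_zero_of_eval₂_eq_zero [IsNoetherianRing S] {N : ℕ}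
    (hd : (maximalIdeal S).height = d) (hπ : RingHom.ker π ≤ maximalIdeal S ^ N)
    (hπ' : Function.Surjective π)
    (hc : ∀ s, π s - c (residue S s) ∈ (maximalIdeal S).map π)
    (hx : Ideal.span (Set.range x) = maximalIdeal S) {p : MvPolynomial (Fin d) (ResidueField S)}
    (hp : eval₂ c (fun i => π (x i)) p = 0) (n : ℕ) (hn : n < N) :
    homogeneousComponent n p = 0 := by
  induction n using Nat.strong_induction_on with
  | _ n ih =>
    have hxm : ∀ i, x i ∈ maximalIdeal S := fun i => hx ▸ Ideal.subset_span ⟨i, rfl⟩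
    obtain ⟨P₀, hP₀⟩ := map_surjective (residue S) residue_surjective (homogeneousComponent n p)
    let P := homogeneousComponent n P₀
    have hP : P.IsHomogeneous n := homogeneousComponent_isHomogeneous n P₀
    have hPp : map (residue S) P = homogeneousComponent n p := by
      ext α
      have := congrArg (coeff α) hP₀
      rw [coeff_map, coeff_homogeneousComponent] at this
      rw [coeff_map, coeff_homogeneousComponent, coeff_homogeneousComponent]
      split_ifs with h
      · rw [this, if_pos h]
      · rw [map_zero]
    rw [← hPp]
    refine map_residue_eq_zero_of_eval_mem hd x hx hP ?_
    have h1 : eval₂ c (fun i => π (x i)) (homogeneousComponent n p) ∈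
        (maximalIdeal S).map π ^ (n + 1) := by
      have h2 : eval₂Hom c (fun i => π (x i)) p =
          ∑ m ∈ Finset.range (p.totalDegree + 1),
            eval₂Hom c (fun i => π (x i)) (homogeneousComponent m p) := by
        conv_lhs => rw [← sum_homogeneousComponent p]
        exact map_sum _ _ _
      rw [coe_eval₂Hom, hp] at h2
      by_cases hm : n ∈ Finset.range (p.totalDegree + 1)
      · rw [← Finset.add_sum_erase _ _ hm, eq_comm, add_eq_zero_iff_eq_neg] at h2
        rw [h2]
        refine neg_mem (Ideal.sum_mem _ fun m hm' => ?_)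
        rcases lt_or_ge n m with h | h
        · exact Ideal.pow_le_pow_right h (eval₂_mem_pow (homogeneousComponent_isHomogeneous m p) _ _
            fun i => Ideal.mem_map_of_mem π (hxm i))
        · have hlt : m < n := lt_of_le_of_ne h (Finset.ne_of_mem_erase hm')
          rw [ih m hlt (hlt.trans hn), eval₂_zero]
          exact zero_mem _
      · rw [homogeneousComponent_eq_zero n p (by simpa using hm), eval₂_zero]
        exact zero_mem _
    have h3 := add_mem (sub_eval₂_map_residue_mem π c x hP hc hxm) (hPp ▸ h1)
    rw [sub_add_cancel, ← Ideal.map_pow] at h3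
    obtain ⟨s, hs, hs'⟩ := (Ideal.mem_map_iff_of_surjective π hπ').1 h3
    have h4 : eval x P - s ∈ RingHom.ker π := by rw [RingHom.mem_ker, map_sub, hs', sub_self]
    -- Membership was known only modulo the kernel of `π`, which lies in `m^N`; since `n + 1 ≤ N`,
    -- nothing is lost.
    have := add_mem (Ideal.pow_le_pow_right (Nat.succ_le_of_lt hn) (hπ h4)) hs
    rwa [sub_add_cancel] at this

end Coefficients

/-- A regular local ring which contains a field is formally smooth over the prime field for the topology
of the maximal ideal. -/
theorem exists_ringHom_lift {F S Q B : Type*} [Field F] [PerfectField F] [CommRing S]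
    [IsRegularLocalRing S] [CommRing Q] [CommRing B] [Algebra F S] [Algebra F Q] [Algebra F B]
    (φ : S →ₐ[F] B) (ψ : Q →ₐ[F] B) (hψ : Function.Surjective ψ) {n : Ideal Q} {N : ℕ}
    (hN : N ≠ 0) (hn : n ^ N = ⊥) (hker : ∀ q, ψ q = 0 → q ∈ n)
    (hφ : ∀ s ∈ maximalIdeal S, ∃ q ∈ n, ψ q = φ s) :
    ∃ θ : S →+* Q, ∀ s, ψ (θ s) = φ s := by
  obtain ⟨d, x, hd, hx⟩ := exists_parameters S
  let K := ResidueField S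
  have hK := formallySmooth_of_perfectField F K
  let I := maximalIdeal S ^ N
  let π : S →ₐ[F] S ⧸ I := Ideal.Quotient.mkₐ F I
  have hπ : Function.Surjective π := Ideal.Quotient.mk_surjective
  have hπI : (maximalIdeal S).map (π : S →+* S ⧸ I) ^ N = ⊥ := by
    rw [← Ideal.map_pow]; exact Ideal.map_quotient_self I
  have hφm : ∀ s ∈ maximalIdeal S, φ s ∈ n.map (ψ : Q →+* B) := fun s hs => by
    obtain ⟨q, hq, e⟩ := hφ s hs
    exact e ▸ Ideal.mem_map_of_mem _ hq
  -- The image of `m` lies in the extension of `n` to `B`, whose `N`-th power is zero because `n ^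
  -- N` is.
  have hφI : ∀ s ∈ I, φ s = 0 := fun s hs => by
    have h1 : (maximalIdeal S).map (φ : S →+* B) ≤ n.map (ψ : Q →+* B) := Ideal.map_le_iff_le_comap.2 hφm
    have h2 := Ideal.pow_right_mono h1 N (Ideal.map_pow (φ : S →+* B) (maximalIdeal S) N ▸
      Ideal.mem_map_of_mem (φ : S →+* B) hs)
    rw [← Ideal.map_pow, hn, Ideal.map_bot] at h2
    exact h2
  let φ' : S ⧸ I →ₐ[F] B := Ideal.Quotient.liftₐ I φ hφI
  have hIm : I ≤ maximalIdeal S := Ideal.pow_le_self hN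
  let ρ : S ⧸ I →ₐ[F] K := Ideal.Quotient.liftₐ I (IsScalarTower.toAlgHom F S K)
    fun s hs => (residue_eq_zero_iff s).2 (hIm hs)
  have hρ : Function.Surjective ρ := fun z => by
    obtain ⟨s, rfl⟩ := residue_surjective z
    exact ⟨π s, rfl⟩
  have hρker : RingHom.ker (ρ : S ⧸ I →+* K) ≤ (maximalIdeal S).map (π : S →+* S ⧸ I) := fun z hz => by
    obtain ⟨s, rfl⟩ := hπ z
    exact Ideal.mem_map_of_mem _ ((residue_eq_zero_iff s).1 hz)
  -- A coefficient field of `S / m^N`: the identity of the residue field is lifted through the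
  -- nilpotent thickening `S / m^N → K`.
  let c : K →ₐ[F] S ⧸ I := Algebra.FormallySmooth.liftOfSurjective (AlgHom.id F K) ρ hρ
    ⟨N, le_bot_iff.1 (hπI ▸ Ideal.pow_right_mono hρker N)⟩
  have hρc : ∀ z, ρ (c z) = z := Algebra.FormallySmooth.liftOfSurjective_apply _ ρ hρ _
  have hc : ∀ s, π s - c (residue S s) ∈ (maximalIdeal S).map (π : S →+* S ⧸ I) := fun s => by
    refine hρker (RingHom.mem_ker.2 ?_)
    change ρ (π s - c (residue S s)) = 0
    rw [map_sub, hρc]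
    exact sub_self (residue S s)
  -- The image in `B` of the coefficient field is lifted to `Q`, again by formal smoothness of `K`.
  -- With lifts `z i` of the images of the parameters this gives a map `T'` from the polynomial ring
  -- to `Q`.
  let c' : K →ₐ[F] Q := Algebra.FormallySmooth.liftOfSurjective (φ'.comp c) ψ hψ
    ⟨N, le_bot_iff.1 (hn ▸ Ideal.pow_right_mono (fun q hq => hker q hq) N)⟩
  have hc' : ∀ z, ψ (c' z) = φ' (c z) := Algebra.FormallySmooth.liftOfSurjective_apply _ ψ hψ _
  have hxm : ∀ i, x i ∈ maximalIdeal S := fun i => hx ▸ Ideal.subset_span ⟨i, rfl⟩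
  choose z hzn hz using fun i => hφ (x i) (hxm i)
  let T := eval₂Hom (c : K →+* S ⧸ I) fun i => π (x i)
  let T' := eval₂Hom (c' : K →+* Q) z
  have hT : Function.Surjective T :=
    surjective_eval₂_coefficients (π : S →+* S ⧸ I) (c : K →+* S ⧸ I) x hπ hπI hc hx
  -- An element of the kernel of `T` has no components of degree below `N`, and `T'` sends those of
  -- degree at least `N` into `n ^ N = 0`. So `T'` descends to `S / m^N`.
  have hker' : RingHom.ker T ≤ RingHom.ker T' := fun p hp => by
    have hp' := homogeneousComponent_eq_zero_of_eval₂_eq_zero (π : S →+* S ⧸ I) (c : K →+* S ⧸ I) x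
      hd (N := N) (fun s hs => Ideal.Quotient.eq_zero_iff_mem.1 hs) hπ hc hx hp
    rw [RingHom.mem_ker, ← sum_homogeneousComponent p, map_sum]
    refine Finset.sum_eq_zero fun m _ => ?_
    rcases lt_or_ge m N with h | h
    · rw [hp' m h, map_zero]
    · have := Ideal.pow_le_pow_right h
        (eval₂_mem_pow (homogeneousComponent_isHomogeneous m p) (c' : K →+* Q) z hzn)
      rwa [hn] at this
  have hTT' : ∀ p, ψ (T' p) = φ' (T p) := fun p => by
    have : (ψ : Q →+* B).comp T' = (φ' : S ⧸ I →+* B).comp T := by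
      refine ringHom_ext (fun z => ?_) (fun i => ?_)
      · simp only [RingHom.comp_apply, T, T', coe_eval₂Hom, eval₂_C]
        exact hc' z
      · simp only [RingHom.comp_apply, T, T', coe_eval₂Hom, eval₂_X]
        exact hz i
    exact congrArg (fun f => f p) this
  let Θ : S ⧸ I →+* Q := RingHom.liftOfSurjective T hT ⟨T', hker'⟩
  refine ⟨Θ.comp (π : S →+* S ⧸ I), fun s => ?_⟩
  obtain ⟨p, hp⟩ := hT (π s)
  have h1 : Θ (T p) = T' p := RingHom.liftOfRightInverse_comp_apply _ _ _ _ p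
  change ψ (Θ (π s)) = _
  rw [← hp, h1, hTT', hp]
  rfl

end Lift

/-! ### Relations of the Rees algebra of a regular local ring. -/

section Comparison

open IsLocalRing

variable {R S A : Type u} [CommRing R] [CommRing S] [CommRing A]

/-- The preceding lifting result, applied to `R / m_R^N → A / m_A^N`, gives compatibility only
modulo `m_A^N`. As `ψ` maps `m_R^N` onto `m_A^N`, a suitable representative in `R` of `θ s` has
image exactly `φ s`, as is needed to lift elements of symmetric algebras over `A` itself. -/
theorem exists_quotient_lift {k : Type u} [Field k] [IsRegularLocalRing S] [IsLocalRing R]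
    [IsLocalRing A] (iS : k →+* S) (iR : k →+* R) (φ : S →+* A) [IsLocalHom φ] (ψ : R →+* A)
    (hψ : Function.Surjective ψ) {N : ℕ} (hN : N ≠ 0) :
    ∃ θ : S →+* R ⧸ maximalIdeal R ^ N, ∀ s, ∃ r, Ideal.Quotient.mk _ r = θ s ∧ ψ r = φ s := by
  obtain ⟨F, _, _, iF, hF⟩ := exists_perfectField_subsingleton k
  have hψm : ∀ r, ψ r ∈ maximalIdeal A → r ∈ maximalIdeal R := fun r hr h => hr (h.map ψ)
  have hmap : (maximalIdeal R).map ψ = maximalIdeal A := by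
    refine le_antisymm (Ideal.map_le_iff_le_comap.2 fun r hr => ?_) fun b hb => ?_
    · have := IsLocalHom.of_surjective ψ hψ
      exact fun h => hr (isUnit_of_map_unit ψ r h)
    · obtain ⟨r, rfl⟩ := hψ b
      exact Ideal.mem_map_of_mem ψ (hψm r hb)
  have hpow : maximalIdeal R ^ N ≤ (maximalIdeal A ^ N).comap ψ := by
    rw [← Ideal.map_le_iff_le_comap, Ideal.map_pow, hmap]
  let := (iS.comp iF).toAlgebra
  let := (iR.comp iF).toAlgebra
  let := (φ.comp (iS.comp iF)).toAlgebra
  let φ' : S →ₐ[F] A := { φ with commutes' := fun _ => rfl }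
  -- Both maps from the prime field to `A` agree, whatever `iS` and `iR` are.
  let ψ' : R →ₐ[F] A := { ψ with
    commutes' := fun t => congrArg (fun f : F →+* A => f t)
      ((hF A).elim (ψ.comp (iR.comp iF)) (φ.comp (iS.comp iF))) }
  let mA : A →ₐ[F] A ⧸ maximalIdeal A ^ N := Ideal.Quotient.mkₐ F _
  let Ψ : (R ⧸ maximalIdeal R ^ N) →ₐ[F] A ⧸ maximalIdeal A ^ N :=
    Ideal.Quotient.liftₐ _ (mA.comp ψ') fun r hr => Ideal.Quotient.eq_zero_iff_mem.2 (hpow hr)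
  have hΨ : Function.Surjective Ψ := fun b => by
    obtain ⟨b, rfl⟩ := Ideal.Quotient.mk_surjective b
    obtain ⟨r, rfl⟩ := hψ b
    exact ⟨Ideal.Quotient.mk _ r, rfl⟩
  obtain ⟨θ, hθ⟩ := exists_ringHom_lift (mA.comp φ') Ψ hΨ
    (n := (maximalIdeal R).map (Ideal.Quotient.mk (maximalIdeal R ^ N))) hN
    (by rw [← Ideal.map_pow]; exact Ideal.map_quotient_self _)
    (fun q hq => by
      obtain ⟨r, rfl⟩ := Ideal.Quotient.mk_surjective q
      exact Ideal.mem_map_of_mem _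
        (hψm r (Ideal.pow_le_self hN (Ideal.Quotient.eq_zero_iff_mem.1 hq))))
    (fun s hs => by
      obtain ⟨r, hr⟩ := hψ (φ s)
      refine ⟨Ideal.Quotient.mk _ r, Ideal.mem_map_of_mem _ (hψm r ?_), congrArg mA hr⟩
      rw [hr]
      exact fun h => hs (isUnit_of_map_unit φ s h))
  refine ⟨θ, fun s => ?_⟩
  obtain ⟨r, hr⟩ := Ideal.Quotient.mk_surjective (θ s)
  have h1 : ψ r - φ s ∈ maximalIdeal A ^ N := by
    have := hθ s
    rw [← hr] at this
    exact (Ideal.Quotient.mk_eq_mk_iff_sub_mem _ _).1 this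
  rw [← hmap, ← Ideal.map_pow] at h1
  obtain ⟨e, he, he'⟩ := (Ideal.mem_map_iff_of_surjective ψ hψ).1 h1
  refine ⟨r - e, ?_, ?_⟩
  · rw [map_sub, hr, Ideal.Quotient.eq_zero_iff_mem.2 he, sub_zero]
  · rw [map_sub, he', sub_sub_cancel]

/-- An element of `Sym_S(I)` can be lifted along a homomorphism `θ : S → R / m` over `A`, with a bound
for the degree of the lift which does not depend on `θ`. -/
theorem exists_sym_lift {φ : S →+* A} {ψ : R →+* A} (a : Ideal A)
    (z : SymmetricAlgebra S (a.comap φ)) :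
    ∃ D : ℕ, ∀ (m : Ideal R) (θ : S →+* R ⧸ m),
      (∀ s, ∃ r, Ideal.Quotient.mk m r = θ s ∧ ψ r = φ s) →
      ∃ ζ : SymmetricAlgebra R (a.comap ψ),
        symMap ψ (a.comap ψ) a le_rfl ζ = symMap φ (a.comap φ) a le_rfl z ∧
        (symToRees _ ζ : Polynomial R).map (Ideal.Quotient.mk m) =
          (symToRees _ z : Polynomial S).map θ ∧
        (symToRees _ ζ : Polynomial R).natDegree ≤ D := by
  induction z using SymmetricAlgebra.induction with
  | algebraMap s =>
    refine ⟨0, fun m θ h => ?_⟩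
    obtain ⟨r, hr, hr'⟩ := h s
    refine ⟨algebraMap R _ r, by rw [symMap_algebraMap, symMap_algebraMap, hr'], ?_, ?_⟩
    · rw [AlgHom.commutes, AlgHom.commutes]
      change (Polynomial.C r).map _ = (Polynomial.C s).map θ
      rw [Polynomial.map_C, Polynomial.map_C, hr]
    · rw [AlgHom.commutes]
      exact (Polynomial.natDegree_C r).le
  | ι x =>
    refine ⟨1, fun m θ h => ?_⟩
    obtain ⟨r, hr, hr'⟩ := h x
    have hra : r ∈ a.comap ψ := by rw [Ideal.mem_comap, hr']; exact x.2
    refine ⟨SymmetricAlgebra.ι R _ ⟨r, hra⟩, ?_, ?_, ?_⟩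
    · rw [symMap_ι, symMap_ι]; exact congrArg _ (Subtype.ext hr')
    · rw [symToRees_ι, symToRees_ι, Polynomial.map_monomial, Polynomial.map_monomial, hr]
    · rw [symToRees_ι]; exact Polynomial.natDegree_monomial_le _
  | mul z w hz hw =>
    obtain ⟨D, hD⟩ := hz
    obtain ⟨D', hD'⟩ := hw
    refine ⟨D + D', fun m θ h => ?_⟩
    obtain ⟨ζ, h1, h2, h3⟩ := hD m θ h
    obtain ⟨ζ', h1', h2', h3'⟩ := hD' m θ h
    refine ⟨ζ * ζ', by rw [map_mul, map_mul, h1, h1'], ?_, ?_⟩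
    · rw [map_mul, map_mul, MulMemClass.coe_mul, MulMemClass.coe_mul, Polynomial.map_mul,
        Polynomial.map_mul, h2, h2']
    · rw [map_mul, MulMemClass.coe_mul]
      exact Polynomial.natDegree_mul_le.trans (add_le_add h3 h3')
  | add z w hz hw =>
    obtain ⟨D, hD⟩ := hz
    obtain ⟨D', hD'⟩ := hw
    refine ⟨max D D', fun m θ h => ?_⟩
    obtain ⟨ζ, h1, h2, h3⟩ := hD m θ h
    obtain ⟨ζ', h1', h2', h3'⟩ := hD' m θ h
    refine ⟨ζ + ζ', by rw [map_add, map_add, h1, h1'], ?_, ?_⟩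
    · rw [map_add, map_add, AddMemClass.coe_add, AddMemClass.coe_add, Polynomial.map_add,
        Polynomial.map_add, h2, h2']
    · rw [map_add, AddMemClass.coe_add]
      exact (Polynomial.natDegree_add_le _ _).trans (max_le_max h3 h3')

theorem eq_sum_reesMonomial (I : Ideal R) (f : reesAlgebra I) {D : ℕ}
    (hD : (f : Polynomial R).natDegree ≤ D) :
    f = ∑ n ∈ Finset.range (D + 1), reesMonomial I n ((f : Polynomial R).coeff n)
      ((mem_reesAlgebra_iff I _).1 f.2 n) := by
  refine Subtype.ext ?_
  rw [AddSubmonoidClass.coe_finsetSum]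
  exact (f : Polynomial R).as_sum_range' (D + 1) (Nat.lt_succ_of_le hD)

/-- Artin–Rees for each of the ideals `I^n` in `R`. A common constant exists because only the
finitely many `n ≤ D` are considered, whence the need for a degree bound; the final `+ 1` only makes
`N` nonzero. -/
theorem exists_pow_inf_le_smul [IsNoetherianRing R] (m I : Ideal R) (D M : ℕ) :
    ∃ N ≠ 0, ∀ n ≤ D, m ^ N ⊓ I ^ n ≤ m ^ M * I ^ n := by
  choose k hk using fun n : ℕ => Ideal.exists_pow_inf_eq_pow_smul m (I ^ n)
  refine ⟨(∑ n ∈ Finset.range (D + 1), k n) + M + 1, by omega, fun n hn => ?_⟩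
  have h1 : k n ≤ ∑ n ∈ Finset.range (D + 1), k n :=
    Finset.single_le_sum (fun _ _ => Nat.zero_le _) (Finset.mem_range.2 (by omega))
  have h2 := hk n ((∑ n ∈ Finset.range (D + 1), k n) + M + 1) (by omega)
  rw [smul_eq_mul, Ideal.mul_top] at h2
  rw [h2]
  exact Ideal.mul_mono (Ideal.pow_le_pow_right (by omega)) inf_le_right

/-- Krull's intersection theorem for the images of elements of bounded degree of a Rees algebra. -/
theorem reesAlgebra_map_eq_zero [IsLocalRing R] [IsNoetherianRing R] {I : Ideal R} {Q : Type*}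
    [CommRing Q] (ρ : reesAlgebra I →+* Q) (w : Q) (D : ℕ)
    (h : ∀ N ≠ 0, ∃ f : reesAlgebra I, ρ f = w ∧
      (f : Polynomial R).natDegree ≤ D ∧ ∀ n, (f : Polynomial R).coeff n ∈ maximalIdeal R ^ N) :
    w = 0 := by
  let := (ρ.comp (algebraMap R (reesAlgebra I))).toAlgebra
  let v (n : ℕ) : ↥(I ^ n) →ₗ[R] Q :=
    { toFun := fun c => ρ (reesMonomial I n c c.2)
      map_add' := fun c d => by
        rw [← map_add]; exact congrArg _ (Subtype.ext (map_add (Polynomial.monomial n) _ _))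
      map_smul' := fun r c => by
        rw [Algebra.smul_def]
        refine Eq.trans (congrArg _ (Subtype.ext ?_)) (map_mul ρ _ _)
        exact (Polynomial.C_mul_monomial ..).symm }
  -- The images of the parts of degree at most `D` span a finite `R`-module, although the Rees
  -- algebra and `Q` need not be finite.
  let V : Submodule R (Q) := ⨆ n ∈ Finset.range (D + 1), LinearMap.range (v n)
  have hV : V.FG := Submodule.fg_biSup _ _ fun n _ => by
    rw [LinearMap.range_eq_map]; exact Submodule.FG.map _ (IsNoetherian.noetherian _)
  have hfin : Module.Finite R V := Module.Finite.iff_fg.2 hV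
  -- With coefficients in `m^N ∩ I^n ⊆ m^M I^n`, each term of `f` is mapped into `m^M V`. So `w`
  -- lies in all the `m^M V`, whose intersection is zero.
  have key : ∀ M : ℕ, w ∈ maximalIdeal R ^ M • V := fun M => by
    obtain ⟨N, hN, hNM⟩ := exists_pow_inf_le_smul (maximalIdeal R) I D M
    obtain ⟨f, rfl, hf, hfN⟩ := h N hN
    rw [eq_sum_reesMonomial I f hf, map_sum]
    refine Submodule.sum_mem _ fun n hn => ?_
    have hmem : (f : Polynomial R).coeff n ∈ I ^ n := (mem_reesAlgebra_iff I _).1 f.2 n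
    have h1 := hNM n (by simpa [Nat.lt_succ_iff] using hn) ⟨hfN n, hmem⟩
    have h2 : (⟨_, hmem⟩ : ↥(I ^ n)) ∈ maximalIdeal R ^ M • (⊤ : Submodule R ↥(I ^ n)) :=
      (Submodule.mem_smul_top_iff _ _ _).2 h1
    have h3 := Submodule.mem_map_of_mem (f := v n) h2
    rw [Submodule.map_smul'', ← LinearMap.range_eq_map] at h3
    exact smul_mono_right _
      (le_iSup₂ (f := fun n (_ : n ∈ Finset.range (D + 1)) => LinearMap.range (v n)) n hn) h3
  have hw : w ∈ V := Submodule.smul_le_right (key 0)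
  have h0 := Ideal.iInf_pow_smul_eq_bot_of_isLocalRing (M := V) (maximalIdeal R)
    (Ideal.IsPrime.ne_top inferInstance)
  have h1 : (⟨w, hw⟩ : V) ∈ (⨅ i : ℕ, maximalIdeal R ^ i • ⊤ : Submodule R V) :=
    Submodule.mem_iInf _ |>.2 fun M => (Submodule.mem_smul_top_iff _ _ _).2 (key M)
  rw [h0, Submodule.mem_bot] at h1
  exact congrArg Subtype.val h1

namespace QSym

variable {φ : S →+* A} {ψ : R →+* A}

/-- The relations of the Rees algebra of a regular local ring hold in every quasi-symmetric algebra. -/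
theorem ofSym_symMap_eq_zero {k : Type u} [Field k] [IsRegularLocalRing S] [IsLocalRing R]
    [IsNoetherianRing R] [IsLocalRing A] (iS : k →+* S) (iR : k →+* R) [IsLocalHom φ]
    (hψ : Function.Surjective ψ) (a : Ideal A) (z : SymmetricAlgebra S (a.comap φ))
    (hz : symToRees _ z = 0) : ofSym ψ a (symMap φ (a.comap φ) a le_rfl z) = 0 := by
  obtain ⟨D, hD⟩ := exists_sym_lift (ψ := ψ) a z
  -- For each `N` the lift `ζ` of `z` along `θ` has the image of `z` in `Sym_A(a)`, so its Rees
  -- element maps to the same `w`. Modulo `m^N` this Rees element is the image of that of `z`, which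
  -- is zero.
  refine reesAlgebra_map_eq_zero (ofRees ψ a) _ D fun N hN => ?_
  obtain ⟨θ, hθ⟩ := exists_quotient_lift iS iR φ ψ hψ hN
  obtain ⟨ζ, h1, h2, h3⟩ := hD _ θ hθ
  refine ⟨symToRees _ ζ, ?_, h3, fun n => ?_⟩
  · rw [← ofSym_symMap, h1]
  · rw [hz, ZeroMemClass.coe_zero, Polynomial.map_zero] at h2
    rw [← Ideal.Quotient.eq_zero_iff_mem, ← Polynomial.coeff_map, h2, Polynomial.coeff_zero]

end QSym

end Comparison

open TensorProduct Polynomial AlgebraicGeometry CategoryTheory TopologicalSpace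

/-! ### Quasi-symmetric algebras as quotients of the symmetric algebra. -/

section Comparison

variable {R S A : Type u} [CommRing R] [CommRing S] [CommRing A]

theorem exists_symToRees_eq_reesMonomial (I : Ideal R) {n : ℕ} {c : R} (hc : c ∈ I ^ n) :
    ∃ y ∈ symDeg I n, symToRees I y = reesMonomial I n c hc := by
  refine Submodule.pow_induction_on_left' (M := I)
    (C := fun n c hc => ∃ y ∈ symDeg I n, symToRees I y = reesMonomial I n c hc) (fun r => ?_)
    (fun x y i _ _ => ?_) (fun m hm i x hx => ?_) hc
  · refine ⟨algebraMap R _ r, ?_, (AlgHom.commutes _ r).trans (Subtype.ext rfl)⟩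
    rw [symDeg, pow_zero]; exact Submodule.algebraMap_mem _
  · rintro ⟨y, hy, e⟩ ⟨y', hy', e'⟩
    refine ⟨y + y', add_mem hy hy', ?_⟩
    rw [map_add, e, e']
    exact Subtype.ext (map_add (monomial i) _ _).symm
  · rintro ⟨y, hy, e⟩
    refine ⟨SymmetricAlgebra.ι R I ⟨m, hm⟩ * y, ?_, ?_⟩
    · rw [symDeg, pow_succ']
      exact Submodule.mul_mem_mul (LinearMap.mem_range_self _ _) hy
    · rw [map_mul, e]
      refine Subtype.ext ?_
      rw [MulMemClass.coe_mul, symToRees_ι]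
      exact (monomial_mul_monomial 1 i m x).trans (by rw [add_comm]; rfl)

theorem symToRees_surjective (I : Ideal R) : Function.Surjective (symToRees I) := fun f => by
  choose y _ hy using fun n => exists_symToRees_eq_reesMonomial I ((mem_reesAlgebra_iff I _).1 f.2 n)
  refine ⟨∑ n ∈ Finset.range ((f : R[X]).natDegree + 1), y n, ?_⟩
  rw [map_sum]
  exact (Finset.sum_congr rfl fun n _ => hy n).trans (eq_sum_reesMonomial I f le_rfl).symm

namespace QSym

variable {φ : S →+* A} {ψ : R →+* A} {a : Ideal A}

theorem exists_ofSym_eq_of_mem_deg {n : ℕ} {z : QSym φ a} (hz : z ∈ deg φ a n) :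
    ∃ x ∈ symDeg a n, ofSym φ a x = z := by
  suffices deg φ a n ≤ ((symDeg a n).toAddSubgroup.map (ofSym φ a).toAddMonoidHom) from this hz
  refine (AddSubgroup.closure_le _).2 ?_
  rintro _ ⟨i, j, rfl, x, hx, r, hr, rfl⟩
  obtain ⟨y, hy, e⟩ := exists_symToRees_eq_reesMonomial _ hr
  refine ⟨x * symMap φ (a.comap φ) a le_rfl y, ?_, ?_⟩
  · change _ ∈ symDeg a (i + j)
    rw [symDeg, pow_add]
    exact Submodule.mul_mem_mul hx (symMap_mem_symDeg _ _ _ _ j hy)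
  · change ofSym φ a (_ * _) = _
    rw [map_mul, ofSym_symMap, e]

theorem ofSym_mem_deg {n : ℕ} {x : SymmetricAlgebra A a} (hx : x ∈ symDeg a n) :
    ofSym φ a x ∈ deg φ a n := by
  have hs : (1 : S) ∈ a.comap φ ^ 0 := by rw [pow_zero, Ideal.one_eq_top]; trivial
  refine AddSubgroup.subset_closure ⟨n, 0, rfl, x, hx, 1, hs, ?_⟩
  rw [show reesMonomial (a.comap φ) 0 1 hs = 1 from Subtype.ext rfl, map_one, mul_one]

/-- Base change of the surjection `Sym_S → Rees_S`. Consequently homomorphisms under `Sym_A(a)` are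
unique, and all later compatibilities are checked on images of elements of the symmetric algebra. -/
theorem ofSym_surjective : Function.Surjective (ofSym φ a) := fun z => by
  refine RingTensor.induction (motive := fun z => ∃ x, ofSym φ a x = z) ⟨0, map_zero _⟩
    (fun x y => ?_) ?_ z
  · obtain ⟨y, rfl⟩ := symToRees_surjective _ y
    exact ⟨x * symMap φ (a.comap φ) a le_rfl y,
      (map_mul _ _ _).trans (congrArg _ (ofSym_symMap y))⟩
  · rintro _ _ ⟨x, rfl⟩ ⟨y, rfl⟩
    exact ⟨x + y, map_add _ _ _⟩

/-- If the relations of the Rees algebra on the side of `φ` hold in the quasi-symmetric algebra of `ψ`,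
there is a homomorphism of quasi-symmetric algebras under `Sym_A(a)`. -/
theorem exists_comparison (h : ∀ z : SymmetricAlgebra S (a.comap φ), symToRees _ z = 0 →
    ofSym ψ a (symMap φ (a.comap φ) a le_rfl z) = 0) :
    ∃ f : QSym φ a →+* QSym ψ a, ∀ x, f (ofSym φ a x) = ofSym ψ a x := by
  let γ : {g : SymmetricAlgebra S (a.comap φ) →+* QSym ψ a //
      RingHom.ker (symToRees (a.comap φ)).toRingHom ≤ RingHom.ker g} :=
    ⟨(ofSym ψ a).comp (symMap φ (a.comap φ) a le_rfl), fun z hz => h z hz⟩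
  let q : reesAlgebra (a.comap φ) →+* QSym ψ a :=
    RingHom.liftOfSurjective (symToRees (a.comap φ)).toRingHom (symToRees_surjective _) γ
  have hq (z) : q ((symToRees (a.comap φ)).toRingHom z) =
      ofSym ψ a (symMap φ (a.comap φ) a le_rfl z) :=
    RingHom.liftOfRightInverse_comp_apply (symToRees (a.comap φ)).toRingHom _
      (Function.rightInverse_surjInv (symToRees_surjective _)) γ z
  exact ⟨RingTensor.lift (ofSym ψ a) q fun z => (hq z).symm, RingTensor.lift_inl _ _ _⟩

end QSym

end Comparison

/-! ### From comparison of stalks to homomorphisms of sheaves. -/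

section Sheaf

variable {X Y M N : Scheme.{u}} (j : Y ⟶ X) (i : X ⟶ M) (i' : X ⟶ N)

/-- The structure homomorphism from the symmetric algebra of the stalk of the ideal sheaf. -/
noncomputable def QSymAt.ofSym (x : X) :
    SymmetricAlgebra (X.presheaf.stalk x) (idealAt j x) →+* QSymAt j i x :=
  QSym.ofSym (i.stalkMap x).hom (idealAt j x)

/-- The germ of a section of the presheaf of symmetric algebras. -/
noncomputable def symGerm (V : X.Opens) (x : X) (hx : x ∈ V) :
    SymmetricAlgebra Γ(X, V) (idealOn j V) →+*
      SymmetricAlgebra (X.presheaf.stalk x) (idealAt j x) :=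
  symMap (X.presheaf.germ V x hx).hom _ _ (idealOn_le_idealAt j hx)

/-- The homogeneous sections are those which lift locally to the symmetric algebra of the ideal
sheaf. -/
theorem mem_homogeneousSections_iff [IsClosedImmersion i] {U : X.Opens} {d : ℕ}
    {s : ∀ x : U, QSymAt j i x} :
    s ∈ homogeneousSections j i U d ↔ ∀ x : U, ∃ V : X.Opens, (x : X) ∈ V ∧
      ∃ t ∈ symDeg (idealOn j V) d, ∀ (y : U) (hy : (y : X) ∈ V),
        s y = QSymAt.ofSym j i y (symGerm j V y hy t) := by
  refine ⟨fun hs x => ?_, fun hs x => ?_⟩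
  · obtain ⟨W, hx, t, ht, h⟩ := hs x
    obtain ⟨τ, hτ, rfl⟩ := QSym.exists_ofSym_eq_of_mem_deg ht
    exact ⟨i ⁻¹ᵁ W, hx, τ, hτ, fun y hy => (h y hy).trans (QSym.map_ofSym _ _ _ _ τ)⟩
  · obtain ⟨V, hx, t, ht, h⟩ := hs x
    -- The topology of `X` is induced from `M`, so `t` may be restricted to the trace of an open set
    -- of the ambient scheme.
    obtain ⟨W, hxW, hW⟩ := exists_preimage_le i hx
    let τ := symMap (X.presheaf.map (homOfLE hW).op).hom _ _ (idealOn_le_res j hW) t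
    refine ⟨W, hxW, QSym.ofSym _ _ τ, QSym.ofSym_mem_deg (symMap_mem_symDeg _ _ _ _ d ht),
      fun y hy => ?_⟩
    rw [h y (hW hy)]
    refine Eq.trans ?_ (QSym.map_ofSym _ _ _ _ τ).symm
    refine congrArg (QSymAt.ofSym j i y) ?_
    have e : (X.presheaf.germ (i ⁻¹ᵁ W) y hy).hom.comp (X.presheaf.map (homOfLE hW).op).hom =
        (X.presheaf.germ V y (hW hy)).hom :=
      congrArg CommRingCat.Hom.hom (X.presheaf.germ_res (homOfLE hW) y.1 hy)
    have hle : idealOn j V ≤ (idealAt j y.1).comap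
        ((X.presheaf.germ (i ⁻¹ᵁ W) y hy).hom.comp (X.presheaf.map (homOfLE hW).op).hom) := by
      rw [e]; exact idealOn_le_idealAt j _
    refine Eq.trans ?_ (QSym.symMap_symMap _ _ _ _ _ (idealOn_le_res j hW)
      (idealOn_le_idealAt j _) hle t).symm
    simp only [e]
    rfl

variable {i i'}

/-- The homomorphism of sheaves given by homomorphisms of the stalks under the symmetric algebra. -/
noncomputable def qSymHom [IsClosedImmersion i] [IsClosedImmersion i']
    (f : ∀ x, QSymAt j i x →+* QSymAt j i' x)
    (hf : ∀ x z, f x (QSymAt.ofSym j i x z) = QSymAt.ofSym j i' x z) :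
    (qSym j i).Hom (qSym j i') :=
  have hdeg (U : X.Opens) (d : ℕ) (s : ∀ x : U, QSymAt j i x)
      (hs : s ∈ homogeneousSections j i U d) :
      (fun x : U => f x (s x)) ∈ homogeneousSections j i' U d := by
    rw [mem_homogeneousSections_iff] at hs ⊢
    intro x
    obtain ⟨V, hx, t, ht, h⟩ := hs x
    exact ⟨V, hx, t, ht, fun y hy => by rw [h y hy, hf]⟩
  let F (U : X.Opens) : (∀ x : U, QSymAt j i x) →+* ∀ x : U, QSymAt j i' x :=
    RingHom.pi fun x : U => (f x).comp (Pi.evalRingHom (fun x : U => QSymAt j i x) x)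
  { app := fun U => ((F U).comp
        (GradedAlgSheaf.locallySum (isHomogeneousSystem j i) U).subtype).codRestrict
      (GradedAlgSheaf.locallySum (isHomogeneousSystem j i') U) fun s x => by
        obtain ⟨V, h, hx, hV⟩ := s.2 x
        refine ⟨V, h, hx, ?_⟩
        suffices ⨆ d, homogeneousSections j i V d ≤ (⨆ d, homogeneousSections j i' V d).comap
          (F V).toAddMonoidHom from this hV
        exact iSup_le fun d s hs => (le_iSup (homogeneousSections j i' V) d) (hdeg V d s hs)
    app_algMap := fun U c => Subtype.ext (funext fun x => hf x _)
    app_mem_deg := fun U d s hs => hdeg U d _ hs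
    app_res := fun _ _ => rfl }

theorem QSymAt.ofSym_surjective (x : X) : Function.Surjective (QSymAt.ofSym j i x) :=
  QSym.ofSym_surjective

theorem qsymTransition_ofSym {f : M ⟶ N} (w : i ≫ f = i') (x : X)
    (z : SymmetricAlgebra (X.presheaf.stalk x) (idealAt j x)) :
    qsymTransition j w x (QSymAt.ofSym j i' x z) = QSymAt.ofSym j i x z := by
  refine (QSym.map_ofSym _ _ _ _ z).trans (congrArg (QSymAt.ofSym j i x) ?_)
  refine congrArg (fun g : SymmetricAlgebra (X.presheaf.stalk x) (idealAt j x) →+* _ => g z)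
    (sym_hom_ext (g := RingHom.id _) (fun r => ?_) (fun r => ?_))
  · exact symMap_algebraMap _ _ _ _ r
  · exact symMap_ι _ _ _ _ r

variable {k : Type u} [Field k] {p : X ⟶ Spec (.of k)}

/-- A ring homomorphism from the ground field to a stalk. -/
noncomputable def stalkFieldMap (q : M ⟶ Spec (.of k)) (x : M) : k →+* M.presheaf.stalk x :=
  ((Scheme.ΓSpecIso (.of k)).inv ≫ q.appTop ≫ M.presheaf.germ ⊤ x trivial).hom

/-- Regularity is needed only at the source. At the target the local ring has to be Noetherian, for
Artin–Rees and Krull, and this follows from finite type over `k`. -/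
theorem exists_stalk_comparison (E E' : AmbientEmbedding p) (hE : E.IsNonsingular) (x : X) :
    ∃ f : QSymAt j E.emb x →+* QSymAt j E'.emb x,
      ∀ z, f (QSymAt.ofSym j E.emb x z) = QSymAt.ofSym j E'.emb x z := by
  have := hE (E.emb x)
  have := E'.locallyOfFiniteType
  have : IsLocallyNoetherian E'.M := LocallyOfFiniteType.isLocallyNoetherian E'.str
  exact QSym.exists_comparison fun z hz => QSym.ofSym_symMap_eq_zero (stalkFieldMap E.str _)
    (stalkFieldMap E'.str _) (E'.emb.stalkMap_surjective x) _ z hz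

end Sheaf

/-! ### Gluing closed immersions into a locally directed colimit. -/

section Glue

variable {J : Type u} [Preorder J] (F : J ⥤ Scheme.{u}) [∀ {v w : J} (h : v ⟶ w), IsOpenImmersion (F.map h)]
  [(F ⋙ Scheme.forget).IsLocallyDirected]

/-- Closed immersions into the members of a locally directed diagram glue to a closed immersion into
its colimit. -/
theorem exists_isClosedImmersion_colimit {M : Scheme.{u}} {W : J → M.Opens} (hW : Monotone W)
    (hcover : ∀ m, ∃ w, m ∈ W w)
    (hdirected : ∀ m v w, m ∈ W v → m ∈ W w → ∃ l, l ≤ v ∧ l ≤ w ∧ m ∈ W l)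
    (a : ∀ w, (W w).toScheme ⟶ F.obj w) [∀ w, IsClosedImmersion (a w)]
    (ha : ∀ {v w} (h : v ≤ w), M.homOfLE (hW h) ≫ a w = a v ≫ F.map (homOfLE h))
    (hmem : ∀ {v w} (h : v ≤ w) (m : (W w).toScheme), a w m ∈ Set.range (F.map (homOfLE h)) →
      (W w).ι m ∈ W v) :
    ∃ g : M ⟶ Limits.colimit F, IsClosedImmersion g ∧
      ∀ w, (W w).ι ≫ g = a w ≫ Limits.colimit.ι F w := by
  let 𝒰 : M.OpenCover :=
    { I₀ := J
      X := fun w => W w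
      f := fun w => (W w).ι
      mem₀ := by
        rw [Scheme.presieve₀_mem_precoverage_iff]
        exact ⟨fun m => (hcover m).imp fun w hw => by simpa using hw, inferInstance⟩ }
  let : Category 𝒰.I₀ := inferInstanceAs (Category J)
  let : 𝒰.LocallyDirected :=
    { trans := fun {v w} h => M.homOfLE (hW (leOfHom h))
      trans_id := fun w => by rw [← cancel_mono (W w).ι]; simp; rfl
      trans_comp := fun {v w l} _ _ => by rw [← cancel_mono (W l).ι]; simp
      w := fun _ => M.homOfLE_ι _
      directed := fun {v w} x => by
        have hv : (Limits.pullback.fst (W v).ι (W w).ι ≫ (W v).ι) x ∈ W v :=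
          (Limits.pullback.fst (W v).ι (W w).ι x).2
        have hw : (Limits.pullback.fst (W v).ι (W w).ι ≫ (W v).ι) x ∈ W w := by
          rw [Limits.pullback.condition]
          exact (Limits.pullback.snd (W v).ι (W w).ι x).2
        obtain ⟨l, hv, hw, hl⟩ := hdirected _ v w hv hw
        obtain ⟨y, hy⟩ : ∃ y, (W l).ι y = (Limits.pullback.fst (W v).ι (W w).ι ≫ (W v).ι) x := ⟨⟨_, hl⟩, rfl⟩
        refine ⟨l, homOfLE hv, homOfLE hw, y, ?_⟩
        apply (Limits.pullback.fst (W v).ι (W w).ι ≫ (W v).ι).isOpenEmbedding.injective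
        refine Eq.trans ?_ hy
        refine (Scheme.Hom.comp_apply _ _ _).symm.trans ?_
        refine congrArg (fun f : (W l).toScheme ⟶ M => f y) ?_
        exact (Limits.pullback.lift_fst_assoc _ _ _ _).trans (M.homOfLE_ι _) }
  let g : M ⟶ Limits.colimit F := 𝒰.glueMorphismsOfLocallyDirected
    (fun w => a w ≫ Limits.colimit.ι F w) fun {v w} h => by
      refine (Category.assoc _ _ _).symm.trans ?_
      refine (congrArg (· ≫ Limits.colimit.ι F w) (ha (leOfHom h))).trans ?_
      exact (Category.assoc _ _ _).trans (congrArg (a v ≫ ·) (Limits.colimit.w F h))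
  have hg (w) : (W w).ι ≫ g = a w ≫ Limits.colimit.ι F w :=
    𝒰.map_glueMorphismsOfLocallyDirected _ _ w
  -- The preimage under `g` of the chart `F w` is `W w`: a point of `F v` and one of `F w` with the
  -- same image in the colimit come from a common smaller chart, and `hmem` transfers this to `M`.
  have hpre (w) (m : M) (y : F.obj w) (h : g m = Limits.colimit.ι F w y) : m ∈ W w := by
    obtain ⟨v, hv⟩ := hcover m
    obtain ⟨x, rfl⟩ : ∃ x, (W v).ι x = m := ⟨⟨m, hv⟩, rfl⟩
    have h1 : Limits.colimit.ι F v (a v x) = Limits.colimit.ι F w y := by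
      rw [← Scheme.Hom.comp_apply, ← hg, Scheme.Hom.comp_apply, h]
    obtain ⟨l, lv, lw, z, hz, -⟩ := (Scheme.IsLocallyDirected.ι_eq_ι_iff F).1 h1
    exact hW (leOfHom lw) (hmem (leOfHom lv) x ⟨z, hz⟩)
  refine ⟨g, ?_, hg⟩
  refine (IsZariskiLocalAtTarget.iff_of_openCover (P := @IsClosedImmersion)
    (Scheme.IsLocallyDirected.openCover F)).2 fun (w : J) => ?_
  -- Hence over each chart `g` restricts to `a w`, and being a closed immersion is local on the
  -- target.
  have hp : IsPullback (W w).ι (a w) g (Limits.colimit.ι F w) := by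
    have hr (s : Limits.PullbackCone g (Limits.colimit.ι F w)) :
        Set.range s.fst ⊆ Set.range (W w).ι := by
      rintro _ ⟨x, rfl⟩
      rw [Scheme.Opens.range_ι]
      refine hpre w _ (s.snd x) ?_
      rw [← Scheme.Hom.comp_apply, s.condition]; rfl
    refine ⟨⟨hg w⟩, ⟨Limits.PullbackCone.IsLimit.mk _ (fun s => IsOpenImmersion.lift (W w).ι s.fst (hr s))
      (fun s => IsOpenImmersion.lift_fac _ _ _) (fun s => ?_) fun s m h1 h2 => ?_⟩⟩
    · rw [← cancel_mono (Limits.colimit.ι F w), Category.assoc, ← hg, IsOpenImmersion.lift_fac_assoc,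
        s.condition]
    · rw [← cancel_mono (W w).ι, h1, IsOpenImmersion.lift_fac]
  have : Limits.pullback.snd g (Limits.colimit.ι F w) = hp.isoPullback.inv ≫ a w :=
    (hp.isoPullback_inv_snd).symm
  change IsClosedImmersion (Limits.pullback.snd g (Limits.colimit.ι F w))
  rw [this]
  infer_instance

end Glue

/-! ### Pairs of sections of two ambient schemes which agree on `X`. -/

section Pairs

variable {X M M' : Scheme.{u}}

/-- The restriction of sections to a smaller open set. -/
noncomputable def sectionRes {O W : M.Opens} (h : O ≤ W) : Γ(M, W) →+* Γ(M, O) :=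
  (M.presheaf.map (homOfLE h).op).hom

theorem sectionRes_sectionRes {V O W : M.Opens} (h : V ≤ O) (h' : O ≤ W) (s : Γ(M, W)) :
    sectionRes h (sectionRes h' s) = sectionRes (h.trans h') s :=
  congrArg (fun g : Γ(M, W) ⟶ Γ(M, V) => g s) (M.presheaf.map_comp (homOfLE h').op (homOfLE h).op).symm

theorem basicOpen_sectionRes {O W : M.Opens} (h : O ≤ W) (s : Γ(M, W)) :
    M.basicOpen (sectionRes h s) = O ⊓ M.basicOpen s :=
  M.basicOpen_res s (homOfLE h).op

theorem isUnit_sectionRes {O W : M.Opens} (h : O ≤ W) {f : Γ(M, W)} (e : O ≤ M.basicOpen f) :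
    IsUnit (sectionRes h f) := by
  have : M.basicOpen (sectionRes h f) = O := by
    rw [basicOpen_sectionRes]; exact inf_eq_left.2 e
  exact (RingedSpace.isUnit_of_isUnit_germ M.toRingedSpace O _ fun x hx =>
    (Scheme.mem_basicOpen M (sectionRes h f) x hx).1 (this.ge hx))

theorem exists_mul_pow_eq_sectionRes {O W : M.Opens} (hW : IsAffineOpen W) (h : O ≤ W)
    {f : Γ(M, W)} (e : O = M.basicOpen f) (s : Γ(M, O)) :
    ∃ (n : ℕ) (a : Γ(M, W)), s * sectionRes h f ^ n = sectionRes h a := by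
  let := (sectionRes h).toAlgebra
  have : IsLocalization.Away f Γ(M, O) := hW.isLocalization_of_eq_basicOpen f (homOfLE h) e
  exact IsLocalization.Away.surj f s

theorem exists_pow_mul_eq_of_sectionRes_eq {O W : M.Opens} (hW : IsAffineOpen W) (h : O ≤ W)
    {f : Γ(M, W)} (e : O = M.basicOpen f) {s t : Γ(M, W)} (hst : sectionRes h s = sectionRes h t) :
    ∃ n : ℕ, f ^ n * s = f ^ n * t := by
  let := (sectionRes h).toAlgebra
  have : IsLocalization.Away f Γ(M, O) := hW.isLocalization_of_eq_basicOpen f (homOfLE h) e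
  exact IsLocalization.Away.exists_of_eq f hst

/-- The restriction of sections along a morphism. -/
noncomputable def sectionPull (i : X ⟶ M) {U : X.Opens} {W : M.Opens} (h : U ≤ i ⁻¹ᵁ W) :
    Γ(M, W) →+* Γ(X, U) :=
  (i.appLE W U h).hom

theorem sectionRes_sectionPull (i : X ⟶ M) {V U : X.Opens} {W : M.Opens} (h : U ≤ i ⁻¹ᵁ W)
    (h' : V ≤ U) (s : Γ(M, W)) :
    sectionRes h' (sectionPull i h s) = sectionPull i (h'.trans h) s :=
  congrArg (fun g : Γ(M, W) ⟶ Γ(X, V) => g s) (i.appLE_map h (homOfLE h').op)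

theorem sectionPull_sectionRes (i : X ⟶ M) {U : X.Opens} {O W : M.Opens} (h : U ≤ i ⁻¹ᵁ O)
    (h' : O ≤ W) (s : Γ(M, W)) :
    sectionPull i h (sectionRes h' s) = sectionPull i (h.trans (i.preimage_mono h')) s :=
  congrArg (fun g : Γ(M, W) ⟶ Γ(X, U) => g s) (i.map_appLE h (homOfLE h').op)

theorem basicOpen_sectionPull (i : X ⟶ M) {U : X.Opens} {W : M.Opens} (h : U ≤ i ⁻¹ᵁ W)
    (s : Γ(M, W)) : X.basicOpen (sectionPull i h s) = U ⊓ i ⁻¹ᵁ M.basicOpen s :=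
  Scheme.basicOpen_appLE i U W h s

theorem sectionPull_surjective (i : X ⟶ M) [IsClosedImmersion i] {U : X.Opens} {W : M.Opens}
    (hW : IsAffineOpen W) (e : U = i ⁻¹ᵁ W) : Function.Surjective (sectionPull i e.le) := by
  subst e
  have := i.app_surjective W hW
  rw [i.app_eq_appLE] at this
  exact this

variable (i : X ⟶ M) (i' : X ⟶ M')

/-- The pairs of sections of `M` and of `M'` which agree on `X`. -/
noncomputable def pairSubring (W : M.Opens) (W' : M'.Opens) : Subring (Γ(M, W) × Γ(M', W')) where
  carrier := {s | ∀ (U : X.Opens) (h : U ≤ i ⁻¹ᵁ W) (h' : U ≤ i' ⁻¹ᵁ W'),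
    sectionPull i h s.1 = sectionPull i' h' s.2}
  mul_mem' hs ht U h h' := by
    rw [Prod.fst_mul, Prod.snd_mul, map_mul, map_mul, hs U h h', ht U h h']
  add_mem' hs ht U h h' := by
    rw [Prod.fst_add, Prod.snd_add, map_add, map_add, hs U h h', ht U h h']
  one_mem' U h h' := by rw [Prod.fst_one, Prod.snd_one, map_one, map_one]
  zero_mem' U h h' := by rw [Prod.fst_zero, Prod.snd_zero, map_zero, map_zero]
  neg_mem' hs U h h' := by rw [Prod.fst_neg, Prod.snd_neg, map_neg, map_neg, hs U h h']

variable {i i'}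

theorem mem_pairSubring_of_eq {W : M.Opens} {W' : M'.Opens} {U : X.Opens} (hU : i ⁻¹ᵁ W ≤ U)
    (h : U ≤ i ⁻¹ᵁ W) (h' : U ≤ i' ⁻¹ᵁ W') {s : Γ(M, W)} {s' : Γ(M', W')}
    (e : sectionPull i h s = sectionPull i' h' s') : (s, s') ∈ pairSubring i i' W W' :=
  fun V hV hV' => by
    have := congrArg (sectionRes (hV.trans hU)) e
    rwa [sectionRes_sectionPull, sectionRes_sectionPull] at this

theorem mem_pairSubring_swap {W : M.Opens} {W' : M'.Opens} {s : Γ(M, W)} {s' : Γ(M', W')}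
    (h : (s, s') ∈ pairSubring i i' W W') : (s', s) ∈ pairSubring i' i W' W :=
  fun U hU hU' => (h U hU' hU).symm

/-- The restriction of pairs of sections. -/
noncomputable def pairRes {O W : M.Opens} {O' W' : M'.Opens} (h : O ≤ W) (h' : O' ≤ W') :
    pairSubring i i' W W' →+* pairSubring i i' O O' :=
  (((sectionRes h).prodMap (sectionRes h')).comp (pairSubring i i' W W').subtype).codRestrict _
    fun s U hU hU' => by
      refine (sectionPull_sectionRes i hU h _).trans (Eq.trans ?_
        (sectionPull_sectionRes i' hU' h' _).symm)
      exact s.2 U _ _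

theorem preimage_basicOpen_eq {W : M.Opens} {W' : M'.Opens} (hU : i ⁻¹ᵁ W = i' ⁻¹ᵁ W')
    (b : pairSubring i i' W W') : i ⁻¹ᵁ M.basicOpen b.1.1 = i' ⁻¹ᵁ M'.basicOpen b.1.2 := by
  have h1 := basicOpen_sectionPull i (le_refl (i ⁻¹ᵁ W)) b.1.1
  have h2 := basicOpen_sectionPull i' hU.le b.1.2
  rw [b.2 _ le_rfl hU.le, h2, hU, inf_eq_right.2 (i'.preimage_mono (M'.basicOpen_le _)),
    inf_eq_right.2] at h1
  · exact h1.symm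
  · rw [← hU]; exact i.preimage_mono (M.basicOpen_le _)

variable [IsClosedImmersion i]

/-- On affine open sets, the pairs of sections on a basic open set are a localization. -/
theorem isLocalization_pairRes {O W : M.Opens} {O' W' : M'.Opens} (hW : IsAffineOpen W)
    (hW' : IsAffineOpen W') (hU : i ⁻¹ᵁ W = i' ⁻¹ᵁ W') (h : O ≤ W) (h' : O' ≤ W')
    (b : pairSubring i i' W W') (e : O = M.basicOpen b.1.1) (e' : O' = M'.basicOpen b.1.2) :
    @IsLocalization.Away _ _ b (pairSubring i i' O O') _ (pairRes h h').toAlgebra := by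
  let := (pairRes (i := i) (i' := i') h h').toAlgebra
  have hO : i ⁻¹ᵁ O = i' ⁻¹ᵁ O' := by rw [e, e', preimage_basicOpen_eq hU]
  refine IsLocalization.Away.mk b ?_ (fun s => ?_) fun s t hst => ?_
  -- The inverses of the two components of `b` agree on `X`, being inverses of the same section.
  · obtain ⟨g, hg⟩ := (isUnit_sectionRes h e.le).exists_left_inv
    obtain ⟨g', hg'⟩ := (isUnit_sectionRes h' e'.le).exists_left_inv
    refine isUnit_iff_exists_inv'.2 ⟨⟨(g, g'), fun U hU hU' => ?_⟩, Subtype.ext (Prod.ext hg hg')⟩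
    have hb := (pairRes h h' b).2 U hU hU'
    have h1 := congrArg (sectionPull i hU) hg
    have h2 := congrArg (sectionPull i' hU') hg'
    rw [map_mul, map_one] at h1 h2
    exact left_inv_eq_right_inv h1 (by rw [← h2, mul_comm]; exact congrArg (sectionPull i' hU' g' * ·) hb)
  -- The components have separate denominators `b^n` and `b^n'`. Cross multiplication makes the
  -- numerators agree on the trace of the basic open set; a further factor `b^m` makes them agree on
  -- the whole trace. This explains the exponent `n + n' + m`.
  · obtain ⟨n, a, ha⟩ := exists_mul_pow_eq_sectionRes hW h e s.1.1
    obtain ⟨n', a', ha'⟩ := exists_mul_pow_eq_sectionRes hW' h' e' s.1.2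
    have h1 : sectionRes (i.preimage_mono h) (sectionPull i le_rfl (b.1.1 ^ n' * a)) =
        sectionRes (i.preimage_mono h) (sectionPull i' hU.le (b.1.2 ^ n * a')) := by
      rw [sectionRes_sectionPull, sectionRes_sectionPull,
        ← sectionPull_sectionRes i le_rfl h, ← sectionPull_sectionRes i' hO.le h']
      have hb : sectionPull i (le_refl (i ⁻¹ᵁ O)) (sectionRes h b.1.1) =
        sectionPull i' hO.le (sectionRes h' b.1.2) := (pairRes h h' b).2 _ le_rfl hO.le
      have hs : sectionPull i (le_refl (i ⁻¹ᵁ O)) s.1.1 = sectionPull i' hO.le s.1.2 :=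
        s.2 _ le_rfl hO.le
      simp only [map_mul, ← ha, ← ha', map_pow]
      rw [hb, hs]
      ring
    obtain ⟨m, hm⟩ := exists_pow_mul_eq_of_sectionRes_eq (hW.preimage i) (i.preimage_mono h)
      (f := sectionPull i le_rfl b.1.1) (by
        rw [basicOpen_sectionPull, e]
        exact (inf_eq_right.2 (i.preimage_mono (M.basicOpen_le _))).symm) h1
    refine ⟨n + n' + m, ⟨(b.1.1 ^ m * (b.1.1 ^ n' * a), b.1.2 ^ m * (b.1.2 ^ n * a')),
      mem_pairSubring_of_eq le_rfl le_rfl hU.le ?_⟩, Subtype.ext (Prod.ext ?_ ?_)⟩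
    · rw [map_mul, map_pow, hm, map_mul (sectionPull i' hU.le) (b.1.2 ^ m), map_pow,
        b.2 _ le_rfl hU.le]
    · change s.1.1 * sectionRes h b.1.1 ^ (n + n' + m) = sectionRes h (b.1.1 ^ m * (b.1.1 ^ n' * a))
      rw [map_mul, map_mul, ← ha, map_pow, map_pow]
      ring
    · change s.1.2 * sectionRes h' b.1.2 ^ (n + n' + m) = sectionRes h' (b.1.2 ^ m * (b.1.2 ^ n * a'))
      rw [map_mul, map_mul, ← ha', map_pow, map_pow]
      ring
  · have h1 : sectionRes h s.1.1 = sectionRes h t.1.1 := congrArg (fun z => z.1.1) hst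
    have h2 : sectionRes h' s.1.2 = sectionRes h' t.1.2 := congrArg (fun z => z.1.2) hst
    obtain ⟨n, hn⟩ := exists_pow_mul_eq_of_sectionRes_eq hW h e h1
    obtain ⟨n', hn'⟩ := exists_pow_mul_eq_of_sectionRes_eq hW' h' e' h2
    refine ⟨n + n', Subtype.ext (Prod.ext ?_ ?_)⟩
    · change b.1.1 ^ (n + n') * s.1.1 = b.1.1 ^ (n + n') * t.1.1
      rw [add_comm, pow_add, mul_assoc, hn, mul_assoc]
    · change b.1.2 ^ (n + n') * s.1.2 = b.1.2 ^ (n + n') * t.1.2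
      rw [pow_add, mul_assoc, hn', mul_assoc]

end Pairs

/-- A pair of affine open sets of `M` and of `M'` with the same trace on `X`. -/
structure AffinePair {X M M' : Scheme.{u}} (i : X ⟶ M) (i' : X ⟶ M') : Type u where
  left : M.Opens
  right : M'.Opens
  isAffineOpen_left : IsAffineOpen left
  isAffineOpen_right : IsAffineOpen right
  preimage_eq : i ⁻¹ᵁ left = i' ⁻¹ᵁ right

/-! ### Affine pairs, ordered by basic open inclusion. -/

namespace AffinePair

variable {X M M' : Scheme.{u}} {i : X ⟶ M} {i' : X ⟶ M'}

theorem ext {v w : AffinePair i i'} (h : v.left = w.left) (h' : v.right = w.right) : v = w := by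
  cases v; cases w; cases h; cases h'; rfl

def swap (w : AffinePair i i') : AffinePair i' i :=
  ⟨w.right, w.left, w.isAffineOpen_right, w.isAffineOpen_left, w.preimage_eq.symm⟩

/-- The ring of pairs of sections which agree on `X`. -/
noncomputable abbrev ring (w : AffinePair i i') : Subring (Γ(M, w.left) × Γ(M', w.right)) :=
  pairSubring i i' w.left w.right

/-- The basic open pair given by a pair of sections. -/
noncomputable def basicOpen (w : AffinePair i i') (b : w.ring) : AffinePair i i' :=
  ⟨M.basicOpen b.1.1, M'.basicOpen b.1.2, w.isAffineOpen_left.basicOpen _,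
    w.isAffineOpen_right.basicOpen _, preimage_basicOpen_eq w.preimage_eq b⟩

theorem ring_fst_surjective [IsClosedImmersion i'] (w : AffinePair i i') (s : Γ(M, w.left)) :
    ∃ s', (s, s') ∈ w.ring := by
  obtain ⟨s', hs⟩ := sectionPull_surjective i' w.isAffineOpen_right w.preimage_eq
    (sectionPull i le_rfl s)
  exact ⟨s', mem_pairSubring_of_eq le_rfl le_rfl _ hs.symm⟩

theorem ring_snd_surjective [IsClosedImmersion i] (w : AffinePair i i') (s' : Γ(M', w.right)) :
    ∃ s, (s, s') ∈ w.ring := by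
  obtain ⟨s, hs⟩ := w.swap.ring_fst_surjective s'
  exact ⟨s, mem_pairSubring_swap hs⟩

variable [IsClosedImmersion i]

/-- By localization `c = d / b^n`, so the locus of `c` inside that of `b` is the locus of `b * d`.
This gives transitivity of the order. -/
theorem exists_basicOpen_basicOpen (w : AffinePair i i') (b : w.ring) (c : (w.basicOpen b).ring) :
    ∃ d : w.ring, (w.basicOpen b).basicOpen c = w.basicOpen d := by
  have h : (w.basicOpen b).left ≤ w.left := M.basicOpen_le _
  have h' : (w.basicOpen b).right ≤ w.right := M'.basicOpen_le _
  let : Algebra w.ring (w.basicOpen b).ring := (pairRes h h').toAlgebra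
  have : IsLocalization.Away b (w.basicOpen b).ring := isLocalization_pairRes w.isAffineOpen_left
    w.isAffineOpen_right w.preimage_eq h h' b rfl rfl
  obtain ⟨n, d, hd⟩ := IsLocalization.Away.surj b c
  have h1 : c.1.1 * sectionRes h b.1.1 ^ n = sectionRes h d.1.1 := congrArg (fun z => z.1.1) hd
  have h2 : c.1.2 * sectionRes h' b.1.2 ^ n = sectionRes h' d.1.2 := congrArg (fun z => z.1.2) hd
  refine ⟨b * d, ext ?_ ?_⟩
  · have h3 := basicOpen_sectionRes h d.1.1
    rw [← h1, M.basicOpen_mul, Scheme.basicOpen_of_isUnit _ ((isUnit_sectionRes h le_rfl).pow n),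
      inf_eq_left.2 (M.basicOpen_le _)] at h3
    exact h3.trans (M.basicOpen_mul _ _).symm
  · have h3 := basicOpen_sectionRes h' d.1.2
    rw [← h2, M'.basicOpen_mul, Scheme.basicOpen_of_isUnit _ ((isUnit_sectionRes h' le_rfl).pow n),
      inf_eq_left.2 (M'.basicOpen_le _)] at h3
    exact h3.trans (M'.basicOpen_mul _ _).symm

/-- Smaller pairs are basic open pairs. -/
instance : Preorder (AffinePair i i') where
  le v w := ∃ b : w.ring, v = w.basicOpen b
  le_refl w := ⟨1, ext (Scheme.basicOpen_of_isUnit _ isUnit_one).symm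
    (Scheme.basicOpen_of_isUnit _ isUnit_one).symm⟩
  le_trans := by
    rintro _ _ w ⟨c, rfl⟩ ⟨b, rfl⟩
    exact exists_basicOpen_basicOpen w b c

theorem left_mono {v w : AffinePair i i'} (h : v ≤ w) : v.left ≤ w.left := by
  obtain ⟨b, rfl⟩ := h; exact M.basicOpen_le _

theorem right_mono {v w : AffinePair i i'} (h : v ≤ w) : v.right ≤ w.right := by
  obtain ⟨b, rfl⟩ := h; exact M'.basicOpen_le _

/-- The pair of sections that cuts `u` out of `w` also cuts it out of `v`, after restriction to `v`.
-/
theorem le_of_le_of_subset {u v w : AffinePair i i'} (h : u ≤ w) (hv : u.left ≤ v.left)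
    (hv' : u.right ≤ v.right) (hw : v.left ≤ w.left) (hw' : v.right ≤ w.right) : u ≤ v := by
  obtain ⟨b, rfl⟩ := h
  refine ⟨pairRes hw hw' b, ext ?_ ?_⟩
  · refine Eq.trans ?_ (basicOpen_sectionRes hw b.1.1).symm
    exact (inf_eq_right.2 hv).symm
  · refine Eq.trans ?_ (basicOpen_sectionRes hw' b.1.2).symm
    exact (inf_eq_right.2 hv').symm

variable [IsClosedImmersion i']

theorem swap_le_swap {v w : AffinePair i i'} (h : v ≤ w) : v.swap ≤ w.swap := by
  obtain ⟨b, rfl⟩ := h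
  exact ⟨⟨(b.1.2, b.1.1), mem_pairSubring_swap b.2⟩, rfl⟩

/-- Near a point of `X`, functions cutting out small neighbourhoods on each side are extended to
pairs and multiplied. Away from `X` a function on the left alone suffices, paired with zero. -/
theorem exists_le_of_mem_left (w : AffinePair i i') {O : M.Opens} {O' : M'.Opens}
    (hO : i ⁻¹ᵁ O = i' ⁻¹ᵁ O') {m : M} (hm : m ∈ O) (hw : m ∈ w.left) :
    ∃ v ≤ w, m ∈ v.left ∧ v.left ≤ O ∧ v.right ≤ O' := by
  by_cases hX : ∃ x, i x = m
  · obtain ⟨x, rfl⟩ := hX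
    have hx' : i' x ∈ w.right := w.preimage_eq.le (show x ∈ i ⁻¹ᵁ w.left from hw)
    have hxO : i' x ∈ O' := hO.le (show x ∈ i ⁻¹ᵁ O from hm)
    obtain ⟨f, hfO, hf⟩ := w.isAffineOpen_left.exists_basicOpen_le ⟨i x, hm⟩ hw
    obtain ⟨f', hff⟩ := w.ring_fst_surjective f
    obtain ⟨g', hgO, hg⟩ := w.isAffineOpen_right.exists_basicOpen_le ⟨i' x, hxO⟩ hx'
    obtain ⟨g, hgg⟩ := w.ring_snd_surjective g'
    have hg1 : i x ∈ M.basicOpen g :=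
      (preimage_basicOpen_eq w.preimage_eq ⟨_, hgg⟩).ge (show x ∈ i' ⁻¹ᵁ M'.basicOpen g' from hg)
    refine ⟨_, ⟨⟨_, hff⟩ * ⟨_, hgg⟩, rfl⟩, ?_, ?_, ?_⟩
    · exact (M.basicOpen_mul f g).ge ⟨hf, hg1⟩
    · exact (M.basicOpen_mul f g).le.trans (inf_le_left.trans hfO)
    · exact (M'.basicOpen_mul f' g').le.trans (inf_le_right.trans hgO)
  · let C : M.Opens := ⟨(Set.range i)ᶜ, i.isClosedEmbedding.isClosed_range.isOpen_compl⟩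
    obtain ⟨f, hfO, hf⟩ := w.isAffineOpen_left.exists_basicOpen_le (V := O ⊓ C)
      ⟨m, hm, fun ⟨x, hx⟩ => hX ⟨x, hx⟩⟩ hw
    have hbot : X.basicOpen (sectionPull i (le_refl (i ⁻¹ᵁ w.left)) f) = ⊥ := by
      rw [basicOpen_sectionPull]
      refine le_bot_iff.1 fun x hx => ?_
      exact (hfO hx.2).2 ⟨x, rfl⟩
    obtain ⟨n, hn⟩ := (Scheme.isNilpotent_iff_basicOpen_eq_bot_of_isCompact
      (w.isAffineOpen_left.preimage i).isCompact _).2 hbot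
    -- A power of `f` vanishes on `X`, since `f` has empty nonvanishing locus there. The exponent `n
    -- + 1` is positive even for `n = 0`, so the basic open set of `f` does not change.
    have hmem : (f ^ (n + 1), 0) ∈ w.ring := mem_pairSubring_of_eq le_rfl le_rfl w.preimage_eq.le (by
      rw [map_pow, pow_succ, hn, zero_mul, map_zero])
    have hpow : M.basicOpen (f ^ (n + 1)) = M.basicOpen f := M.basicOpen_pow f n.succ_pos
    have hzero : M'.basicOpen (0 : Γ(M', w.right)) = ⊥ := M'.basicOpen_zero _
    exact ⟨_, ⟨⟨_, hmem⟩, rfl⟩, hpow.ge hf, hpow.le.trans (hfO.trans inf_le_left),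
      hzero.le.trans bot_le⟩

theorem exists_mem_left (i : X ⟶ M) (i' : X ⟶ M') [IsClosedImmersion i] [IsClosedImmersion i']
    (m : M) : ∃ w : AffinePair i i', m ∈ w.left := by
  by_cases hX : ∃ x, i x = m
  · obtain ⟨x, rfl⟩ := hX
    obtain ⟨_, ⟨W, hW, rfl⟩, hx, -⟩ := M.isBasis_affineOpens.exists_subset_of_mem_open
      (Set.mem_univ (i x)) isOpen_univ
    obtain ⟨_, ⟨W', hW', rfl⟩, hx', -⟩ := M'.isBasis_affineOpens.exists_subset_of_mem_open
      (Set.mem_univ (i' x)) isOpen_univ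
    -- The traces are equalized by shrinking first on the left, then on the right, and finally by
    -- lifting to the left the function `f'` on the trace: `g` and `f'` then have the same
    -- nonvanishing locus on `X`.
    obtain ⟨V, hxV, hV⟩ := exists_preimage_le i (U := i' ⁻¹ᵁ W') hx'
    obtain ⟨f, hfV, hf⟩ := hW.exists_basicOpen_le ⟨i x, hxV⟩ hx
    obtain ⟨V', hxV', hV'⟩ := exists_preimage_le i' (U := i ⁻¹ᵁ M.basicOpen f) hf
    obtain ⟨f', hfV', hf'⟩ := hW'.exists_basicOpen_le ⟨i' x, hxV'⟩ hx'
    obtain ⟨g, hg⟩ := sectionPull_surjective i (hW.basicOpen f) rfl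
      (sectionPull i' ((i.preimage_mono hfV).trans hV) f')
    have h1 : i ⁻¹ᵁ M.basicOpen g = i' ⁻¹ᵁ M'.basicOpen f' := by
      have h2 := basicOpen_sectionPull i (le_refl (i ⁻¹ᵁ M.basicOpen f)) g
      rw [hg, basicOpen_sectionPull, inf_eq_right.2 (i.preimage_mono (M.basicOpen_le g)),
        inf_eq_right.2 ((i'.preimage_mono hfV').trans hV')] at h2
      exact h2.symm
    exact ⟨⟨M.basicOpen g, M'.basicOpen f', (hW.basicOpen f).basicOpen g, hW'.basicOpen f', h1⟩,
      h1.ge (show x ∈ i' ⁻¹ᵁ M'.basicOpen f' from hf')⟩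
  · obtain ⟨_, ⟨W, hW, rfl⟩, hm, hWX⟩ := M.isBasis_affineOpens.exists_subset_of_mem_open
      (show m ∈ (Set.range i)ᶜ from fun ⟨x, hx⟩ => hX ⟨x, hx⟩)
      i.isClosedEmbedding.isClosed_range.isOpen_compl
    -- Off `X`, an affine neighbourhood which misses `X` is paired with the empty set.
    exact ⟨⟨W, ⊥, hW, isAffineOpen_bot _, le_antisymm (fun x hx => (hWX hx ⟨x, rfl⟩).elim)
      (fun x hx => hx.elim)⟩, hm⟩

theorem exists_mem_right (i : X ⟶ M) (i' : X ⟶ M') [IsClosedImmersion i] [IsClosedImmersion i']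
    (m : M') : ∃ w : AffinePair i i', m ∈ w.right :=
  (exists_mem_left i' i m).imp' swap fun _ h => h

/-- A basic pair of `v` inside the intersection need not be basic in `w`. Shrinking it once more
inside `w` gives a pair which is basic in `w`, hence in the intermediate pair, hence in `v`. -/
theorem exists_le_le_of_mem_left (v w : AffinePair i i') {m : M} (hv : m ∈ v.left)
    (hw : m ∈ w.left) : ∃ l ≤ v, l ≤ w ∧ m ∈ l.left := by
  have h : i ⁻¹ᵁ (v.left ⊓ w.left) = i' ⁻¹ᵁ (v.right ⊓ w.right) :=
    congrArg₂ (· ⊓ ·) v.preimage_eq w.preimage_eq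
  obtain ⟨l, hl, hml, h1, h2⟩ := v.exists_le_of_mem_left h ⟨hv, hw⟩ hv
  obtain ⟨l', hl', hml', h1', h2'⟩ := w.exists_le_of_mem_left l.preimage_eq hml hw
  exact ⟨l', (le_of_le_of_subset hl' h1' h2' (h1.trans inf_le_right)
    (h2.trans inf_le_right)).trans hl, hl', hml'⟩

theorem exists_le_le_of_mem_right (v w : AffinePair i i') {m : M'} (hv : m ∈ v.right)
    (hw : m ∈ w.right) : ∃ l ≤ v, l ≤ w ∧ m ∈ l.right := by
  obtain ⟨l, h1, h2, h3⟩ := v.swap.exists_le_le_of_mem_left w.swap hv hw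
  exact ⟨l.swap, swap_le_swap h1, swap_le_swap h2, h3⟩

end AffinePair

theorem homOfLE_toSpecΓ_specMap {M : Scheme.{u}} {U V : M.Opens} (h : U ≤ V) {R : Type u} [CommRing R]
    (f : R →+* Γ(M, V)) : M.homOfLE h ≫ V.toSpecΓ ≫ Spec.map (CommRingCat.ofHom f) =
      U.toSpecΓ ≫ Spec.map (CommRingCat.ofHom ((sectionRes h).comp f)) := by
  rw [← Scheme.Opens.toSpecΓ_SpecMap_presheaf_map_assoc, ← Spec.map_comp]
  rfl

/-! ### The diagram of spectra of rings of pairs. -/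

namespace AffinePair

variable {X M M' : Scheme.{u}} {i : X ⟶ M} {i' : X ⟶ M'}

/-- The first component of a pair of sections. -/
noncomputable def fst (w : AffinePair i i') : w.ring →+* Γ(M, w.left) :=
  (RingHom.fst _ _).comp w.ring.subtype

/-- The second component of a pair of sections. -/
noncomputable def snd (w : AffinePair i i') : w.ring →+* Γ(M', w.right) :=
  (RingHom.snd _ _).comp w.ring.subtype

theorem fst_surjective [IsClosedImmersion i'] (w : AffinePair i i') : Function.Surjective w.fst := fun s =>
  (w.ring_fst_surjective s).elim fun _ h => ⟨⟨_, h⟩, rfl⟩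

theorem snd_surjective [IsClosedImmersion i] (w : AffinePair i i') : Function.Surjective w.snd := fun s =>
  (w.ring_snd_surjective s).elim fun _ h => ⟨⟨_, h⟩, rfl⟩

variable (i i') [IsClosedImmersion i]

/-- The diagram of the spectra of the rings of pairs of sections. -/
noncomputable def specFunctor : AffinePair i i' ⥤ Scheme.{u} where
  obj w := Spec (.of w.ring)
  map {v w} h := Spec.map (CommRingCat.ofHom (pairRes (left_mono (leOfHom h)) (right_mono (leOfHom h))))
  map_id w := by
    rw [← Spec.map_id]
    refine congrArg Spec.map (CommRingCat.hom_ext (RingHom.ext fun s => Subtype.ext (Prod.ext ?_ ?_)))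
    · exact congrArg (fun g : Γ(M, w.left) ⟶ Γ(M, w.left) => g s.1.1) (M.presheaf.map_id _)
    · exact congrArg (fun g : Γ(M', w.right) ⟶ Γ(M', w.right) => g s.1.2) (M'.presheaf.map_id _)
  map_comp f g := by
    rw [← Spec.map_comp]
    refine congrArg Spec.map (CommRingCat.hom_ext (RingHom.ext fun s => Subtype.ext (Prod.ext ?_ ?_)))
    · exact (sectionRes_sectionRes _ _ s.1.1).symm
    · exact (sectionRes_sectionRes _ _ s.1.2).symm

variable {i i'}

theorem isLocalization_pairRes_basicOpen (w : AffinePair i i') (b : w.ring) :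
    @IsLocalization.Away _ _ b (w.basicOpen b).ring _
      (pairRes (left_mono ⟨b, rfl⟩) (right_mono ⟨b, rfl⟩)).toAlgebra :=
  isLocalization_pairRes w.isAffineOpen_left w.isAffineOpen_right w.preimage_eq _ _ b rfl rfl

instance isOpenImmersion_specFunctor_map {v w : AffinePair i i'} (h : v ⟶ w) :
    IsOpenImmersion ((specFunctor i i').map h) := by
  obtain ⟨b, rfl⟩ := leOfHom h
  let : Algebra w.ring (w.basicOpen b).ring :=
    (pairRes (left_mono ⟨b, rfl⟩) (right_mono ⟨b, rfl⟩)).toAlgebra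
  have : IsLocalization.Away b (w.basicOpen b).ring := w.isLocalization_pairRes_basicOpen b
  exact IsOpenImmersion.of_isLocalization (R := w.ring) (S := (w.basicOpen b).ring) b

theorem range_specFunctor_map (w : AffinePair i i') (b : w.ring) (h : w.basicOpen b ⟶ w) :
    Set.range ((specFunctor i i').map h) = (PrimeSpectrum.basicOpen b : Set (PrimeSpectrum w.ring)) := by
  let : Algebra w.ring (w.basicOpen b).ring :=
    (pairRes (left_mono ⟨b, rfl⟩) (right_mono ⟨b, rfl⟩)).toAlgebra
  have : IsLocalization.Away b (w.basicOpen b).ring := w.isLocalization_pairRes_basicOpen b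
  exact PrimeSpectrum.localization_away_comap_range (w.basicOpen b).ring b

/-- Two smaller pairs occupy the basic open sets of `b` and `c` in the spectrum for `w`; these meet
in that of `b * c`, which comes from a pair below both. -/
instance isLocallyDirected_specFunctor : (specFunctor i i' ⋙ Scheme.forget).IsLocallyDirected where
  cond {v v' w} f g x y hxy := by
    replace hxy : (specFunctor i i').map f x = (specFunctor i i').map g y := hxy
    obtain ⟨b, rfl⟩ := leOfHom f
    obtain ⟨c, rfl⟩ := leOfHom g
    have hb : (specFunctor i i').map f x ∈ Set.range ((specFunctor i i').map f) := ⟨x, rfl⟩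
    have hc : (specFunctor i i').map f x ∈ Set.range ((specFunctor i i').map g) := ⟨y, hxy.symm⟩
    rw [range_specFunctor_map] at hb hc
    have hl : w.basicOpen (b * c) ≤ w := ⟨_, rfl⟩
    have hlb : w.basicOpen (b * c) ≤ w.basicOpen b :=
      le_of_le_of_subset hl ((M.basicOpen_mul _ _).le.trans inf_le_left)
        ((M'.basicOpen_mul _ _).le.trans inf_le_left) (M.basicOpen_le _) (M'.basicOpen_le _)
    have hlc : w.basicOpen (b * c) ≤ w.basicOpen c :=
      le_of_le_of_subset hl ((M.basicOpen_mul _ _).le.trans inf_le_right)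
        ((M'.basicOpen_mul _ _).le.trans inf_le_right) (M.basicOpen_le _) (M'.basicOpen_le _)
    obtain ⟨z, hz⟩ : (specFunctor i i').map f x ∈ Set.range ((specFunctor i i').map (homOfLE hl)) := by
      rw [range_specFunctor_map, PrimeSpectrum.basicOpen_mul]
      exact ⟨hb, hc⟩
    refine ⟨_, homOfLE hlb, homOfLE hlc, z, ?_, ?_⟩
    · exact ((specFunctor i i').map f).isOpenEmbedding.injective ((congrArg
        (fun r : (specFunctor i i').obj _ ⟶ (specFunctor i i').obj w => r z)
        ((specFunctor i i').map_comp (homOfLE hlb) f).symm).trans hz)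
    · exact ((specFunctor i i').map g).isOpenEmbedding.injective ((congrArg
        (fun r : (specFunctor i i').obj _ ⟶ (specFunctor i i').obj w => r z)
        ((specFunctor i i').map_comp (homOfLE hlc) g).symm).trans (hz.trans hxy))

/-- The morphism of the left open set to the spectrum of the ring of pairs of sections. -/
noncomputable def leftHom (w : AffinePair i i') : w.left.toScheme ⟶ (specFunctor i i').obj w :=
  w.left.toSpecΓ ≫ Spec.map (CommRingCat.ofHom w.fst)

/-- The morphism of the right open set to the spectrum of the ring of pairs of sections. -/
noncomputable def rightHom (w : AffinePair i i') : w.right.toScheme ⟶ (specFunctor i i').obj w :=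
  w.right.toSpecΓ ≫ Spec.map (CommRingCat.ofHom w.snd)

theorem leftHom_naturality {v w : AffinePair i i'} (h : v ≤ w) :
    M.homOfLE (left_mono h) ≫ w.leftHom = v.leftHom ≫ (specFunctor i i').map (homOfLE h) := by
  refine (homOfLE_toSpecΓ_specMap _ w.fst).trans (Eq.trans ?_ (Category.assoc _ _ _).symm)
  exact congrArg (v.left.toSpecΓ ≫ ·) (Spec.map_comp
    (CommRingCat.ofHom (pairRes (left_mono h) (right_mono h)))
    (show CommRingCat.of v.ring ⟶ Γ(M, v.left) from CommRingCat.ofHom v.fst))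

theorem rightHom_naturality {v w : AffinePair i i'} (h : v ≤ w) :
    M'.homOfLE (right_mono h) ≫ w.rightHom = v.rightHom ≫ (specFunctor i i').map (homOfLE h) := by
  refine (homOfLE_toSpecΓ_specMap _ w.snd).trans (Eq.trans ?_ (Category.assoc _ _ _).symm)
  exact congrArg (v.right.toSpecΓ ≫ ·) (Spec.map_comp
    (CommRingCat.ofHom (pairRes (left_mono h) (right_mono h)))
    (show CommRingCat.of v.ring ⟶ Γ(M', v.right) from CommRingCat.ofHom v.snd))

/-- The preimage in the left open set of the basic open set of `b` is the basic open set of its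
first component. So the gluing adds no identifications among points of `M`. -/
theorem mem_left_of_leftHom_mem {v w : AffinePair i i'} (h : v ≤ w) (m : w.left.toScheme)
    (hm : w.leftHom m ∈ Set.range ((specFunctor i i').map (homOfLE h))) : w.left.ι m ∈ v.left := by
  obtain ⟨b, rfl⟩ := h
  rw [range_specFunctor_map] at hm
  exact (w.left.toSpecΓ_preimage_basicOpen b.1.1).le
    (show m ∈ w.left.toSpecΓ ⁻¹ᵁ PrimeSpectrum.basicOpen b.1.1 from hm)

theorem mem_right_of_rightHom_mem {v w : AffinePair i i'} (h : v ≤ w) (m : w.right.toScheme)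
    (hm : w.rightHom m ∈ Set.range ((specFunctor i i').map (homOfLE h))) :
    w.right.ι m ∈ v.right := by
  obtain ⟨b, rfl⟩ := h
  rw [range_specFunctor_map] at hm
  exact (w.right.toSpecΓ_preimage_basicOpen b.1.2).le
    (show m ∈ w.right.toSpecΓ ⁻¹ᵁ PrimeSpectrum.basicOpen b.1.2 from hm)

variable [IsClosedImmersion i']

instance isClosedImmersion_leftHom (w : AffinePair i i') : IsClosedImmersion w.leftHom := by
  have : IsIso w.left.toSpecΓ := inferInstanceAs (IsIso w.isAffineOpen_left.isoSpec.hom)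
  have := IsClosedImmersion.spec_of_surjective (CommRingCat.ofHom w.fst) w.fst_surjective
  exact inferInstanceAs (IsClosedImmersion (w.left.toSpecΓ ≫ Spec.map (CommRingCat.ofHom w.fst)))

instance isClosedImmersion_rightHom (w : AffinePair i i') : IsClosedImmersion w.rightHom := by
  have : IsIso w.right.toSpecΓ := inferInstanceAs (IsIso w.isAffineOpen_right.isoSpec.hom)
  have := IsClosedImmersion.spec_of_surjective (CommRingCat.ofHom w.snd) w.snd_surjective
  exact inferInstanceAs (IsClosedImmersion (w.right.toSpecΓ ≫ Spec.map (CommRingCat.ofHom w.snd)))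

/-- The kernels of the two projections have product zero, so every prime contains one of them. Hence
the glued scheme is the union of the images of `M` and `M'`, which gives its quasi-compactness. -/
theorem exists_leftHom_or_rightHom_eq (w : AffinePair i i') (q : (specFunctor i i').obj w) :
    (∃ m, w.leftHom m = q) ∨ ∃ m, w.rightHom m = q := by
  have h : RingHom.ker w.fst * RingHom.ker w.snd ≤ PrimeSpectrum.asIdeal q := by
    refine Ideal.mul_le.2 fun s hs t ht => ?_
    have : s * t = 0 := by
      refine Subtype.ext (Prod.ext ?_ ?_)
      · exact (congrArg (· * t.1.1) hs).trans (zero_mul _)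
      · exact (congrArg (s.1.2 * ·) ht).trans (mul_zero _)
    rw [this]
    exact zero_mem _
  have : IsIso w.left.toSpecΓ := inferInstanceAs (IsIso w.isAffineOpen_left.isoSpec.hom)
  have : IsIso w.right.toSpecΓ := inferInstanceAs (IsIso w.isAffineOpen_right.isoSpec.hom)
  refine (q.isPrime.mul_le.1 h).imp (fun h => ?_) (fun h => ?_)
  · obtain ⟨y, hy⟩ := (range_comap_of_surjective _ w.fst w.fst_surjective).ge h
    obtain ⟨m, rfl⟩ := w.left.toSpecΓ.homeomorph.surjective y
    exact ⟨m, hy⟩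
  · obtain ⟨y, hy⟩ := (range_comap_of_surjective _ w.snd w.snd_surjective).ge h
    obtain ⟨m, rfl⟩ := w.right.toSpecΓ.homeomorph.surjective y
    exact ⟨m, hy⟩

end AffinePair

/-! ### Finite type and structure maps over the ground field. -/

/-- A ring with jointly injective surjections to two algebras of finite type is itself of finite
type. -/
theorem finiteType_of_jointly_injective {k B A A' : Type u} [Field k] [CommRing B] [CommRing A]
    [CommRing A'] (κ : k →+* B) (α : B →+* A) (α' : B →+* A') (hα : Function.Surjective α)
    (hα' : Function.Surjective α') (hinj : Function.Injective (α.prod α'))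
    (h : (α.comp κ).FiniteType) (h' : (α'.comp κ).FiniteType) : κ.FiniteType := by
  classical
  let := κ.toAlgebra
  let := α.toAlgebra
  let := α'.toAlgebra
  let := (α.comp κ).toAlgebra
  let := (α'.comp κ).toAlgebra
  have : Algebra.FiniteType k A := h
  have : Algebra.FiniteType k A' := h'
  have : IsScalarTower k B (A × A') := .of_algebraMap_eq' rfl
  -- The two idempotents span `A × A'` over `B`, so the Artin–Tate lemma applies to `k → B ⊆ A ×
  -- A'`.
  have hBC : (⊤ : Submodule B (A × A')).FG := by
    refine ⟨{(1, 0), (0, 1)}, top_le_iff.1 fun z _ => ?_⟩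
    obtain ⟨⟨b, hb⟩, ⟨b', hb'⟩⟩ := And.intro (hα z.1) (hα' z.2)
    have hz : z = b • (1, 0) + b' • (0, 1) := by
      refine Prod.ext ?_ ?_
      · change z.1 = b • 1 + b' • 0
        rw [smul_zero, add_zero, ← hb]
        exact (mul_one _).symm.trans (Algebra.smul_def _ _).symm
      · change z.2 = b • 0 + b' • 1
        rw [smul_zero, zero_add, ← hb']
        exact (mul_one _).symm.trans (Algebra.smul_def _ _).symm
    rw [hz]
    exact add_mem (Submodule.smul_mem _ _ (Submodule.subset_span (by simp)))
      (Submodule.smul_mem _ _ (Submodule.subset_span (by simp)))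
  have hfg : Algebra.FiniteType k (A × A') := inferInstance
  exact ⟨fg_of_fg_of_fg k B (A × A') hfg.1 hBC hinj⟩

section Field

variable {X M : Scheme.{u}} {k : Type u} [Field k]

/-- The ring homomorphism from the ground field to the sections over an open set. -/
noncomputable def sectionField (q : M ⟶ Spec (.of k)) (W : M.Opens) : k →+* Γ(M, W) :=
  (sectionPull q (le_top : W ≤ q ⁻¹ᵁ ⊤)).comp (Scheme.ΓSpecIso (.of k)).inv.hom

theorem ι_comp_eq (q : M ⟶ Spec (.of k)) (W : M.Opens) :
    W.ι ≫ q = W.toSpecΓ ≫ Spec.map (CommRingCat.ofHom (sectionField q W)) := by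
  have e : W ≤ q ⁻¹ᵁ ⊤ := le_top
  have h : CommRingCat.ofHom (sectionField q W) =
      (Scheme.ΓSpecIso (.of k)).inv ≫ q.appLE ⊤ W e := rfl
  rw [h, Spec.map_comp, Scheme.Opens.toSpecΓ_SpecMap_appLE_assoc, Scheme.Opens.toSpecΓ_top,
    Category.assoc, Scheme.Hom.resLE_comp_ι_assoc, toSpecΓ_SpecMap_ΓSpecIso_inv, Category.comp_id]

theorem sectionRes_sectionField (q : M ⟶ Spec (.of k)) {O W : M.Opens} (h : O ≤ W) (c : k) :
    sectionRes h (sectionField q W c) = sectionField q O c :=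
  sectionRes_sectionPull q (le_top : W ≤ q ⁻¹ᵁ ⊤) h ((Scheme.ΓSpecIso (.of k)).inv.hom c)

theorem sectionPull_sectionField (i : X ⟶ M) (q : M ⟶ Spec (.of k)) {U : X.Opens} {W : M.Opens}
    (h : U ≤ i ⁻¹ᵁ W) (c : k) :
    sectionPull i h (sectionField q W c) = sectionField (i ≫ q) U c :=
  congrArg (fun g : Γ(Spec (.of k), ⊤) ⟶ Γ(X, U) => g ((Scheme.ΓSpecIso (.of k)).inv c))
    (Scheme.Hom.appLE_comp_appLE i q ⊤ W U le_top h)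

theorem finiteType_sectionField (q : M ⟶ Spec (.of k)) [LocallyOfFiniteType q] {W : M.Opens}
    (hW : IsAffineOpen W) : (sectionField q W).FiniteType :=
  (q.finiteType_appLE (isAffineOpen_top _) hW le_top).comp
    (.of_surjective _ (ConcreteCategory.bijective_of_isIso (Scheme.ΓSpecIso (.of k)).inv).surjective)

end Field

/-! ### A common ambient scheme for two embeddings. -/

section Ambient

variable {X M M' : Scheme.{u}} {i : X ⟶ M} {i' : X ⟶ M'} {k : Type u} [Field k]

/-- The ring homomorphism from the ground field to the pairs of sections which agree on `X`. -/
noncomputable def pairField (q : M ⟶ Spec (.of k)) (q' : M' ⟶ Spec (.of k)) (h : i ≫ q = i' ≫ q')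
    (w : AffinePair i i') : k →+* w.ring :=
  ((sectionField q w.left).prod (sectionField q' w.right)).codRestrict _ fun c U hU hU' => by
    refine (sectionPull_sectionField i q hU c).trans (Eq.trans ?_
      (sectionPull_sectionField i' q' hU' c).symm)
    rw [h]

variable [IsClosedImmersion i]

theorem AffinePair.resLE_leftHom (w : AffinePair i i') :
    i.resLE w.left (i ⁻¹ᵁ w.left) le_rfl ≫ w.leftHom =
      i'.resLE w.right (i ⁻¹ᵁ w.left) w.preimage_eq.le ≫ w.rightHom := by
  refine (Scheme.Opens.toSpecΓ_SpecMap_appLE_assoc i _ _ _ _).symm.trans (Eq.trans ?_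
    (Scheme.Opens.toSpecΓ_SpecMap_appLE_assoc i' _ _ _ _))
  refine congrArg ((i ⁻¹ᵁ w.left).toSpecΓ ≫ ·) ?_
  refine (Spec.map_comp _ _).symm.trans (Eq.trans ?_ (Spec.map_comp _ _))
  exact congrArg Spec.map (CommRingCat.hom_ext (RingHom.ext fun s => s.2 _ _ _))

variable [IsClosedImmersion i']

theorem finiteType_pairField (q : M ⟶ Spec (.of k)) (q' : M' ⟶ Spec (.of k))
    (h : i ≫ q = i' ≫ q') [LocallyOfFiniteType q] [LocallyOfFiniteType q'] (w : AffinePair i i') :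
    (pairField q q' h w).FiniteType :=
  finiteType_of_jointly_injective _ w.fst w.snd w.fst_surjective w.snd_surjective
    Subtype.val_injective (finiteType_sectionField q w.isAffineOpen_left)
    (finiteType_sectionField q' w.isAffineOpen_right)

variable {p : X ⟶ Spec (.of k)}

/-- Any two ambient embeddings are contained in a third one. -/
theorem exists_common_ambient (E E' : AmbientEmbedding p) :
    ∃ N : AmbientEmbedding p, Nonempty (E.Hom N) ∧ Nonempty (E'.Hom N) := by
  -- The common ambient scheme is the colimit of this diagram, that is, `M` and `M'` glued along
  -- `X`.
  let F := AffinePair.specFunctor E.emb E'.emb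
  have := E.locallyOfFiniteType
  have := E'.locallyOfFiniteType
  have := E.quasiCompact
  have := E'.quasiCompact
  have hE : E.emb ≫ E.str = E'.emb ≫ E'.str := E.emb_str.trans E'.emb_str.symm
  obtain ⟨g, hgc, hg⟩ := exists_isClosedImmersion_colimit F (W := AffinePair.left)
    (fun _ _ h => AffinePair.left_mono h) (AffinePair.exists_mem_left E.emb E'.emb)
    (fun _ v w => v.exists_le_le_of_mem_left w) (fun w => w.leftHom)
    (fun h => AffinePair.leftHom_naturality h) (fun h => AffinePair.mem_left_of_leftHom_mem h)
  obtain ⟨g', hgc', hg'⟩ := exists_isClosedImmersion_colimit F (W := AffinePair.right)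
    (fun _ _ h => AffinePair.right_mono h) (AffinePair.exists_mem_right E.emb E'.emb)
    (fun _ v w => v.exists_le_le_of_mem_right w) (fun w => w.rightHom)
    (fun h => AffinePair.rightHom_naturality h) (fun h => AffinePair.mem_right_of_rightHom_mem h)
  let s : Limits.Cocone F :=
    { pt := Spec (.of k)
      ι :=
        { app := fun w => Spec.map (CommRingCat.ofHom (pairField E.str E'.str hE w))
          naturality := fun v w h => by
            refine (Spec.map_comp _ _).symm.trans (Eq.trans ?_ (Category.comp_id _).symm)
            refine congrArg Spec.map (CommRingCat.hom_ext (RingHom.ext fun c =>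
              Subtype.ext (Prod.ext ?_ ?_)))
            · exact sectionRes_sectionField _ _ c
            · exact sectionRes_sectionField _ _ c } }
  let str : Limits.colimit F ⟶ Spec (.of k) := Limits.colimit.desc F s
  have hstr (w) : Limits.colimit.ι F w ≫ str =
      Spec.map (CommRingCat.ofHom (pairField E.str E'.str hE w)) := Limits.colimit.ι_desc s w
  -- On the trace of an affine pair both composites are given by restricting a pair of sections to
  -- `X`, where its components agree.
  have hemb : E.emb ≫ g = E'.emb ≫ g' := by
    refine Scheme.hom_ext_of_forall _ _ fun x => ?_
    obtain ⟨w, hw⟩ := AffinePair.exists_mem_left E.emb E'.emb (E.emb x)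
    refine ⟨E.emb ⁻¹ᵁ w.left, hw, ?_⟩
    rw [← Scheme.Hom.resLE_comp_ι_assoc E.emb (U := w.left) le_rfl,
      ← Scheme.Hom.resLE_comp_ι_assoc E'.emb (U := w.right) w.preimage_eq.le, hg, hg']
    exact congrArg (· ≫ Limits.colimit.ι F w) w.resLE_leftHom
  have hgstr : g ≫ str = E.str := by
    refine Scheme.hom_ext_of_forall _ _ fun m => ?_
    obtain ⟨w, hw⟩ := AffinePair.exists_mem_left E.emb E'.emb m
    refine ⟨w.left, hw, ?_⟩
    rw [reassoc_of% hg, hstr, ι_comp_eq]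
    refine (Category.assoc _ _ _).trans (congrArg (w.left.toSpecΓ ≫ ·) ?_)
    exact (Spec.map_comp _ (CommRingCat.ofHom w.fst)).symm
  have hgstr' : g' ≫ str = E'.str := by
    refine Scheme.hom_ext_of_forall _ _ fun m => ?_
    obtain ⟨w, hw⟩ := AffinePair.exists_mem_right E.emb E'.emb m
    refine ⟨w.right, hw, ?_⟩
    rw [reassoc_of% hg', hstr, ι_comp_eq]
    refine (Category.assoc _ _ _).trans (congrArg (w.right.toSpecΓ ≫ ·) ?_)
    exact (Spec.map_comp _ (CommRingCat.ofHom w.snd)).symm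
  have hft : LocallyOfFiniteType str := by
    have : IsZariskiLocalAtSource @LocallyOfFiniteType :=
      HasRingHomProperty.instIsZariskiLocalAtSource
    refine (IsZariskiLocalAtSource.iff_of_openCover (P := @LocallyOfFiniteType)
      (Scheme.IsLocallyDirected.openCover F)).2 fun (w : AffinePair E.emb E'.emb) => ?_
    change LocallyOfFiniteType (Limits.colimit.ι F w ≫ str)
    rw [hstr]
    exact (HasRingHomProperty.Spec_iff (P := @LocallyOfFiniteType)).2
      (finiteType_pairField E.str E'.str hE w)
  have hqc : QuasiCompact str := by
    have h1 : CompactSpace E.M := QuasiCompact.compactSpace_of_compactSpace E.str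
    have h2 : CompactSpace E'.M := QuasiCompact.compactSpace_of_compactSpace E'.str
    suffices h4 : IsCompact (Set.univ : Set (Limits.colimit F).carrier) from
      have : CompactSpace (Limits.colimit F).carrier := ⟨h4⟩
      quasiCompact_of_compactSpace str

    have h3 : Set.range g ∪ Set.range g' = Set.univ := by
      refine Set.eq_univ_of_forall fun n => ?_
      obtain ⟨w, q, rfl⟩ := Scheme.IsLocallyDirected.ι_jointly_surjective F n
      refine (w.exists_leftHom_or_rightHom_eq q).imp ?_ ?_
      · rintro ⟨m, rfl⟩
        exact ⟨w.left.ι m, congrArg (fun f : w.left.toScheme ⟶ Limits.colimit F => f m) (hg w)⟩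
      · rintro ⟨m, rfl⟩
        exact ⟨w.right.ι m, congrArg (fun f : w.right.toScheme ⟶ Limits.colimit F => f m) (hg' w)⟩
    rw [← h3]
    exact (isCompact_range g.continuous).union (isCompact_range g'.continuous)
  exact ⟨{ M := Limits.colimit F
           str := str
           locallyOfFiniteType := hft
           quasiCompact := hqc
           emb := E.emb ≫ g
           isClosedImmersion := inferInstance
           emb_str := by rw [Category.assoc, hgstr, E.emb_str] },
    ⟨{ hom := g, isClosedImmersion := hgc, hom_str := hgstr, emb_hom := rfl }⟩,
    ⟨{ hom := g', isClosedImmersion := hgc', hom_str := hgstr', emb_hom := hemb.symm }⟩⟩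

end Ambient

/-! ### Components of a section of the inverse limit. -/

section Sheaf

variable {X Y : Scheme.{u}} (j : Y ⟶ X) {k : Type u} [Field k] {p : X ⟶ Spec (.of k)}

/-- Both components are the images of the component at a common ambient scheme, and that one lifts
to the symmetric algebra. Compatibility of the family is used only here in the comparison of
components. -/
theorem exists_eq_ofSym_of_mem_absQSym (E E' : AmbientEmbedding p) {U : X.Opens}
    (s : (absQSym j p).sections U) (x : U) :
    ∃ z, ((absQSymProj j p E).app U s).1 x = QSymAt.ofSym j E.emb x z ∧
      ((absQSymProj j p E').app U s).1 x = QSymAt.ofSym j E'.emb x z := by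
  obtain ⟨N, ⟨f⟩, ⟨f'⟩⟩ := exists_common_ambient E E'
  obtain ⟨z, hz⟩ := QSymAt.ofSym_surjective j x.1 (((absQSymProj j p N).app U s).1 x)
  refine ⟨z, ?_, ?_⟩
  · rw [← transition_absQSymProj j p f, ← qsymTransition_ofSym j f.emb_hom, hz]; rfl
  · rw [← transition_absQSymProj j p f', ← qsymTransition_ofSym j f'.emb_hom, hz]; rfl

end Sheaf

end QuasiSym

/-! ### The comparison with a nonsingular ambient scheme. -/

open AlgebraicGeometry QuasiSym in
theorem mainTheorem4 {k : Type u} [Field k] {X Y : Scheme.{u}} (p : X ⟶ Spec (.of k))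
    [LocallyOfFiniteType p] [QuasiCompact p] (j : Y ⟶ X) [IsClosedImmersion j]
    (E : AmbientEmbedding p) (hE : E.IsNonsingular) :
    (absQSymProj j p E).IsIso ∧
      ∀ E' : AmbientEmbedding p, E'.IsNonsingular →
        ∃ g : (qSym j E.emb).Hom (qSym j E'.emb), g.IsIso ∧
          ∀ (U : X.Opens) (s : (absQSym j p).sections U),
            g.app U ((absQSymProj j p E).app U s) = (absQSymProj j p E').app U s := by
  -- The comparison homomorphism out of a nonsingular `E₁`, characterized by its effect on images of
  -- elements of the symmetric algebra; `E₂` is arbitrary.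
  have key : ∀ (E₁ : AmbientEmbedding p), E₁.IsNonsingular → ∀ E₂ : AmbientEmbedding p,
      ∃ g : (qSym j E₁.emb).Hom (qSym j E₂.emb), ∀ (U : X.Opens) (s) (x : U) (z),
        s.1 x = QSymAt.ofSym j E₁.emb x z → (g.app U s).1 x = QSymAt.ofSym j E₂.emb x z := by
    intro E₁ h₁ E₂
    choose f hf using exists_stalk_comparison j E₁ E₂ h₁
    exact ⟨qSymHom j f hf, fun U s x z h => (congrArg (f x) h).trans (hf x z)⟩
  have hproj : ∀ (E₁ E₂ : AmbientEmbedding p) (g : (qSym j E₁.emb).Hom (qSym j E₂.emb)),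
      (∀ (U : X.Opens) (s) (x : U) (z), s.1 x = QSymAt.ofSym j E₁.emb x z →
        (g.app U s).1 x = QSymAt.ofSym j E₂.emb x z) →
      ∀ (U : X.Opens) (s : (absQSym j p).sections U),
        g.app U ((absQSymProj j p E₁).app U s) = (absQSymProj j p E₂).app U s := by
    intro E₁ E₂ g hg U s
    refine Subtype.ext (funext fun x => ?_)
    obtain ⟨z, h₁, h₂⟩ := exists_eq_ofSym_of_mem_absQSym j E₁ E₂ s x
    exact (hg U _ x z h₁).trans h₂.symm
  refine ⟨?_, fun E' hE' => ?_⟩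
  · choose g hg using key E hE
    -- The comparison maps to all ambient schemes form a cone, because they and the transition maps
    -- are maps under the symmetric algebra. The induced map `h` to the inverse limit is the
    -- candidate inverse of the projection.
    obtain ⟨h, hh, -⟩ := existsUnique_lift j p (qSym j E.emb) g fun E₁ E₂ f U s => by
      refine Subtype.ext (funext fun x => ?_)
      obtain ⟨z, hz⟩ := QSymAt.ofSym_surjective j x.1 (s.1 x)
      rw [hg E₁ U s x z hz.symm, ← qsymTransition_ofSym j f.emb_hom, ← hg E₂ U s x z hz.symm]
      rfl
    refine ⟨h, fun U s => ?_, fun U t => ?_⟩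
    · refine Subtype.ext (funext fun x => funext fun E₁ => ?_)
      -- This direction needs the common ambient scheme, through `hproj`: the component at `E`
      -- determines the component at every `E₁`.
      have h₁ := (hh E₁ U ((absQSymProj j p E).app U s)).trans (hproj E E₁ (g E₁) (hg E₁) U s)
      exact congrFun (congrArg Subtype.val h₁) x
    -- The other composite is the comparison of `E` with itself, which fixes every image of the
    -- symmetric algebra and so is the identity.
    · rw [hh]
      refine Subtype.ext (funext fun x => ?_)
      obtain ⟨z, hz⟩ := QSymAt.ofSym_surjective j x.1 (t.1 x)
      rw [hg E U t x z hz.symm, hz]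
  · obtain ⟨g, hg⟩ := key E hE E'
    obtain ⟨g', hg'⟩ := key E' hE' E
    refine ⟨g, ⟨g', fun U s => ?_, fun U s => ?_⟩, hproj E E' g hg⟩
    · refine Subtype.ext (funext fun x => ?_)
      obtain ⟨z, hz⟩ := QSymAt.ofSym_surjective j x.1 (s.1 x)
      rw [hg' U _ x z (hg U s x z hz.symm), hz]
    · refine Subtype.ext (funext fun x => ?_)
      obtain ⟨z, hz⟩ := QSymAt.ofSym_surjective j x.1 (s.1 x)
      rw [hg U _ x z (hg' U s x z hz.symm), hz]
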